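/- **Model.** Let $m\ge 1$, $n\ge 2$. Events of class $k\in\{1,\dots,m\}$ occur at the times of a Poisson process $N^{(k)}$ with intensity $\beta_k>0$; write $\beta=\sum_k\beta_k$. An event of class $k$ causes a claim in line $j\in\{1,\dots,n\}$ with probability $p_{kj}\in[0,1]$, and the severity of a claim in line $j$ has a distribution $F_j$ on $[0,\infty)$ with finite mean. The Poisson processes, the hits of the individual lines at the individual events, and the severities $U$ are all independent. For each line $j$ let $\mathcal F_j$ be a family of Borel functions $R:[0,\infty)\to[0,\infty)$ with $0\le R(\alpha)\le\alpha$ (retained loss functions), and let $\boldsymbol{\mathcal F}=\mathcal F_1\times\dots\times\mathcal F_n$. For $\boldsymbol R\in\boldsymbol{\mathcal F}$ let $$G^{\boldsymbol R}(\alpha)=\sum_{k=1}^m\frac{\beta_k}{\beta}\sum_{A\subseteq\{1,\dots,n\}}\ \prod_{z\in A}p_{kz}\prod_{z\notin A}(1-p_{kz})\;P\Big(\sum_{z\in A}R_z(U_z)\le\alpha\Big)$$ with independent $U_z\sim F_z$, and let $G$ be $G^{\boldsymbol R}$ for $R_z=\mathrm{id}$. With safety loadings $\eta_1\ge\eta>0$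 put $p_{\boldsymbol R}=(1+\eta)\beta\int\alpha\,dG-(1+\eta_1)\beta\big(\int\alpha\,dG-\int\alpha\,dG^{\boldsymbol R}\big)$. Assume that $p_{\boldsymbol R}\ge 0$ for at least one $\boldsymbol R\in\boldsymbol{\mathcal F}$ (this holds, for instance, if it is possible not to reinsure). Let $\delta>0$. Let $(\mathcal F_t)$ be the (uncompleted) filtration generated by the uncontrolled surplus processes of the $n$ lines, on the canonical probability space of the above processes. An admissible strategy $\pi=(\boldsymbol R,D)$ consists of a map $(\omega,t)\mapsto\boldsymbol R_t(\omega)\in\boldsymbol{\mathcal F}$ such that $(\omega,\alpha,t)\mapsto\boldsymbol R_t(\omega,\alpha)$ is measurable and $\boldsymbol R_t(\cdot,\alpha)$ is $\mathcal F_{t-}$-measurable for all $t,\alpha$, and a nondecreasing left-continuous process $D$ with $D_0=0$ and $D_t$ $\mathcal F_{t-}$-measurable for all $t$. For initial surplus $x\ge0$ the controlled surplus $X^\pi(t)$ is $x+\int_0^t p_{\boldsymbol R_s}ds-D_t$ minus the retained parts of all claims up to time $t$, where a claim $U$ in line $j$ at time $s$ has retained part $R_{j,s}(U)$. Put $$\tau^\pi=\inf\{t\ge0:X^\pi(t)<0\},\qquad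 V^\pi(x)=E\Big[\int_{[0,\tau^\pi)}e^{-\delta s}dD_s\Big],\qquad V(x)=\sup_\pi V^\pi(x),$$ where $dD([a,b))=D_b-D_a$. **HJB equation.** For $u:[0,\infty)\to\mathbb R$, $d\in\mathbb R$, $x\ge 0$ put $$\mathcal L_{\boldsymbol R}(x,d,u)=p_{\boldsymbol R}\,d-(\delta+\beta)u(x)+\beta\int_{[0,x]}u(x-\alpha)\,dG^{\boldsymbol R}(\alpha),\qquad H(x,d,u)=\max\Big\{1-d,\ \sup_{\boldsymbol R\in\boldsymbol{\mathcal F}}\mathcal L_{\boldsymbol R}(x,d,u)\Big\}.$$ A locally Lipschitz $u:[0,\infty)\to\mathbb R$ is a viscosity supersolution of $\max\{1-u',\sup_{\boldsymbol R}\mathcal L_{\boldsymbol R}(u)\}=0$ if $H(x,d,u)\le0$ for all $x>0$ and all $d$ with $$\liminf_{h\to0^+}\tfrac{u(x+h)-u(x)}h\ge d\ge\limsup_{h\to0^-}\tfrac{u(x+h)-u(x)}h,$$ a viscosity subsolution if $H(x,d,u)\ge0$ for all $x>0$ and all $d$ with $$\liminf_{h\to0^-}\tfrac{u(x+h)-u(x)}h\ge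 d\ge\limsup_{h\to0^+}\tfrac{u(x+h)-u(x)}h,$$ and a viscosity solution if it is both. The class $L$ consists of the locally Lipschitz $u:[0,\infty)\to\mathbb R$ with $u(y)-u(x)\ge y-x$ for $0\le x<y$ and, for some constant $k>0$, $u(x)\le x+k$ for all $x$. Let $L^*$ be the set of viscosity solutions in $L$. **Proposition 4.4.** $V$ is finite, and it is the smallest viscosity supersolution in $L$: it is a viscosity supersolution in $L$, and $V\le u$ pointwise for every viscosity supersolution $u\in L$. If moreover every $\mathcal F_j$ is sequentially compact for pointwise convergence (for instance the family of proportional contracts $b\alpha$, $0\le b\le1$, of excess-of-loss contracts $\min\{\alpha,M\}$, or of limited excess-of-loss contracts $\min\{\alpha,M\}+(\alpha-M-L)^+$, $0\le M,L\le\infty$), then $V$ is the unique $u\in L^*$ with $u(0)=\inf_{w\in L^*}w(0)$. -/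

import Mathlib

open MeasureTheory ProbabilityTheory Filter Topology
open scoped NNReal ENNReal

noncomputable section

/-- Parameters of the insurance model with `m` classes of claim-causing events and `n` lines of
business. -/
structure RiskModel (m n : ℕ) where
  /-- intensity of the Poisson process of events of class `k` -/
  β : Fin m → ℝ
  β_pos : ∀ k, 0 < β k
  /-- `hit k j` is the probability that an event of class `k` causes a claim in line `j` -/
  hit : Fin m → Fin n → ℝ≥0
  hit_le_one : ∀ k j, hit k j ≤ 1
  /-- distribution of the claim severities of line `j` -/
  F : Fin n → Measure ℝ≥0
  F_prob : ∀ j, IsProbabilityMeasure (F j)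
  F_integrable : ∀ j, Integrable (fun a : ℝ≥0 => (a : ℝ)) (F j)
  /-- safety loading of the insurer -/
  η : ℝ
  /-- safety loading of the reinsurer -/
  η₁ : ℝ
  η_pos : 0 < η
  η_le : η ≤ η₁
  /-- discount rate -/
  δ : ℝ
  δ_pos : 0 < δ
  /-- `fam j` is the family of retained loss functions available in line `j` -/
  fam : Fin n → Set (ℝ≥0 → ℝ≥0)
  fam_measurable : ∀ j, ∀ R ∈ fam j, Measurable R
  fam_le : ∀ j, ∀ R ∈ fam j, ∀ a, R a ≤ a

/-- What is attached to one event: the waiting time since the preceding event of the same class,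
the lines that are hit, and the severities of the (potential) claims in the lines. -/
abbrev Mark (n : ℕ) : Type := ℝ≥0 × (Fin n → Bool) × (Fin n → ℝ≥0)

/-- The sample space: `ω (k, i)` describes the `i`-th event of class `k` (`i = 0, 1, …`). -/
abbrev Scenario (m n : ℕ) : Type := Fin m × ℕ → Mark n

/-- The Bernoulli distribution with success probability `p ≤ 1`. -/
def bernoulliLaw (p : ℝ≥0) : Measure Bool :=
  (p : ℝ≥0∞) • Measure.dirac true + ((1 - p : ℝ≥0) : ℝ≥0∞) • Measure.dirac false

theorem isProbabilityMeasure_bernoulliLaw {p : ℝ≥0} (hp : p ≤ 1) :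
    IsProbabilityMeasure (bernoulliLaw p) := by
  constructor
  simp only [bernoulliLaw, Measure.coe_add, Measure.coe_smul, Pi.add_apply, Pi.smul_apply,
    measure_univ, smul_eq_mul, mul_one]
  rw [← ENNReal.coe_add, add_tsub_cancel_of_le hp, ENNReal.coe_one]

namespace RiskModel

variable {m n : ℕ} (M : RiskModel m n)

instance instProbF (j : Fin n) : IsProbabilityMeasure (M.F j) := M.F_prob j

instance instProbHit (k : Fin m) (j : Fin n) : IsProbabilityMeasure (bernoulliLaw (M.hit k j)) :=
  isProbabilityMeasure_bernoulliLaw (M.hit_le_one k j)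

instance instProbExp (k : Fin m) : IsProbabilityMeasure (expMeasure (M.β k)) :=
  isProbabilityMeasure_expMeasure (M.β_pos k)

/-- Law of the waiting times between events of class `k`: exponential with parameter `β k`. -/
def gapLaw (k : Fin m) : Measure ℝ≥0 := (expMeasure (M.β k)).map Real.toNNReal

instance instProbGap (k : Fin m) : IsProbabilityMeasure (M.gapLaw k) :=
  Measure.isProbabilityMeasure_map measurable_real_toNNReal.aemeasurable

/-- Law of the mark of an event of class `k`: waiting time, hits of the single lines and claim
severities of the single lines are all independent. -/
def markLaw (k : Fin m) : Measure (Mark n) :=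
  (M.gapLaw k).prod
    ((Measure.pi fun j => bernoulliLaw (M.hit k j)).prod (Measure.pi M.F))

instance instProbMark (k : Fin m) : IsProbabilityMeasure (M.markLaw k) := by
  unfold markLaw; infer_instance

/-- The probability measure: the marks of all events of all classes are independent. -/
def prob : Measure (Scenario m n) := Measure.infinitePi fun ki : Fin m × ℕ => M.markLaw ki.1

end RiskModel

section Processes

variable {m n : ℕ}

/-- Time of the `i`-th event of class `k`. -/
def eventTime (k : Fin m) (i : ℕ) (ω : Scenario m n) : ℝ≥0 :=
  ∑ l ∈ Finset.range (i + 1), (ω (k, l)).1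

open scoped Classical in
/-- The number of events of class `k` up to time `t` (a Poisson process with intensity `β k`); on
the null event that infinitely many events occur in bounded time it is set to `0` for all `t`. -/
def eventCount (k : Fin m) (t : ℝ≥0) (ω : Scenario m n) : ℕ :=
  if ∀ s : ℝ≥0, {i : ℕ | eventTime k i ω ≤ s}.Finite then {i : ℕ | eventTime k i ω ≤ t}.ncard
  else 0

/-- Aggregate claims of line `j` up to time `t`, before reinsurance. The uncontrolled surplus of
line `j` is a deterministic linear premium income minus this. -/
def lineClaims (j : Fin n) (t : ℝ≥0) (ω : Scenario m n) : ℝ≥0 :=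
  ∑ k : Fin m, ∑ i ∈ Finset.range (eventCount k t ω),
    if (ω (k, i)).2.1 j = true then (ω (k, i)).2.2 j else 0

/-- The σ-algebra `ℱ_{t-}` of the (uncompleted) filtration generated by the surplus processes of
the `n` lines: it is generated by their values at all times `s < t`. -/
abbrev strictPast (m n : ℕ) (t : ℝ≥0) : MeasurableSpace (Scenario m n) :=
  ⨆ (j : Fin n) (s : ℝ≥0) (_ : s < t), MeasurableSpace.comap (lineClaims j s) inferInstance

end Processes

namespace RiskModel

variable {m n : ℕ} (M : RiskModel m n)

/-- A vector of retained loss functions available to the insurer. -/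
def IsContract (R : Fin n → ℝ≥0 → ℝ≥0) : Prop := ∀ j, R j ∈ M.fam j

/-- Total intensity `∑ β_i`. -/
def totalRate : ℝ := ∑ k, M.β k

/-- The distribution `G^R` of the total retained claim of an event: with probability
`β_k / ∑ β_i` the event is of class `k`; given this it hits exactly the lines in `A` with
probability `∏_{z ∈ A} p_{kz} ∏_{z ∉ A} (1 - p_{kz})`, and then the retained claim is
`∑_{z ∈ A} R_z(U_z)`, where the `U_z` are independent with distribution `F_z`. -/
def claimLaw (R : Fin n → ℝ≥0 → ℝ≥0) : Measure ℝ≥0 :=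
  ∑ k : Fin m, ENNReal.ofReal (M.β k / M.totalRate) •
    ∑ A : Finset (Fin n),
      (((∏ z ∈ A, M.hit k z) * ∏ z ∈ Aᶜ, (1 - M.hit k z) : ℝ≥0) : ℝ≥0∞) •
        (Measure.pi M.F).map (fun v => ∑ z ∈ A, R z (v z))

/-- Premium rate before reinsurance, `p = (1 + η) (∑ β_i) ∫ α dG`. -/
def grossPremium : ℝ := (1 + M.η) * M.totalRate * ∫ a, (a : ℝ) ∂(M.claimLaw fun _ => id)

/-- Premium rate `q_R` paid to the reinsurers. -/
def reinsurancePremium (R : Fin n → ℝ≥0 → ℝ≥0) : ℝ :=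
  (1 + M.η₁) * M.totalRate *
    ((∫ a, (a : ℝ) ∂(M.claimLaw fun _ => id)) - ∫ a, (a : ℝ) ∂(M.claimLaw R))

/-- Net premium rate `p_R = p - q_R`. -/
def netPremium (R : Fin n → ℝ≥0 → ℝ≥0) : ℝ := M.grossPremium - M.reinsurancePremium R

/-- Admissible control strategies: a predictable reinsurance strategy and a predictable,
nondecreasing, left-continuous process of cumulative dividends. -/
structure Strategy where
  /-- `R j t ω` is the retained loss function used in line `j` at time `t` -/
  R : Fin n → ℝ≥0 → Scenario m n → ℝ≥0 → ℝ≥0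
  R_mem : ∀ j t ω, R j t ω ∈ M.fam j
  R_measurable : ∀ j, Measurable fun q : ℝ≥0 × Scenario m n × ℝ≥0 => R j q.1 q.2.1 q.2.2
  R_past : ∀ j t a, Measurable[strictPast m n t] fun ω => R j t ω a
  /-- `D t ω` is the cumulative amount of dividends paid before time `t` -/
  D : ℝ≥0 → Scenario m n → ℝ≥0
  D_zero : ∀ ω, D 0 ω = 0
  D_mono : ∀ ω, Monotone fun t => D t ω
  D_leftCont : ∀ ω t, ContinuousWithinAt (fun s => D s ω) (Set.Iic t) t
  D_past : ∀ t, Measurable[strictPast m n t] (D t)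

namespace Strategy

variable {M} (π : M.Strategy)

/-- The controlled surplus at time `t` with initial surplus `x`. -/
def surplus (x : ℝ≥0) (t : ℝ≥0) (ω : Scenario m n) : ℝ :=
  x + (∫ s in (0 : ℝ)..t, M.netPremium fun j => π.R j s.toNNReal ω)
    - (∑ k : Fin m, ∑ i ∈ Finset.range (eventCount k t ω), ∑ j : Fin n,
        if (ω (k, i)).2.1 j = true then (π.R j (eventTime k i ω) ω ((ω (k, i)).2.2 j) : ℝ) else 0)
    - π.D t ω

/-- The ruin time `inf {t ≥ 0 : X(t) < 0}` (`∞` if there is no ruin). -/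
def ruinTime (x : ℝ≥0) (ω : Scenario m n) : ℝ≥0∞ :=
  ⨅ (t : ℝ≥0) (_ : π.surplus x t ω < 0), (t : ℝ≥0∞)

theorem monotone_extend (ω : Scenario m n) : Monotone fun t : ℝ => (π.D t.toNNReal ω : ℝ) :=
  fun _ _ h => NNReal.coe_le_coe.2 (π.D_mono ω (Real.toNNReal_le_toNNReal h))

/-- The Lebesgue–Stieltjes measure `dD` on the time axis. It gives mass `D_b - D_a` to `[a, b)` for
`0 ≤ a ≤ b`; in particular a lump sum paid at time `0` is included. -/
def dividendMeasure (ω : Scenario m n) : Measure ℝ := (π.monotone_extend ω).stieltjesFunction.measure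

/-- Expected discounted dividends up to ruin, `E_x ∫_{[0, τ)} e^{-δ s} dD_s`. -/
def value (x : ℝ≥0) : ℝ≥0∞ :=
  ∫⁻ ω, ∫⁻ s in {s : ℝ | 0 ≤ s ∧ ENNReal.ofReal s < π.ruinTime x ω},
    ENNReal.ofReal (Real.exp (-M.δ * s)) ∂(π.dividendMeasure ω) ∂M.prob

end Strategy

/-- The optimal value function, as an extended nonnegative number. -/
def optimalValue (x : ℝ≥0) : ℝ≥0∞ := ⨆ π : M.Strategy, π.value x

/-- The operator `ℒ_R`, where the function is `u` and its derivative at `x` is replaced by `d`. -/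
def generator (R : Fin n → ℝ≥0 → ℝ≥0) (u : ℝ≥0 → ℝ) (d : ℝ) (x : ℝ≥0) : ℝ :=
  M.netPremium R * d - (M.δ + M.totalRate) * u x
    + M.totalRate * ∫ a in Set.Iic x, u (x - a) ∂(M.claimLaw R)

/-- Left-hand side of the Hamilton–Jacobi–Bellman equation
`max {1 - u'(x), sup_R ℒ_R(u)(x)} = 0`, with `d` in place of `u'(x)`. -/
def hjb (u : ℝ≥0 → ℝ) (d : ℝ) (x : ℝ≥0) : EReal :=
  max ((1 - d : ℝ) : EReal)
    (⨆ (R : Fin n → ℝ≥0 → ℝ≥0) (_ : M.IsContract R), (M.generator R u d x : EReal))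

end RiskModel

/-- Difference quotient of `u` at `x`, as an extended real number. -/
def diffQuot (u : ℝ≥0 → ℝ) (x y : ℝ≥0) : EReal := (((u y - u x) / ((y : ℝ) - x) : ℝ) : EReal)

/-- The superdifferential `D⁺u(x)`. -/
def superDiff (u : ℝ≥0 → ℝ) (x : ℝ≥0) : Set ℝ :=
  {d | (d : EReal) ≤ liminf (diffQuot u x) (𝓝[<] x) ∧ limsup (diffQuot u x) (𝓝[>] x) ≤ d}

/-- The subdifferential `D⁻u(x)`. -/
def subDiff (u : ℝ≥0 → ℝ) (x : ℝ≥0) : Set ℝ :=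
  {d | (d : EReal) ≤ liminf (diffQuot u x) (𝓝[>] x) ∧ limsup (diffQuot u x) (𝓝[<] x) ≤ d}

/-- The class `L`. -/
structure ClassL (u : ℝ≥0 → ℝ) : Prop where
  locallyLipschitz : LocallyLipschitz u
  increment : ∀ x y : ℝ≥0, x < y → (y : ℝ) - x ≤ u y - u x
  growth : ∃ k : ℝ, 0 < k ∧ ∀ x : ℝ≥0, u x ≤ x + k

namespace RiskModel

variable {m n : ℕ} (M : RiskModel m n)

/-- Viscosity subsolutions of the Hamilton–Jacobi–Bellman equation on `(0, ∞)`. -/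
def IsViscositySub (u : ℝ≥0 → ℝ) : Prop :=
  LocallyLipschitz u ∧ ∀ x : ℝ≥0, 0 < x → ∀ d ∈ superDiff u x, 0 ≤ M.hjb u d x

/-- Viscosity supersolutions of the Hamilton–Jacobi–Bellman equation on `(0, ∞)`. -/
def IsViscositySuper (u : ℝ≥0 → ℝ) : Prop :=
  LocallyLipschitz u ∧ ∀ x : ℝ≥0, 0 < x → ∀ d ∈ subDiff u x, M.hjb u d x ≤ 0

/-- The set `L*` of all viscosity solutions that belong to the class `L`. -/
def LStar : Set (ℝ≥0 → ℝ) := {u | ClassL u ∧ M.IsViscositySub u ∧ M.IsViscositySuper u}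

end RiskModel

end

/-! The proof combines verification, dynamic programming, Perron's method and a comparison
principle.

Verification. Let v be nonnegative and continuously differentiable with v' ≥ 1 and ℒ_R(v) ≤ 0 for
every contract R. Along a surplus path, discretizing time yields a change of variables inequality in
which every dividend is paid for by a decrease of v (`PathData.path_le`, `PathData.jumpPath_chain`).
In expectation, sums over events turn into time integrals by a compensation formula
(`lintegral_all_events`), which is obtained by resampling the mark of one event and needs no
martingale theory. What remains is that expected discounted dividends are at most v(x)
(`Strategy.value_le`). A supersolution u in the class L is not smooth, but it is differentiable
almost everywhere and satisfies the inequality there; its forward averages over [z, z + ε] are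
smooth and inherit it (`IsViscositySuper.generator_forwardMean_le`). Letting ε tend to 0 gives V ≤
u. The function x + k with k large shows that V is finite.

Dynamic programming. Only a lower bound for V is needed: keep a contract R up to a short time h and
then continue almost optimally from the surplus reached. If there is no event, or exactly one event,
up to time h, memorylessness gives the remaining scenario its original law, and the bound is
explicit (`wait_le_optimalValue`). With a single fixed continuation it shows that V is in L.
Continuity of V then allows a measurable choice among countably many strategies, and h → 0 gives the
supersolution property (`isViscositySuper_optimalValueReal`).

Perron's method. If V were not a subsolution at x, sequential compactness would make the failure
uniform over contracts and over points near x. Taking the minimum of V with a cone near x would then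
produce a smaller supersolution in L, contradicting minimality (`isViscositySub_of_least`). Hence no
upper dynamic programming inequality is required.

Comparison. A subsolution in L lies below every supersolution in L that is nonnegative at 0 and
dominates it there (`IsViscositySub.le_of_super`). If u in L* has the least value at 0, then u(0) ≤
V(0), so u ≤ V, and V ≤ u by minimality. -/

noncomputable section

/-! ### Claim laws as images of hits and severities; bounds for premium rates -/

namespace RiskModel

variable {m n : ℕ} (M : RiskModel m n)

/-- Joint law of the hits and the severities at an event of class `k`. -/
def hitLaw (k : Fin m) : Measure ((Fin n → Bool) × (Fin n → ℝ≥0)) :=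
  (Measure.pi fun j => bernoulliLaw (M.hit k j)).prod (Measure.pi M.F)

instance instProbHitLaw (k : Fin m) : IsProbabilityMeasure (M.hitLaw k) := by
  unfold hitLaw; infer_instance

theorem markLaw_eq (k : Fin m) : M.markLaw k = (M.gapLaw k).prod (M.hitLaw k) := rfl

end RiskModel

/-- Total retained claim of an event with hits `y.1` and severities `y.2`. -/
def retained {n : ℕ} (R : Fin n → ℝ≥0 → ℝ≥0) (y : (Fin n → Bool) × (Fin n → ℝ≥0)) : ℝ≥0 :=
  ∑ j, if y.1 j = true then R j (y.2 j) else 0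

theorem measurable_retained {n : ℕ} {R : Fin n → ℝ≥0 → ℝ≥0} (hR : ∀ j, Measurable (R j)) :
    Measurable (retained R) := by
  unfold retained
  refine Finset.measurable_sum _ fun j _ => Measurable.ite ?_ ?_ measurable_const
  · exact measurableSet_eq_fun (by fun_prop) measurable_const
  · exact (hR j).comp (by fun_prop)

theorem retained_mono {n : ℕ} {R S : Fin n → ℝ≥0 → ℝ≥0} (h : ∀ j a, R j a ≤ S j a) (y) :
    retained R y ≤ retained S y := by
  unfold retained
  refine Finset.sum_le_sum fun j _ => ?_
  split_ifs
  exacts [h j _, le_rfl]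

theorem bernoulliLaw_true (p : ℝ≥0) : bernoulliLaw p {true} = p := by
  simp [bernoulliLaw]

theorem bernoulliLaw_false (p : ℝ≥0) : bernoulliLaw p {false} = (1 - p : ℝ≥0) := by
  simp [bernoulliLaw]

namespace RiskModel

variable {m n : ℕ} (M : RiskModel m n)

/-- Independent Bernoulli hits are a random subset A of the lines, so the product law is a finite
sum over A. This matches the sample space with the sum in the definition of `claimLaw`. -/
theorem lintegral_hitLaw {k : Fin m} {f : ((Fin n → Bool) × (Fin n → ℝ≥0)) → ℝ≥0∞}
    (hf : Measurable f) :
    ∫⁻ y, f y ∂(M.hitLaw k) = ∑ A : Finset (Fin n),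
      (((∏ z ∈ A, M.hit k z) * ∏ z ∈ Aᶜ, (1 - M.hit k z) : ℝ≥0) : ℝ≥0∞) *
        ∫⁻ v, f (fun j => decide (j ∈ A), v) ∂(Measure.pi M.F) := by
  classical
  rw [hitLaw, lintegral_prod _ hf.aemeasurable, lintegral_fintype]
  let e : (Finset (Fin n)) ≃ (Fin n → Bool) :=
    ⟨fun A j => decide (j ∈ A), fun b => Finset.univ.filter fun j => b j = true,
      fun A => by ext; simp, fun b => by ext; simp⟩
  rw [← e.sum_comp]
  refine Finset.sum_congr rfl fun A _ => ?_
  rw [mul_comm]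
  congr 1
  rw [Measure.pi_singleton, ← Finset.prod_mul_prod_compl A]
  push_cast
  congr 1
  · refine Finset.prod_congr rfl fun j hj => ?_
    have : e A j = true := by simp [e, hj]
    rw [this, bernoulliLaw_true]
  · refine Finset.prod_congr rfl fun j hj => ?_
    have : e A j = false := by simpa [e] using hj
    rw [this, bernoulliLaw_false]
    simp

variable {M} in
theorem IsContract.measurable {R : Fin n → ℝ≥0 → ℝ≥0} (hR : M.IsContract R) (j : Fin n) :
    Measurable (R j) := M.fam_measurable j _ (hR j)

/-- The bridge between the analytic object G^R in the generator and the marks of the sample space.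
-/
theorem lintegral_claimLaw {R : Fin n → ℝ≥0 → ℝ≥0} (hR : ∀ j, Measurable (R j))
    {f : ℝ≥0 → ℝ≥0∞} (hf : Measurable f) :
    ∫⁻ a, f a ∂(M.claimLaw R) =
      ∑ k, ENNReal.ofReal (M.β k / M.totalRate) * ∫⁻ y, f (retained R y) ∂(M.hitLaw k) := by
  rw [claimLaw, lintegral_finsetSum_measure]
  refine Finset.sum_congr rfl fun k _ => ?_
  rw [lintegral_smul_measure, lintegral_finsetSum_measure, smul_eq_mul,
    M.lintegral_hitLaw (f := fun y => f (retained R y)) (hf.comp (measurable_retained hR))]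
  congr 1
  refine Finset.sum_congr rfl fun A _ => ?_
  rw [lintegral_smul_measure, smul_eq_mul, lintegral_map hf]
  · congr 2
    ext v
    simp [retained, Finset.sum_ite_mem]
  · refine Finset.measurable_sum _ fun j _ => (hR j).comp (by fun_prop)

theorem totalRate_pos (hm : 1 ≤ m) : 0 < M.totalRate := by
  have : NeZero m := ⟨by omega⟩
  exact Finset.sum_pos (fun k _ => M.β_pos k) Finset.univ_nonempty

theorem sum_ofReal_rate (hm : 1 ≤ m) :
    ∑ k, ENNReal.ofReal (M.β k / M.totalRate) = 1 := by
  rw [← ENNReal.ofReal_sum_of_nonneg fun k _ =>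
    div_nonneg (M.β_pos k).le (M.totalRate_pos hm).le, ← Finset.sum_div]
  have := (M.totalRate_pos hm).ne'
  rw [show ∑ k, M.β k = M.totalRate from rfl, div_self this, ENNReal.ofReal_one]

theorem isProbabilityMeasure_claimLaw (hm : 1 ≤ m) {R : Fin n → ℝ≥0 → ℝ≥0}
    (hR : ∀ j, Measurable (R j)) : IsProbabilityMeasure (M.claimLaw R) := by
  constructor
  have := M.lintegral_claimLaw hR (f := fun _ => 1) measurable_const
  simpa [M.sum_ofReal_rate hm] using this

/-- Rate-weighted form of `lintegral_claimLaw`. -/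
theorem rate_mul_lintegral_claimLaw (hm : 1 ≤ m) {R : Fin n → ℝ≥0 → ℝ≥0}
    (hR : ∀ j, Measurable (R j)) {f : ℝ≥0 → ℝ≥0∞} (hf : Measurable f) :
    ENNReal.ofReal M.totalRate * ∫⁻ a, f a ∂(M.claimLaw R) =
      ∑ k, ENNReal.ofReal (M.β k) * ∫⁻ y, f (retained R y) ∂(M.hitLaw k) := by
  rw [M.lintegral_claimLaw hR hf, Finset.mul_sum]
  refine Finset.sum_congr rfl fun k _ => ?_
  rw [← mul_assoc, ← ENNReal.ofReal_mul (M.totalRate_pos hm).le,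
    mul_div_cancel₀ _ (M.totalRate_pos hm).ne']

theorem lintegral_severity_lt_top :
    ∫⁻ v, ((∑ j, v j : ℝ≥0) : ℝ≥0∞) ∂(Measure.pi M.F) < ⊤ := by
  push_cast
  rw [lintegral_finsetSum _ fun j _ => by fun_prop]
  refine ENNReal.sum_lt_top.2 fun j _ => ?_
  have h1 := (measurePreserving_eval M.F j).lintegral_comp (f := fun a : ℝ≥0 => (a : ℝ≥0∞))
    (by fun_prop)
  simp only [Function.eval] at h1
  rw [h1]
  have h2 := (M.F_integrable j).lintegral_lt_top
  simpa using h2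

/-- Expected total claim of an event of class `k` under a contract. -/
theorem lintegral_retained_le (k : Fin m) {R : Fin n → ℝ≥0 → ℝ≥0} (hR : ∀ j a, R j a ≤ a) :
    ∫⁻ y, (retained R y : ℝ≥0∞) ∂(M.hitLaw k) ≤
      ∫⁻ v, ((∑ j, v j : ℝ≥0) : ℝ≥0∞) ∂(Measure.pi M.F) := by
  calc ∫⁻ y, (retained R y : ℝ≥0∞) ∂(M.hitLaw k)
      ≤ ∫⁻ y, ((∑ j, y.2 j : ℝ≥0) : ℝ≥0∞) ∂(M.hitLaw k) := by
        refine lintegral_mono fun y => ?_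
        refine ENNReal.coe_le_coe.2 (Finset.sum_le_sum fun j _ => ?_)
        split_ifs
        exacts [hR j _, zero_le]
    _ = _ := by
        rw [hitLaw, lintegral_prod _ (by fun_prop)]
        simp

theorem lintegral_claimLaw_lt_top {R : Fin n → ℝ≥0 → ℝ≥0}
    (hR : ∀ j, Measurable (R j)) (hR' : ∀ j a, R j a ≤ a) :
    ∫⁻ a, (a : ℝ≥0∞) ∂(M.claimLaw R) < ⊤ := by
  rw [M.lintegral_claimLaw hR (by fun_prop)]
  refine ENNReal.sum_lt_top.2 fun k _ => ENNReal.mul_lt_top (by simp) ?_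
  exact (M.lintegral_retained_le k hR').trans_lt M.lintegral_severity_lt_top

theorem integral_claimLaw_eq (R : Fin n → ℝ≥0 → ℝ≥0) :
    ∫ a, (a : ℝ) ∂(M.claimLaw R) = (∫⁻ a, (a : ℝ≥0∞) ∂(M.claimLaw R)).toReal := by
  rw [integral_eq_lintegral_of_nonneg_ae (ae_of_all _ fun a => a.2) (by fun_prop)]
  simp

theorem lintegral_claimLaw_mono {R S : Fin n → ℝ≥0 → ℝ≥0}
    (hR : ∀ j, Measurable (R j)) (hS : ∀ j, Measurable (S j)) (h : ∀ j a, R j a ≤ S j a) :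
    ∫⁻ a, (a : ℝ≥0∞) ∂(M.claimLaw R) ≤ ∫⁻ a, (a : ℝ≥0∞) ∂(M.claimLaw S) := by
  rw [M.lintegral_claimLaw hR (by fun_prop), M.lintegral_claimLaw hS (by fun_prop)]
  gcongr with k _ y
  exact retained_mono h _

variable {M} in
theorem IsContract.le {R : Fin n → ℝ≥0 → ℝ≥0} (hR : M.IsContract R) (j : Fin n) (a : ℝ≥0) :
    R j a ≤ a := M.fam_le j _ (hR j) a

/-- A bound for all premium rates. -/
def premiumBound : ℝ := (1 + M.η₁) * M.totalRate * ∫ a, (a : ℝ) ∂(M.claimLaw fun _ => id)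

/-- With I and J the mean retained and the mean total claim, 0 ≤ I ≤ J. The premium rate is affine
and increasing in I, so it lies between its values at I = 0 and I = J, and η ≤ η₁ bounds both. -/
theorem abs_netPremium_le (hm : 1 ≤ m) {R : Fin n → ℝ≥0 → ℝ≥0} (hR : M.IsContract R) :
    |M.netPremium R| ≤ M.premiumBound := by
  have hid : ∀ j : Fin n, Measurable ((fun _ => id : Fin n → ℝ≥0 → ℝ≥0) j) :=
    fun _ => measurable_id
  have h1 : ∫ a, (a : ℝ) ∂(M.claimLaw R) ≤ ∫ a, (a : ℝ) ∂(M.claimLaw fun _ => id) := by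
    rw [integral_claimLaw_eq, integral_claimLaw_eq]
    refine ENNReal.toReal_mono (M.lintegral_claimLaw_lt_top hid fun _ _ => le_rfl).ne ?_
    exact M.lintegral_claimLaw_mono hR.measurable hid hR.le
  have h0 : 0 ≤ ∫ a, (a : ℝ) ∂(M.claimLaw R) := integral_nonneg fun a => a.2
  have hb := M.totalRate_pos hm
  have := M.η_pos
  have := M.η_le
  rw [netPremium, grossPremium, reinsurancePremium, premiumBound]
  set I := ∫ a, (a : ℝ) ∂(M.claimLaw R)
  set J := ∫ a, (a : ℝ) ∂(M.claimLaw fun _ => id)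
  rw [abs_le]
  constructor
  · nlinarith [mul_nonneg hb.le h0, mul_nonneg hb.le (h0.trans h1),
      mul_nonneg (mul_nonneg (show (0:ℝ) ≤ 1 + M.η by linarith) hb.le) (h0.trans h1),
      mul_nonneg (mul_nonneg (show (0:ℝ) ≤ 1 + M.η₁ by linarith) hb.le) h0]
  · nlinarith [mul_nonneg (mul_nonneg (show (0:ℝ) ≤ 1 + M.η₁ by linarith) hb.le)
      (sub_nonneg.2 h1), mul_nonneg (mul_nonneg (show (0:ℝ) ≤ M.η₁ - M.η by linarith) hb.le)
      (h0.trans h1)]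

theorem premiumBound_nonneg (hm : 1 ≤ m) : 0 ≤ M.premiumBound := by
  have := M.η_pos
  have := M.η_le
  exact mul_nonneg (mul_nonneg (by linarith) (M.totalRate_pos hm).le)
    (integral_nonneg fun a => a.2)

end RiskModel

/-! ### Event times and the effect of changing one mark -/

section EventTimes

variable {m n : ℕ}

/-- Time of the event of class `k` preceding the `i`-th one (`0` if there is none). -/
def prevTime (k : Fin m) (i : ℕ) (ω : Scenario m n) : ℝ≥0 := ∑ l ∈ Finset.range i, (ω (k, l)).1

theorem eventTime_eq (k : Fin m) (i : ℕ) (ω : Scenario m n) :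
    eventTime k i ω = prevTime k i ω + (ω (k, i)).1 := Finset.sum_range_succ _ _

theorem prevTime_succ (k : Fin m) (i : ℕ) (ω : Scenario m n) :
    prevTime k (i + 1) ω = eventTime k i ω := rfl

@[fun_prop]
theorem measurable_prevTime (k : Fin m) (i : ℕ) :
    Measurable (prevTime k i : Scenario m n → ℝ≥0) := by
  unfold prevTime; fun_prop

@[fun_prop]
theorem measurable_eventTime (k : Fin m) (i : ℕ) :
    Measurable (eventTime k i : Scenario m n → ℝ≥0) := by
  unfold eventTime; fun_prop

theorem prevTime_mono (k : Fin m) (ω : Scenario m n) : Monotone fun i => prevTime k i ω :=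
  fun _ _ h => Finset.sum_le_sum_of_subset (Finset.range_mono h)

theorem eventTime_mono (k : Fin m) (ω : Scenario m n) : Monotone fun i => eventTime k i ω :=
  fun _ _ h => prevTime_mono k ω (Nat.succ_le_succ h)

theorem prevTime_update (k : Fin m) (i : ℕ) (ω : Scenario m n) (a : Mark n) :
    prevTime k i (Function.update ω (k, i) a) = prevTime k i ω := by
  refine Finset.sum_congr rfl fun l hl => ?_
  rw [Function.update_of_ne]
  simp only [ne_eq, Prod.mk.injEq, true_and]
  exact (Finset.mem_range.1 hl).ne

theorem eventTime_update_self (k : Fin m) (i : ℕ) (ω : Scenario m n) (a : Mark n) :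
    eventTime k i (Function.update ω (k, i) a) = prevTime k i ω + a.1 := by
  rw [eventTime_eq, prevTime_update, Function.update_self]

theorem eventTime_update_of_lt (k : Fin m) {i l : ℕ} (h : l < i) (ω : Scenario m n) (a : Mark n) :
    eventTime k l (Function.update ω (k, i) a) = eventTime k l ω := by
  refine Finset.sum_congr rfl fun l' hl => ?_
  rw [Function.update_of_ne]
  simp only [ne_eq, Prod.mk.injEq, true_and]
  have := Finset.mem_range.1 hl
  omega

theorem eventTime_update_of_ne {k k' : Fin m} (hk : k' ≠ k) (i l : ℕ) (ω : Scenario m n)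
    (a : Mark n) : eventTime k' l (Function.update ω (k, i) a) = eventTime k' l ω := by
  refine Finset.sum_congr rfl fun l' _ => ?_
  rw [Function.update_of_ne]
  simp [hk]

/-- `H s ω` depends on `ω` only through the events before time `s`: it is unaffected by a change of
an event that takes place at time `s` or later. -/
def EventPredictable {α : Type*} (H : ℝ≥0 → Scenario m n → α) : Prop :=
  ∀ k i s ω a, s ≤ eventTime k i ω → s ≤ eventTime k i (Function.update ω (k, i) a) →
    H s (Function.update ω (k, i) a) = H s ω

/-- Only finitely many events occur in bounded time. -/
def NonExplosive (ω : Scenario m n) : Prop := ∀ k, ∀ s : ℝ≥0, {i : ℕ | eventTime k i ω ≤ s}.Finite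

end EventTimes

/-! ### Resampling a mark, the compensation formula and null events -/

namespace RiskModel

variable {m n : ℕ} (M : RiskModel m n)

instance instProbProb : IsProbabilityMeasure M.prob := by unfold prob; infer_instance

/-- In a product measure a coordinate may be replaced by an independent copy; this is checked on
finite rectangles, which determine the measure. -/
theorem map_update_prob (j : Fin m × ℕ) :
    (M.prob.prod (M.markLaw j.1)).map (fun p => Function.update p.1 j p.2) = M.prob := by
  refine Measure.eq_infinitePi _ fun s t ht => ?_
  have hmeas : Measurable fun p : Scenario m n × Mark n => Function.update p.1 j p.2 :=
    measurable_update'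
  rw [Measure.map_apply hmeas (MeasurableSet.pi s.countable_toSet fun i _ => ht i)]
  have hset : (fun p : Scenario m n × Mark n => Function.update p.1 j p.2) ⁻¹' (Set.pi s t) =
      (Set.pi ((s.erase j : Finset _) : Set (Fin m × ℕ)) t) ×ˢ
        (if j ∈ s then t j else Set.univ) := by
    ext ⟨ω, a⟩
    simp only [Set.mem_preimage, Set.mem_pi, Finset.mem_coe, Set.mem_prod, Finset.mem_erase]
    constructor
    · intro h
      refine ⟨fun i hi => ?_, ?_⟩
      · simpa [hi.1] using h i hi.2
      · split_ifs with hj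
        · simpa using h j hj
        · trivial
    · rintro ⟨h1, h2⟩ i hi
      by_cases hij : i = j
      · subst hij
        simpa [hi] using h2
      · simpa [hij] using h1 i ⟨hij, hi⟩
  rw [hset, Measure.prod_prod, prob, Measure.infinitePi_pi _ fun i _ => ht i]
  split_ifs with hj
  · rw [Finset.prod_erase_mul _ _ hj]
  · rw [Finset.erase_eq_of_notMem hj, measure_univ, mul_one]

/-- Resampling the mark of one event does not change the law of a scenario. -/
theorem lintegral_prob_update (j : Fin m × ℕ) {f : Scenario m n → ℝ≥0∞} (hf : Measurable f) :
    ∫⁻ ω, f ω ∂M.prob =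
      ∫⁻ ω, ∫⁻ a, f (Function.update ω j a) ∂(M.markLaw j.1) ∂M.prob := by
  conv_lhs => rw [← M.map_update_prob j]
  rw [lintegral_map hf measurable_update', lintegral_prod]
  exact (hf.comp measurable_update').aemeasurable

/-- The point 0 is a null set, so the exponential density may be integrated over the open half-line,
where passing between real and nonnegative times is harmless. -/
theorem lintegral_gapLaw (k : Fin m) {g : ℝ≥0 → ℝ≥0∞} (hg : Measurable g) :
    ∫⁻ w, g w ∂(M.gapLaw k) =
      ∫⁻ x in Set.Ioi (0 : ℝ), ENNReal.ofReal (M.β k * Real.exp (-(M.β k * x))) *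
        g x.toNNReal := by
  rw [gapLaw, lintegral_map hg measurable_real_toNNReal]
  change ∫⁻ x, g x.toNNReal ∂(volume.withDensity (exponentialPDF (M.β k))) = _
  have hd : Measurable (exponentialPDF (M.β k)) :=
    (measurable_exponentialPDFReal _).ennreal_ofReal
  have hg' : Measurable fun x : ℝ => g x.toNNReal := hg.comp measurable_real_toNNReal
  rw [lintegral_withDensity_eq_lintegral_mul _ hd hg', ← lintegral_indicator measurableSet_Ioi]
  refine lintegral_congr_ae ?_
  filter_upwards [(measure_eq_zero_iff_ae_notMem.1 (Real.volume_singleton (a := 0)))] with x hx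
  simp only [Set.mem_singleton_iff] at hx
  simp only [Pi.mul_apply, Set.indicator, Set.mem_Ioi]
  rcases lt_or_gt_of_ne hx with h | h
  · rw [exponentialPDF_of_neg h, if_neg (not_lt.2 h.le), zero_mul]
  · rw [exponentialPDF_of_nonneg h.le, if_pos h]

theorem gapLaw_singleton (k : Fin m) (w : ℝ≥0) : M.gapLaw k {w} = 0 := by
  rw [← lintegral_indicator_one (measurableSet_singleton w),
    M.lintegral_gapLaw k (measurable_one.indicator (measurableSet_singleton w)),
    lintegral_eq_zero_iff (by
      refine Measurable.mul (by fun_prop) ?_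
      exact (measurable_one.indicator (measurableSet_singleton w)).comp measurable_real_toNNReal)]
  rw [EventuallyEq, ae_restrict_iff' measurableSet_Ioi]
  filter_upwards [(measure_eq_zero_iff_ae_notMem.1 (Real.volume_singleton (a := (w : ℝ))))]
    with x hx h0
  have : x.toNNReal ≠ w := fun h => hx (by
    rw [← h, Set.mem_singleton_iff, Real.coe_toNNReal _ (le_of_lt h0)])
  simp [this]

theorem gapLaw_Ici (k : Fin m) {c : ℝ} (hc : 0 ≤ c) :
    M.gapLaw k {w : ℝ≥0 | c ≤ w} = ENNReal.ofReal (Real.exp (-(M.β k * c))) := by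
  have hms : MeasurableSet {w : ℝ≥0 | c ≤ w} := measurableSet_le (by fun_prop) (by fun_prop)
  have hβ := M.β_pos k
  rw [← lintegral_indicator_one hms, M.lintegral_gapLaw k (measurable_one.indicator hms)]
  have h1 : ∀ x ∈ Set.Ioi (0 : ℝ), ENNReal.ofReal (M.β k * Real.exp (-(M.β k * x))) *
      {w : ℝ≥0 | c ≤ w}.indicator 1 x.toNNReal =
      (Set.Ici c).indicator (fun x => ENNReal.ofReal (M.β k * Real.exp (-(M.β k * x)))) x := by
    intro x hx
    simp only [Set.indicator, Set.mem_ofPred_eq, Real.coe_toNNReal _ (le_of_lt hx), Set.mem_Ici]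
    split_ifs <;> simp
  rw [setLIntegral_congr_fun measurableSet_Ioi h1, lintegral_indicator measurableSet_Ici,
    Measure.restrict_restrict measurableSet_Ici]
  have h2 : (volume.restrict (Set.Ici c ∩ Set.Ioi 0) : Measure ℝ) = volume.restrict (Set.Ioi c) := by
    refine Measure.restrict_congr_set ?_
    rcases hc.eq_or_lt with rfl | h
    · rw [Set.inter_eq_right.2 Set.Ioi_subset_Ici_self]
      exact EventuallyEq.rfl
    · rw [Set.inter_eq_left.2 (Set.Ici_subset_Ioi.2 h)]
      exact Ioi_ae_eq_Ici.symm
  rw [h2]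
  have hd : ∀ x ∈ Set.Ici c, HasDerivAt (fun a => -Real.exp (-(M.β k * a)))
      (M.β k * Real.exp (-(M.β k * x))) x := fun x _ => hasDerivAt_neg_exp_mul_exp
  have ht : Tendsto (fun a => -Real.exp (-(M.β k * a))) atTop (𝓝 0) := by
    rw [← neg_zero]
    refine Tendsto.neg (Real.tendsto_exp_neg_atTop_nhds_zero.comp ?_)
    exact tendsto_id.const_mul_atTop hβ
  have hpos : ∀ x ∈ Set.Ioi c, 0 ≤ M.β k * Real.exp (-(M.β k * x)) := fun x _ => by positivity
  have hi := integrableOn_Ioi_deriv_of_nonneg' hd hpos ht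
  rw [← ofReal_integral_eq_lintegral_ofReal hi
    (ae_of_all _ fun x => by positivity), integral_Ioi_of_hasDerivAt_of_tendsto' hd hi ht]
  simp

theorem lintegral_Ioi_shift (c : ℝ) {f : ℝ → ℝ≥0∞} :
    ∫⁻ x in Set.Ioi (0 : ℝ), f (c + x) = ∫⁻ s in Set.Ioi c, f s := by
  have h := (measurePreserving_add_left (volume : Measure ℝ) c).setLIntegral_comp_preimage_emb
    (measurableEmbedding_addLeft c) f (Set.Ioi c)
  simpa using h

/-- Compensation formula for a single event. -/
theorem lintegral_event (k : Fin m) (i : ℕ)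
    {h : ℝ≥0 → ((Fin n → Bool) × (Fin n → ℝ≥0)) → Scenario m n → ℝ≥0∞}
    (hm : Measurable fun q : ℝ≥0 × ((Fin n → Bool) × (Fin n → ℝ≥0)) × Scenario m n =>
      h q.1 q.2.1 q.2.2)
    (hp : ∀ y, EventPredictable fun s ω => h s y ω) :
    ∫⁻ ω, h (eventTime k i ω) (ω (k, i)).2 ω ∂M.prob =
      ∫⁻ ω, (∫⁻ s in Set.Ioi (0 : ℝ),
        (if prevTime k i ω < s.toNNReal ∧ s.toNNReal ≤ eventTime k i ω then
          ENNReal.ofReal (M.β k) * ∫⁻ y, h s.toNNReal y ω ∂(M.hitLaw k) else 0)) ∂M.prob := by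
  have hβ := M.β_pos k
  have hupd : Measurable fun p : Scenario m n × Mark n => Function.update p.1 (k, i) p.2 :=
    measurable_update'
  -- measurability of the building blocks
  have hm' : Measurable fun q : ℝ≥0 × Scenario m n => ∫⁻ y, h q.1 y q.2 ∂(M.hitLaw k) := by
    refine Measurable.lintegral_prod_right' (f := fun q : (ℝ≥0 × Scenario m n) ×
      ((Fin n → Bool) × (Fin n → ℝ≥0)) => h q.1.1 q.2 q.1.2) ?_
    exact hm.comp (f := fun q : (ℝ≥0 × Scenario m n) × ((Fin n → Bool) × (Fin n → ℝ≥0)) =>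
      (q.1.1, q.2, q.1.2)) (by fun_prop)
  have hL : Measurable fun ω => h (eventTime k i ω) (ω (k, i)).2 ω :=
    hm.comp (f := fun ω => (eventTime k i ω, (ω (k, i)).2, ω)) (by fun_prop)
  have hmR : Measurable fun q : Scenario m n × ℝ =>
      (if prevTime k i q.1 < q.2.toNNReal ∧ q.2.toNNReal ≤ eventTime k i q.1 then
          ENNReal.ofReal (M.β k) * ∫⁻ y, h q.2.toNNReal y q.1 ∂(M.hitLaw k) else 0) := by
    refine Measurable.ite ?_ ?_ measurable_const
    · exact (measurableSet_lt (by fun_prop) (by fun_prop)).inter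
        (measurableSet_le (by fun_prop) (by fun_prop))
    · exact Measurable.const_mul (hm'.comp (f := fun q : Scenario m n × ℝ => (q.2.toNNReal, q.1))
        (by fun_prop)) _
  have hR : Measurable fun ω => ∫⁻ s in Set.Ioi (0 : ℝ),
        (if prevTime k i ω < s.toNNReal ∧ s.toNNReal ≤ eventTime k i ω then
          ENNReal.ofReal (M.β k) * ∫⁻ y, h s.toNNReal y ω ∂(M.hitLaw k) else 0) :=
    Measurable.lintegral_prod_right hmR
  -- Resample the mark of the event on both sides. With everything else frozen, only the exponential
  -- waiting time and the independent hits and severities are random.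
  rw [M.lintegral_prob_update (k, i) hL, M.lintegral_prob_update (k, i) hR]
  refine lintegral_congr fun ω => ?_
  -- `Φ s` is the average of `h s y ω` when the event takes place at time `s`
  set S : ℝ≥0 := prevTime k i ω with hS
  let Ψ : ℝ≥0 → ((Fin n → Bool) × (Fin n → ℝ≥0)) → ℝ≥0∞ :=
    fun w y => h (S + w) y (Function.update ω (k, i) (w, y))
  have hΨ : Measurable fun q : ℝ≥0 × ((Fin n → Bool) × (Fin n → ℝ≥0)) => Ψ q.1 q.2 := by
    refine hm.comp (g := fun q : ℝ≥0 × ((Fin n → Bool) × (Fin n → ℝ≥0)) × Scenario m n =>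
      h q.1 q.2.1 q.2.2) (f := fun q : ℝ≥0 × ((Fin n → Bool) × (Fin n → ℝ≥0)) =>
        (S + q.1, q.2, Function.update ω (k, i) (q.1, q.2))) ?_
    refine Measurable.prodMk (by fun_prop) (Measurable.prodMk (by fun_prop) ?_)
    exact hupd.comp (f := fun q : ℝ≥0 × ((Fin n → Bool) × (Fin n → ℝ≥0)) => (ω, q)) (by fun_prop)
  let Φ : ℝ≥0 → ℝ≥0∞ := fun w => ∫⁻ y, Ψ w y ∂(M.hitLaw k)
  have hΦ : Measurable Φ := Measurable.lintegral_prod_right hΨ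
  have lhs : ∫⁻ a, h (eventTime k i (Function.update ω (k, i) a))
      (Function.update ω (k, i) a (k, i)).2 (Function.update ω (k, i) a) ∂(M.markLaw k) =
      ∫⁻ x in Set.Ioi (0 : ℝ), ENNReal.ofReal (M.β k * Real.exp (-(M.β k * x))) *
        Φ x.toNNReal := by
    rw [← M.lintegral_gapLaw k hΦ, markLaw_eq, ← lintegral_prod _ hΨ.aemeasurable]
    refine lintegral_congr fun a => ?_
    rw [eventTime_update_self, Function.update_self]
  have rhs : ∫⁻ a, (∫⁻ s in Set.Ioi (0 : ℝ),
      (if prevTime k i (Function.update ω (k, i) a) < s.toNNReal ∧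
          s.toNNReal ≤ eventTime k i (Function.update ω (k, i) a) then
        ENNReal.ofReal (M.β k) * ∫⁻ y, h s.toNNReal y (Function.update ω (k, i) a) ∂(M.hitLaw k)
        else 0)) ∂(M.markLaw k) =
      ∫⁻ a, (∫⁻ x in Set.Ioi (0 : ℝ), (if x.toNNReal ≤ a.1 then
        ENNReal.ofReal (M.β k) * Φ x.toNNReal else 0)) ∂(M.markLaw k) := by
    refine lintegral_congr fun a => ?_
    have e1 : ∀ s ∈ Set.Ioi (0 : ℝ),
        (if prevTime k i (Function.update ω (k, i) a) < s.toNNReal ∧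
          s.toNNReal ≤ eventTime k i (Function.update ω (k, i) a) then
        ENNReal.ofReal (M.β k) * ∫⁻ y, h s.toNNReal y (Function.update ω (k, i) a) ∂(M.hitLaw k)
        else 0) = (Set.Ioi (S : ℝ)).indicator (fun s => if (s - S).toNNReal ≤ a.1 then
          ENNReal.ofReal (M.β k) * Φ (s - S).toNNReal else 0) s := by
      intro s hs
      have hs0 : 0 < s := hs
      rw [prevTime_update, eventTime_update_self, ← hS]
      simp only [Set.indicator, Set.mem_Ioi]
      by_cases h1 : (S : ℝ) < s
      · have hw : S + (s - S).toNNReal = s.toNNReal := by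
          ext
          push_cast
          rw [Real.coe_toNNReal _ (sub_nonneg.2 h1.le), Real.coe_toNNReal _ hs0.le]
          ring
        have h1' : S < s.toNNReal := Real.lt_toNNReal_iff_coe_lt.2 h1
        rw [if_pos h1]
        by_cases h2 : (s - S).toNNReal ≤ a.1
        · have h2' : s.toNNReal ≤ S + a.1 := by rw [← hw]; gcongr
          rw [if_pos ⟨h1', h2'⟩, if_pos h2]
          congr 1
          refine lintegral_congr fun y => ?_
          simp only [Ψ]
          rw [hw]
          -- Predictability: the integrand at time s does not distinguish the scenario with the
          -- event exactly at s from the one with the event at S + a.1 ≥ s.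
          have := hp y k i s.toNNReal (Function.update ω (k, i) ((s - S).toNNReal, y)) a
            (by rw [eventTime_update_self, ← hS]; exact hw.ge)
            (by rw [Function.update_idem, eventTime_update_self, ← hS]; exact h2')
          rwa [Function.update_idem] at this
        · have h2' : ¬ s.toNNReal ≤ S + a.1 := by
            rw [← hw]
            simpa using h2
          rw [if_neg (fun h => h2' h.2), if_neg h2]
      · have h1' : ¬ S < s.toNNReal := fun h => h1 (Real.lt_toNNReal_iff_coe_lt.1 h)
        rw [if_neg h1, if_neg (fun h => h1' h.1)]
    rw [setLIntegral_congr_fun measurableSet_Ioi e1, lintegral_indicator measurableSet_Ioi,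
      Measure.restrict_restrict measurableSet_Ioi,
      Set.inter_eq_left.2 (Set.Ioi_subset_Ioi (NNReal.coe_nonneg S)), ← lintegral_Ioi_shift]
    simp
  -- Both sides agree because the exponential density is the rate times the survival function:
  -- integrating the indicator of {x ≤ waiting time} over the mark gives exp (-β x).
  rw [lhs, rhs, lintegral_lintegral_swap]
  · refine setLIntegral_congr_fun measurableSet_Ioi fun x hx => ?_
    have hx0 : 0 < x := hx
    have e2 : ∀ a : Mark n, (if x.toNNReal ≤ a.1 then
        ENNReal.ofReal (M.β k) * Φ x.toNNReal else 0) =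
        ENNReal.ofReal (M.β k) * Φ x.toNNReal *
          ({w : ℝ≥0 | x ≤ w} ×ˢ (Set.univ : Set ((Fin n → Bool) × (Fin n → ℝ≥0)))).indicator 1 a := by
      intro a
      simp only [Set.indicator, Set.mem_prod, Set.mem_ofPred_eq, Set.mem_univ, and_true,
        Real.toNNReal_le_iff_le_coe]
      split_ifs <;> simp
    have hms : MeasurableSet ({w : ℝ≥0 | x ≤ w} ×ˢ
        (Set.univ : Set ((Fin n → Bool) × (Fin n → ℝ≥0)))) :=
      (measurableSet_le (by fun_prop) (by fun_prop)).prod MeasurableSet.univ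
    simp only [e2]
    rw [lintegral_const_mul _ (measurable_one.indicator hms), lintegral_indicator_one hms,
      markLaw_eq, Measure.prod_prod, measure_univ, mul_one, M.gapLaw_Ici k hx0.le,
      ENNReal.ofReal_mul hβ.le]
    ring
  · refine Measurable.aemeasurable ?_
    refine Measurable.ite (measurableSet_le (by fun_prop) (by fun_prop)) ?_ measurable_const
    exact Measurable.const_mul (hΦ.comp (by fun_prop)) _

/-- The indicators of the waiting intervals are kept here, since non-explosion is not yet available;
in fact it is deduced from this version. -/
theorem lintegral_events_aux (k : Fin m)
    {h : ℝ≥0 → ((Fin n → Bool) × (Fin n → ℝ≥0)) → Scenario m n → ℝ≥0∞}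
    (hm : Measurable fun q : ℝ≥0 × ((Fin n → Bool) × (Fin n → ℝ≥0)) × Scenario m n =>
      h q.1 q.2.1 q.2.2)
    (hp : ∀ y, EventPredictable fun s ω => h s y ω) :
    ∫⁻ ω, ∑' i, h (eventTime k i ω) (ω (k, i)).2 ω ∂M.prob =
      ∫⁻ ω, (∫⁻ s in Set.Ioi (0 : ℝ), ∑' i,
        (if prevTime k i ω < s.toNNReal ∧ s.toNNReal ≤ eventTime k i ω then
          ENNReal.ofReal (M.β k) * ∫⁻ y, h s.toNNReal y ω ∂(M.hitLaw k) else 0)) ∂M.prob := by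
  have hm' : Measurable fun q : ℝ≥0 × Scenario m n => ∫⁻ y, h q.1 y q.2 ∂(M.hitLaw k) := by
    refine Measurable.lintegral_prod_right' (f := fun q : (ℝ≥0 × Scenario m n) ×
      ((Fin n → Bool) × (Fin n → ℝ≥0)) => h q.1.1 q.2 q.1.2) ?_
    exact hm.comp (f := fun q : (ℝ≥0 × Scenario m n) × ((Fin n → Bool) × (Fin n → ℝ≥0)) =>
      (q.1.1, q.2, q.1.2)) (by fun_prop)
  have hmR : ∀ i, Measurable fun q : Scenario m n × ℝ =>
      (if prevTime k i q.1 < q.2.toNNReal ∧ q.2.toNNReal ≤ eventTime k i q.1 then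
          ENNReal.ofReal (M.β k) * ∫⁻ y, h q.2.toNNReal y q.1 ∂(M.hitLaw k) else 0) := by
    intro i
    refine Measurable.ite ?_ ?_ measurable_const
    · exact (measurableSet_lt (by fun_prop) (by fun_prop)).inter
        (measurableSet_le (by fun_prop) (by fun_prop))
    · exact Measurable.const_mul (hm'.comp (f := fun q : Scenario m n × ℝ => (q.2.toNNReal, q.1))
        (by fun_prop)) _
  have hL : ∀ i, Measurable fun ω => h (eventTime k i ω) (ω (k, i)).2 ω := fun i =>
    hm.comp (f := fun ω => (eventTime k i ω, (ω (k, i)).2, ω)) (by fun_prop)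
  rw [lintegral_tsum fun i => (hL i).aemeasurable]
  simp_rw [fun i => M.lintegral_event k i hm hp]
  rw [← lintegral_tsum fun i => (Measurable.lintegral_prod_right (hmR i)).aemeasurable]
  refine lintegral_congr fun ω => ?_
  have hmS : ∀ i, Measurable fun s : ℝ =>
      (if prevTime k i ω < s.toNNReal ∧ s.toNNReal ≤ eventTime k i ω then
          ENNReal.ofReal (M.β k) * ∫⁻ y, h s.toNNReal y ω ∂(M.hitLaw k) else 0) := fun i =>
    (hmR i).comp (f := fun s : ℝ => (ω, s)) measurable_prodMk_left
  rw [← lintegral_tsum fun i => (hmS i).aemeasurable]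

/-- The intervals from one event to the next are disjoint, so at most one term survives. They cover
the positive axis only if there is no explosion. -/
theorem tsum_interval_le (k : Fin m) (ω : Scenario m n) (s : ℝ≥0) (c : ℝ≥0∞) :
    ∑' i, (if prevTime k i ω < s ∧ s ≤ eventTime k i ω then c else 0) ≤ c := by
  by_cases h : ∃ i, prevTime k i ω < s ∧ s ≤ eventTime k i ω
  · obtain ⟨i, hi⟩ := h
    rw [tsum_eq_single i, if_pos hi]
    intro l hl
    rw [if_neg]
    rintro ⟨h1, h2⟩
    rcases lt_or_gt_of_ne hl with h | h
    · exact absurd (h2.trans (prevTime_mono k ω (Nat.succ_le_of_lt h))) (not_le.2 hi.1)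
    · exact absurd (hi.2.trans (prevTime_mono k ω (Nat.succ_le_of_lt h))) (not_le.2 h1)
  · push Not at h
    rw [ENNReal.tsum_eq_zero.2]
    · exact zero_le
    · intro i
      rw [if_neg]
      rintro ⟨h1, h2⟩
      exact absurd h2 (not_le.2 (h i h1))

theorem tsum_interval_eq {k : Fin m} {ω : Scenario m n} (hω : NonExplosive ω) {s : ℝ≥0}
    (hs : 0 < s) (c : ℝ≥0∞) :
    ∑' i, (if prevTime k i ω < s ∧ s ≤ eventTime k i ω then c else 0) = c := by
  refine le_antisymm (tsum_interval_le k ω s c) ?_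
  have hex : ∃ i, s ≤ eventTime k i ω := by
    by_contra hcon
    push Not at hcon
    refine Set.infinite_univ ((hω k s).subset fun i _ => (hcon i).le)
  classical
  have h1 : s ≤ eventTime k (Nat.find hex) ω := Nat.find_spec hex
  have h2 : prevTime k (Nat.find hex) ω < s := by
    rcases hi : Nat.find hex with _ | i
    · simpa [prevTime] using hs
    · rw [prevTime_succ]
      exact not_le.1 (Nat.find_min hex (by omega))
  calc c = if prevTime k (Nat.find hex) ω < s ∧ s ≤ eventTime k (Nat.find hex) ω then c else 0 := by
        rw [if_pos ⟨h2, h1⟩]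
    _ ≤ _ := ENNReal.le_tsum (f := fun i =>
      if prevTime k i ω < s ∧ s ≤ eventTime k i ω then c else 0) _

/-- Applied to the indicator of {s ≤ N}, the compensation formula bounds the expected number of
events up to time N by β_k N, so this number is almost surely finite. -/
theorem ae_nonExplosive : ∀ᵐ ω ∂M.prob, NonExplosive ω := by
  unfold NonExplosive
  rw [ae_all_iff]
  intro k
  have key : ∀ N : ℕ, ∀ᵐ ω ∂M.prob, {i : ℕ | eventTime k i ω ≤ (N : ℝ≥0)}.Finite := by
    intro N
    have hmeas : Measurable fun q : ℝ≥0 × ((Fin n → Bool) × (Fin n → ℝ≥0)) × Scenario m n =>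
        (if q.1 ≤ (N : ℝ≥0) then 1 else 0 : ℝ≥0∞) :=
      Measurable.ite (measurableSet_le (by fun_prop) (by fun_prop)) measurable_const
        measurable_const
    have h := M.lintegral_events_aux k
      (h := fun s _ _ => if s ≤ (N : ℝ≥0) then 1 else 0) hmeas
      (fun y => by intro _ _ _ _ _ _ _; rfl)
    have hfin : ∫⁻ ω, ∑' i, (if eventTime k i ω ≤ (N : ℝ≥0) then 1 else 0 : ℝ≥0∞) ∂M.prob < ⊤ := by
      rw [h]
      calc _ ≤ ∫⁻ ω, ENNReal.ofReal (M.β k) * ENNReal.ofReal N ∂M.prob := by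
            refine lintegral_mono fun ω => ?_
            calc _ ≤ ∫⁻ s in Set.Ioi (0 : ℝ), (Set.Iic (N : ℝ)).indicator
                    (fun _ => ENNReal.ofReal (M.β k)) s := by
                  refine lintegral_mono fun s => ?_
                  refine (tsum_interval_le k ω s.toNNReal _).trans ?_
                  simp only [lintegral_const, measure_univ, mul_one, Set.indicator, Set.mem_Iic]
                  split_ifs with h1 h2 h2
                  · simp
                  · exfalso
                    apply h2
                    have := Real.toNNReal_le_iff_le_coe.1 h1
                    simpa using this
                  · simp
                  · simp
              _ = _ := by
                  rw [lintegral_indicator measurableSet_Iic, lintegral_const,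
                    Measure.restrict_restrict measurableSet_Iic, Measure.restrict_apply_univ]
                  congr 1
                  rw [show Set.Iic (N : ℝ) ∩ Set.Ioi 0 = Set.Ioc 0 (N : ℝ) by
                    ext; simp [and_comm], Real.volume_Ioc, sub_zero]
        _ < ⊤ := by
            rw [lintegral_const, measure_univ, mul_one]
            exact ENNReal.mul_lt_top (by simp) (by simp)
    have hae := ae_lt_top (μ := M.prob) (by
      refine Measurable.tsum fun i => ?_
      exact Measurable.ite (measurableSet_le (by fun_prop) (by fun_prop)) measurable_const
        measurable_const) hfin.ne
    filter_upwards [hae] with ω hω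
    have := ENNReal.finite_const_le_of_tsum_ne_top hω.ne one_ne_zero
    refine this.subset fun i hi => ?_
    simp only [Set.mem_ofPred_eq] at hi ⊢
    rw [if_pos hi]
  filter_upwards [ae_all_iff.2 key] with ω hω s
  obtain ⟨N, hN⟩ := exists_nat_ge s
  exact (hω N).subset fun i hi => le_trans hi hN

/-- Compensation formula. -/
theorem lintegral_events (k : Fin m)
    {h : ℝ≥0 → ((Fin n → Bool) × (Fin n → ℝ≥0)) → Scenario m n → ℝ≥0∞}
    (hm : Measurable fun q : ℝ≥0 × ((Fin n → Bool) × (Fin n → ℝ≥0)) × Scenario m n =>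
      h q.1 q.2.1 q.2.2)
    (hp : ∀ y, EventPredictable fun s ω => h s y ω) :
    ∫⁻ ω, ∑' i, h (eventTime k i ω) (ω (k, i)).2 ω ∂M.prob =
      ∫⁻ ω, (∫⁻ s in Set.Ioi (0 : ℝ),
          ENNReal.ofReal (M.β k) * ∫⁻ y, h s.toNNReal y ω ∂(M.hitLaw k)) ∂M.prob := by
  rw [M.lintegral_events_aux k hm hp]
  refine lintegral_congr_ae ?_
  filter_upwards [M.ae_nonExplosive] with ω hω
  refine setLIntegral_congr_fun measurableSet_Ioi fun s hs => ?_
  exact tsum_interval_eq hω (Real.toNNReal_pos.2 hs) _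

/-- Almost surely no event takes place immediately after the preceding one of its class. -/
theorem ae_gap_pos : ∀ᵐ ω ∂M.prob, ∀ j : Fin m × ℕ, 0 < (ω j).1 := by
  rw [ae_all_iff]
  rintro ⟨k, i⟩
  have hms : MeasurableSet {ω : Scenario m n | (ω (k, i)).1 = 0} :=
    measurableSet_eq_fun (by fun_prop) measurable_const
  have h0 : M.prob {ω : Scenario m n | (ω (k, i)).1 = 0} = 0 := by
    rw [← lintegral_indicator_one hms,
      M.lintegral_prob_update (k, i) (measurable_one.indicator hms)]
    have : ∀ ω : Scenario m n, ∫⁻ a, ({ω : Scenario m n | (ω (k, i)).1 = 0}.indicator 1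
        (Function.update ω (k, i) a) : ℝ≥0∞) ∂(M.markLaw k) = 0 := by
      intro ω
      have e : ∀ a : Mark n, ({ω : Scenario m n | (ω (k, i)).1 = 0}.indicator 1
        (Function.update ω (k, i) a) : ℝ≥0∞) = (({0} : Set ℝ≥0) ×ˢ
          (Set.univ : Set ((Fin n → Bool) × (Fin n → ℝ≥0)))).indicator 1 a := by
        intro a
        simp [Set.indicator]
      simp only [e]
      rw [lintegral_indicator_one ((measurableSet_singleton _).prod MeasurableSet.univ),
        markLaw_eq, Measure.prod_prod, gapLaw_singleton, zero_mul]
    simp [this]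
  filter_upwards [measure_eq_zero_iff_ae_notMem.1 h0] with ω hω
  exact pos_iff_ne_zero.2 hω

/-- Almost surely events of different classes take place at different times. -/
theorem ae_eventTime_ne : ∀ᵐ ω ∂M.prob, ∀ (k k' : Fin m) (i i' : ℕ), k ≠ k' →
    eventTime k i ω ≠ eventTime k' i' ω := by
  rw [ae_all_iff]; intro k
  rw [ae_all_iff]; intro k'
  rw [ae_all_iff]; intro i
  rw [ae_all_iff]; intro i'
  by_cases hk : k = k'
  · exact ae_of_all _ fun ω h => absurd hk h
  have hms : MeasurableSet {ω : Scenario m n | eventTime k i ω = eventTime k' i' ω} :=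
    measurableSet_eq_fun (by fun_prop) (by fun_prop)
  have h0 : M.prob {ω : Scenario m n | eventTime k i ω = eventTime k' i' ω} = 0 := by
    rw [← lintegral_indicator_one hms,
      M.lintegral_prob_update (k, i) (measurable_one.indicator hms)]
    have : ∀ ω : Scenario m n, ∫⁻ a, ({ω : Scenario m n | eventTime k i ω =
        eventTime k' i' ω}.indicator 1 (Function.update ω (k, i) a) : ℝ≥0∞) ∂(M.markLaw k) = 0 := by
      intro ω
      refine le_antisymm ?_ zero_le
      -- A coincidence prescribes the resampled waiting time. If the truncated subtraction is not a
      -- true difference there is no coincidence at all, so an inequality suffices.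
      have e : ∀ a : Mark n, ({ω : Scenario m n | eventTime k i ω =
          eventTime k' i' ω}.indicator 1 (Function.update ω (k, i) a) : ℝ≥0∞) ≤
          (({eventTime k' i' ω - prevTime k i ω} : Set ℝ≥0) ×ˢ
          (Set.univ : Set ((Fin n → Bool) × (Fin n → ℝ≥0)))).indicator 1 a := by
        intro a
        simp only [Set.indicator, Set.mem_ofPred_eq, Set.mem_prod, Set.mem_singleton_iff,
          Set.mem_univ, and_true, eventTime_update_self, eventTime_update_of_ne (Ne.symm hk)]
        split_ifs with h1 h2 h2
        · exact le_rfl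
        · exact absurd (by rw [← h1, add_tsub_cancel_left]) h2
        · exact zero_le
        · exact le_rfl
      refine (lintegral_mono e).trans ?_
      rw [lintegral_indicator_one ((measurableSet_singleton _).prod MeasurableSet.univ),
        markLaw_eq, Measure.prod_prod, gapLaw_singleton, zero_mul]
    simp [this]
  filter_upwards [measure_eq_zero_iff_ae_notMem.1 h0] with ω hω _
  exact hω

end RiskModel

/-! ### Change of variables along a deterministic path between claims -/

/-- The driving data of a surplus path between claims: cumulative dividends `D` with Stieltjes
measure `μ`, and premium rates `p` bounded by `K`. -/
structure PathData (D : ℝ → ℝ) (μ : Measure ℝ) (p : ℝ → ℝ) (K : ℝ) : Prop where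
  mono : Monotone D
  leftCont : ∀ t, ContinuousWithinAt D (Set.Iic t) t
  measure_Ico : ∀ s t, s ≤ t → μ (Set.Ico s t) = ENNReal.ofReal (D t - D s)
  measurable : Measurable p
  bound : ∀ s, |p s| ≤ K

/-- A continuously differentiable test function on the surplus axis with slope at least one. -/
structure SlopeFunction (v dv : ℝ → ℝ) : Prop where
  hasDerivAt : ∀ z, HasDerivAt v (dv z) z
  continuous_deriv : Continuous dv
  one_le : ∀ z, 0 ≤ z → 1 ≤ dv z
  nonneg : ∀ z, 0 ≤ z → 0 ≤ v z

namespace SlopeFunction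

variable {v dv : ℝ → ℝ}

theorem continuous (hv : SlopeFunction v dv) : Continuous v :=
  continuous_iff_continuousAt.2 fun z => (hv.hasDerivAt z).continuousAt

theorem add_le (hv : SlopeFunction v dv) {z w : ℝ} (hz : 0 ≤ z) (hw : z ≤ w) : v z + (w - z) ≤ v w := by
  have := Convex.mul_sub_le_image_sub_of_le_deriv (convex_Ici (0 : ℝ)) (f := v) (C := 1)
    hv.continuous.continuousOn (fun x _ => (hv.hasDerivAt x).differentiableAt.differentiableWithinAt)
    (fun x hx => by
      rw [(hv.hasDerivAt x).deriv]
      exact hv.one_le x (interior_subset hx)) z hz w (hz.trans hw) hw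
  linarith

theorem exists_bound (hv : SlopeFunction v dv) (B : ℝ) : ∃ C, 0 ≤ C ∧ ∀ z ∈ Set.Icc 0 B, |v z| ≤ C ∧ |dv z| ≤ C := by
  obtain ⟨C₁, h₁⟩ := isCompact_Icc.exists_bound_of_continuousOn (hv.continuous.continuousOn
    (s := Set.Icc 0 B))
  obtain ⟨C₂, h₂⟩ := isCompact_Icc.exists_bound_of_continuousOn (hv.continuous_deriv.continuousOn
    (s := Set.Icc 0 B))
  refine ⟨max (max C₁ C₂) 0, le_max_right _ _, fun z hz => ⟨?_, ?_⟩⟩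
  · exact (h₁ z hz).trans ((le_max_left _ _).trans (le_max_left _ _))
  · exact (h₂ z hz).trans ((le_max_right _ _).trans (le_max_left _ _))

end SlopeFunction

namespace PathData

variable {D : ℝ → ℝ} {μ : Measure ℝ} {p : ℝ → ℝ} {K : ℝ}

theorem K_nonneg (hD : PathData D μ p K) : 0 ≤ K := (abs_nonneg _).trans (hD.bound 0)

theorem intervalIntegrable (hD : PathData D μ p K) (s t : ℝ) : IntervalIntegrable p volume s t := by
  rw [intervalIntegrable_iff]
  exact Measure.integrableOn_of_bounded (M := K) (by simp) hD.measurable.aestronglyMeasurable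
    (ae_of_all _ hD.bound)

theorem abs_integral_le (hD : PathData D μ p K) {s t : ℝ} (h : s ≤ t) : |∫ r in s..t, p r| ≤ K * (t - s) := by
  have := intervalIntegral.norm_integral_le_of_norm_le_const (a := s) (b := t) (f := p) (C := K)
    fun x _ => hD.bound x
  rwa [abs_of_nonneg (sub_nonneg.2 h)] at this

theorem continuous_integral (hD : PathData D μ p K) (a : ℝ) : Continuous fun s => ∫ r in a..s, p r :=
  intervalIntegral.continuous_primitive hD.intervalIntegrable a

theorem integrableOn_exp (hD : PathData D μ p K) {δ : ℝ} {s t : ℝ} :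
    IntegrableOn (fun r => Real.exp (-δ * r)) (Set.Ico s t) μ := by
  rcases le_or_gt s t with h | h
  · have hc : IntegrableOn (fun r => Real.exp (-δ * r)) (Set.Icc s t) (μ.restrict (Set.Ico s t)) := by
      have : IsFiniteMeasure (μ.restrict (Set.Ico s t)) :=
        ⟨by rw [Measure.restrict_apply_univ, hD.measure_Ico s t h]; simp⟩
      exact ContinuousOn.integrableOn_compact isCompact_Icc (by fun_prop)
    rw [IntegrableOn, Measure.restrict_restrict measurableSet_Icc,
      Set.inter_eq_right.2 Set.Ico_subset_Icc_self] at hc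
    exact hc
  · rw [Set.Ico_eq_empty (not_lt.2 h.le)]; exact integrableOn_empty

theorem integral_exp_le (hD : PathData D μ p K) {δ : ℝ} (hδ : 0 < δ) {s t : ℝ} (h : s ≤ t) :
    ∫ r in Set.Ico s t, Real.exp (-δ * r) ∂μ ≤ Real.exp (-δ * s) * (D t - D s) := by
  have hfin : μ (Set.Ico s t) ≠ ⊤ := by rw [hD.measure_Ico s t h]; simp
  calc ∫ r in Set.Ico s t, Real.exp (-δ * r) ∂μ
      ≤ ∫ r in Set.Ico s t, Real.exp (-δ * s) ∂μ := by
        refine setIntegral_mono_on hD.integrableOn_exp (integrableOn_const hfin)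
          measurableSet_Ico fun r hr => Real.exp_le_exp.2 ?_
        nlinarith [hr.1]
    _ = _ := by
        rw [setIntegral_const, smul_eq_mul, Measure.real, hD.measure_Ico s t h,
          ENNReal.toReal_ofReal (sub_nonneg.2 (hD.mono h)), mul_comm]

/-- One step of the discretized chain rule. -/
theorem step_le (hD : PathData D μ p K) {v dv : ℝ → ℝ} (hv : SlopeFunction v dv) {δ : ℝ} (hδ : 0 < δ) {s t : ℝ}
    (hs : 0 ≤ s) (hst : s ≤ t) {y₀ y₁ B ε : ℝ} (hy₀ : 0 ≤ y₀) (hy₁ : 0 ≤ y₁) (hyB : y₀ ≤ B)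
    (hPB : y₀ + (∫ r in s..t, p r) ≤ B)
    (hy : y₁ = y₀ + (∫ r in s..t, p r) - (D t - D s)) (hε : 0 ≤ ε)
    (hosc : ∀ ξ ∈ Set.Icc 0 B, |ξ - y₀| ≤ K * (t - s) → |dv ξ - dv y₀| ≤ ε) :
    (∫ r in Set.Ico s t, Real.exp (-δ * r) ∂μ) + Real.exp (-δ * t) * v y₁
      - Real.exp (-δ * s) * v y₀ ≤
    (∫ r in s..t, (Real.exp (-δ * t) * dv y₀ * p r - δ * Real.exp (-δ * r) * v y₀))
      + ε * (K * (t - s)) + δ * (t - s) * (D t - D s) := by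
  -- The step is split in two moves: first collect the premium P, then pay out all dividends of the
  -- step. The errors come from the oscillation of dv and from discounting dividends at s instead of
  -- t.
  set P := ∫ r in s..t, p r with hP
  have hPabs : |P| ≤ K * (t - s) := hD.abs_integral_le hst
  have hDst : 0 ≤ D t - D s := sub_nonneg.2 (hD.mono hst)
  have h1 := hD.integral_exp_le (μ := μ) hδ hst
  have hes : Real.exp (-δ * s) ≤ 1 := Real.exp_le_one_iff.2 (by nlinarith)
  have het : Real.exp (-δ * t) ≤ 1 := Real.exp_le_one_iff.2 (by nlinarith)
  have het0 := Real.exp_pos (-δ * t)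
  have hediff : Real.exp (-δ * s) - Real.exp (-δ * t) ≤ δ * (t - s) := by
    have : Real.exp (-δ * t) = Real.exp (-δ * s) * Real.exp (-(δ * (t - s))) := by
      rw [← Real.exp_add]; congr 1; ring
    rw [this]
    have h2 := Real.add_one_le_exp (-(δ * (t - s)))
    have h3 : 0 ≤ δ * (t - s) := mul_nonneg hδ.le (sub_nonneg.2 hst)
    nlinarith [Real.exp_pos (-δ * s)]
  -- the drift part
  have hdrift : v (y₀ + P) ≤ v y₀ + dv y₀ * P + ε * (K * (t - s)) := by
    have key : ∃ ξ ∈ Set.Icc 0 B, |ξ - y₀| ≤ |P| ∧ v (y₀ + P) - v y₀ = dv ξ * P := by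
      have hyP : 0 ≤ y₀ + P := by linarith
      rcases lt_trichotomy P 0 with hP0 | hP0 | hP0
      · obtain ⟨ξ, hξ, he⟩ := exists_hasDerivAt_eq_slope v dv (show y₀ + P < y₀ by linarith)
          hv.continuous.continuousOn (fun x _ => hv.hasDerivAt x)
        refine ⟨ξ, ⟨by linarith [hξ.1], by linarith [hξ.2]⟩, ?_, ?_⟩
        · rw [abs_of_neg (by linarith [hξ.2]), abs_of_neg hP0]; linarith [hξ.1]
        · rw [he]
          have : y₀ - (y₀ + P) ≠ 0 := by
            intro h; linarith
          field_simp
          ring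
      · exact ⟨y₀, ⟨hy₀, hyB⟩, by simp, by simp [hP0]⟩
      · obtain ⟨ξ, hξ, he⟩ := exists_hasDerivAt_eq_slope v dv (show y₀ < y₀ + P by linarith)
          hv.continuous.continuousOn (fun x _ => hv.hasDerivAt x)
        refine ⟨ξ, ⟨by linarith [hξ.1], by linarith [hξ.2]⟩, ?_, ?_⟩
        · rw [abs_of_pos (by linarith [hξ.1]), abs_of_pos hP0]; linarith [hξ.2]
        · rw [he]
          have : y₀ + P - y₀ ≠ 0 := by
            intro h; linarith
          field_simp
          ring
    obtain ⟨ξ, hξ, hξy, he⟩ := key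
    have h4 := hosc ξ hξ (hξy.trans hPabs)
    have h5 : (dv ξ - dv y₀) * P ≤ ε * (K * (t - s)) := by
      calc (dv ξ - dv y₀) * P ≤ |dv ξ - dv y₀| * |P| := by
            rw [← abs_mul]; exact le_abs_self _
        _ ≤ ε * (K * (t - s)) := by gcongr
    nlinarith
  -- Slope at least one: a payment lowers v by at least the amount paid.
  have hdiv : v y₁ ≤ v (y₀ + P) - (D t - D s) := by
    have := hv.add_le hy₁ (show y₁ ≤ y₀ + P by linarith)
    rw [hy] at this ⊢
    linarith
  have hint : (∫ r in s..t, (Real.exp (-δ * t) * dv y₀ * p r - δ * Real.exp (-δ * r) * v y₀)) =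
      Real.exp (-δ * t) * dv y₀ * P + (Real.exp (-δ * t) - Real.exp (-δ * s)) * v y₀ := by
    have hder : ∀ x ∈ Set.uIcc s t, HasDerivAt (fun r => Real.exp (-δ * r) * v y₀)
        (-(δ * Real.exp (-δ * x) * v y₀)) x := by
      intro x _
      have := (((hasDerivAt_id x).const_mul (-δ)).exp).mul_const (v y₀)
      refine this.congr_deriv ?_
      simp only [id, mul_one]
      ring
    have hci : IntervalIntegrable (fun r => -(δ * Real.exp (-δ * r) * v y₀)) volume s t :=
      Continuous.intervalIntegrable (by fun_prop) _ _
    have h6 := intervalIntegral.integral_eq_sub_of_hasDerivAt hder hci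
    have h7 : (∫ r in s..t, (Real.exp (-δ * t) * dv y₀ * p r - δ * Real.exp (-δ * r) * v y₀)) =
        (∫ r in s..t, Real.exp (-δ * t) * dv y₀ * p r) +
          ∫ r in s..t, -(δ * Real.exp (-δ * r) * v y₀) := by
      rw [← intervalIntegral.integral_add ((hD.intervalIntegrable s t).const_mul _) hci]
      rfl
    rw [h7, h6, intervalIntegral.integral_const_mul]
    ring
  rw [hint]
  have hfin : Real.exp (-δ * t) * v y₁ ≤
      Real.exp (-δ * t) * (v y₀ + dv y₀ * P + ε * (K * (t - s)) - (D t - D s)) :=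
    mul_le_mul_of_nonneg_left (by linarith) het0.le
  have h8 : Real.exp (-δ * t) * (ε * (K * (t - s))) ≤ ε * (K * (t - s)) := by
    have : 0 ≤ ε * (K * (t - s)) :=
      mul_nonneg hε (mul_nonneg hD.K_nonneg (sub_nonneg.2 hst))
    nlinarith
  nlinarith [mul_le_mul_of_nonneg_right hediff hDst]

/-- The surplus starting with `z` at time `a`, in the absence of claims. -/
theorem measurable_path (hD : PathData D μ p K) (a z : ℝ) : Measurable fun s => z + (∫ r in a..s, p r) - (D s - D a) :=
  ((hD.continuous_integral a).measurable.const_add z).sub (hD.mono.measurable.sub_const _)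

/-- Change of variables inequality along a surplus path without claims. -/
theorem path_le (hD : PathData D μ p K) {v dv : ℝ → ℝ} (hv : SlopeFunction v dv) {δ : ℝ} (hδ : 0 < δ) {a b : ℝ}
    (ha : 0 ≤ a) (hab : a ≤ b) {z : ℝ} {y : ℝ → ℝ}
    (hy : ∀ s, y s = z + (∫ r in a..s, p r) - (D s - D a)) (hpos : ∀ s ∈ Set.Icc a b, 0 ≤ y s) :
    (∫ r in Set.Ico a b, Real.exp (-δ * r) ∂μ) + Real.exp (-δ * b) * v (y b) ≤
      Real.exp (-δ * a) * v z +
        ∫ r in a..b, (Real.exp (-δ * r) * dv (y r) * p r - δ * Real.exp (-δ * r) * v (y r)) := by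
  have hya : y a = z := by rw [hy]; simp
  rcases hab.eq_or_lt with rfl | hab'
  · simp [hya]
  have hmy : Measurable y := by
    rw [show y = _ from funext hy]; exact hD.measurable_path a z
  set B : ℝ := z + K * (b - a) with hB
  have hyB : ∀ s ∈ Set.Icc a b, y s ≤ B := by
    intro s hs
    have h1 := (le_abs_self _).trans (hD.abs_integral_le hs.1)
    have h2 := hD.mono hs.1
    have h3 : K * (s - a) ≤ K * (b - a) :=
      mul_le_mul_of_nonneg_left (by linarith [hs.2]) hD.K_nonneg
    rw [hy, hB]; linarith
  obtain ⟨C, hC0, hC⟩ := hv.exists_bound B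
  have huc : UniformContinuousOn dv (Set.Icc 0 B) :=
    isCompact_Icc.uniformContinuousOn_of_continuous hv.continuous_deriv.continuousOn
  set L : ℝ := b - a with hL
  have hLpos : 0 < L := sub_pos.2 hab'
  -- left end point of the grid cell
  let l : ℕ → ℝ → ℝ := fun N r => a + L / (N + 1) * ⌊(r - a) / (L / (N + 1))⌋
  let f : ℕ → ℝ → ℝ := fun N r =>
    Real.exp (-δ * (l N r + L / (N + 1))) * dv (y (l N r)) * p r
      - δ * Real.exp (-δ * r) * v (y (l N r))
  have hLN : ∀ N : ℕ, 0 < L / (N + 1) := fun N => by positivity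
  have hl_le : ∀ N r, l N r ≤ r := by
    intro N r
    have := Int.floor_le ((r - a) / (L / (N + 1)))
    rw [le_div_iff₀ (hLN N)] at this
    simp only [l]; linarith
  have hl_lt : ∀ N r, r < l N r + L / (N + 1) := by
    intro N r
    have := Int.lt_floor_add_one ((r - a) / (L / (N + 1)))
    rw [div_lt_iff₀ (hLN N)] at this
    simp only [l]; linarith
  have hl_a : ∀ N r, a ≤ r → a ≤ l N r := by
    intro N r hr
    have : (0 : ℤ) ≤ ⌊(r - a) / (L / (N + 1))⌋ :=
      Int.floor_nonneg.2 (div_nonneg (sub_nonneg.2 hr) (hLN N).le)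
    have h2 : (0 : ℝ) ≤ ⌊(r - a) / (L / (N + 1))⌋ := by exact_mod_cast this
    have := mul_nonneg (hLN N).le h2
    simp only [l]; linarith
  have hLN0 : Tendsto (fun N : ℕ => L / ((N : ℝ) + 1)) atTop (𝓝 0) := by
    simpa [div_eq_mul_inv] using
      (tendsto_one_div_add_atTop_nhds_zero_nat (𝕜 := ℝ)).const_mul L
  have hl_tendsto : ∀ r, Tendsto (fun N => l N r) atTop (𝓝 r) := by
    intro r
    refine tendsto_of_tendsto_of_tendsto_of_le_of_le
      (g := fun N : ℕ => r - L / ((N : ℝ) + 1)) ?_ tendsto_const_nhds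
      (fun N => by have := hl_lt N r; simp only; linarith) (fun N => hl_le N r)
    simpa using (tendsto_const_nhds (x := r)).sub hLN0
  -- Left continuity of D is what makes left end points of grid cells the right choice: they
  -- approach r from the left, so the discretized integrands converge everywhere.
  have hy_left : ∀ r, ContinuousWithinAt y (Set.Iic r) r := by
    intro r
    rw [show y = _ from funext hy]
    exact (continuousWithinAt_const.add (hD.continuous_integral a).continuousWithinAt).sub
      ((hD.leftCont r).sub continuousWithinAt_const)
  have hyl : ∀ r, Tendsto (fun N => y (l N r)) atTop (𝓝 (y r)) := by
    intro r
    refine (hy_left r).tendsto.comp (tendsto_nhdsWithin_iff.2 ⟨hl_tendsto r, ?_⟩)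
    exact Eventually.of_forall fun N => hl_le N r
  have hml : ∀ N, Measurable (l N) := by
    intro N
    refine Measurable.const_add (Measurable.const_mul ?_ _) _
    exact (measurable_from_top (f := fun k : ℤ => (k : ℝ))).comp
      (Int.measurable_floor.comp (by fun_prop))
  have hmf : ∀ N, Measurable (f N) := by
    intro N
    have h1 : Measurable fun r => dv (y (l N r)) :=
      hv.continuous_deriv.measurable.comp (hmy.comp (hml N))
    have h2 : Measurable fun r => v (y (l N r)) :=
      hv.continuous.measurable.comp (hmy.comp (hml N))
    have h3 : Measurable fun r => Real.exp (-δ * (l N r + L / (N + 1))) :=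
      Real.measurable_exp.comp (((hml N).add_const _).const_mul _)
    exact ((h3.mul h1).mul hD.measurable).sub (Measurable.mul (by fun_prop) h2)
  have hbound : ∀ N, ∀ r ∈ Set.Ioc a b, ‖f N r‖ ≤ C * K + δ * C := by
    intro N r hr
    have hmem : l N r ∈ Set.Icc a b := ⟨hl_a N r hr.1.le, (hl_le N r).trans hr.2⟩
    obtain ⟨hCv, hCd⟩ := hC (y (l N r)) ⟨hpos _ hmem, hyB _ hmem⟩
    have hr0 : 0 ≤ r := ha.trans hr.1.le
    have e1 : Real.exp (-δ * (l N r + L / (N + 1))) ≤ 1 :=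
      Real.exp_le_one_iff.2 (by nlinarith [hl_lt N r])
    have e2 : Real.exp (-δ * r) ≤ 1 := Real.exp_le_one_iff.2 (by nlinarith)
    have g1 : |Real.exp (-δ * (l N r + L / (N + 1))) * dv (y (l N r)) * p r| ≤ C * K := by
      rw [abs_mul, abs_mul, abs_of_pos (Real.exp_pos _)]
      have := hD.bound r
      calc _ ≤ 1 * C * K := by gcongr
        _ = C * K := by ring
    have g2 : |δ * Real.exp (-δ * r) * v (y (l N r))| ≤ δ * C := by
      rw [abs_mul, abs_mul, abs_of_pos (Real.exp_pos _), abs_of_pos hδ]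
      calc _ ≤ δ * 1 * C := by gcongr
        _ = δ * C := by ring
    exact (abs_sub _ _).trans (add_le_add g1 g2)
  have hfint : ∀ N, IntervalIntegrable (f N) volume a b := by
    intro N
    rw [intervalIntegrable_iff, Set.uIoc_of_le hab]
    exact Measure.integrableOn_of_bounded (M := C * K + δ * C) (by simp)
      (hmf N).aestronglyMeasurable
      ((ae_restrict_iff' measurableSet_Ioc).2 (ae_of_all _ (hbound N)))
  have hlim : Tendsto (fun N => ∫ r in a..b, f N r) atTop
      (𝓝 (∫ r in a..b, (Real.exp (-δ * r) * dv (y r) * p r - δ * Real.exp (-δ * r) * v (y r)))) := by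
    refine intervalIntegral.tendsto_integral_filter_of_dominated_convergence
      (fun _ => C * K + δ * C) (Eventually.of_forall fun N => (hmf N).aestronglyMeasurable)
      (Eventually.of_forall fun N => ae_of_all _ fun r hr => hbound N r
        (by rwa [Set.uIoc_of_le hab] at hr)) (by simp) (ae_of_all _ fun r _ => ?_)
    have t1 := (hv.continuous_deriv.tendsto (y r)).comp (hyl r)
    have t2 := (hv.continuous.tendsto (y r)).comp (hyl r)
    have t3 : Tendsto (fun N : ℕ => Real.exp (-δ * (l N r + L / (N + 1)))) atTop
        (𝓝 (Real.exp (-δ * r))) := by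
      refine (Real.continuous_exp.tendsto _).comp (Tendsto.const_mul (-δ) ?_)
      simpa using (hl_tendsto r).add hLN0
    exact ((t3.mul t1).mul_const _).sub (t2.const_mul _)
  -- discretized inequality
  have hdisc : ∀ ε > 0, ∀ᶠ N : ℕ in atTop,
      (∫ r in Set.Ico a b, Real.exp (-δ * r) ∂μ) + Real.exp (-δ * b) * v (y b)
        - Real.exp (-δ * a) * v z ≤
      (∫ r in a..b, f N r) + ε * (K * L) + δ * (L / (N + 1)) * (D b - D a) := by
    intro ε hε
    obtain ⟨η, hη, huc'⟩ := Metric.uniformContinuousOn_iff.1 huc ε hε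
    have hsmall : ∀ᶠ N : ℕ in atTop, K * (L / (N + 1)) < η := by
      have := hLN0.const_mul K
      rw [mul_zero] at this
      exact this.eventually_lt_const hη
    filter_upwards [hsmall] with N hN
    set h : ℝ := L / (N + 1) with hh
    have hhpos : 0 < h := hLN N
    let t : ℕ → ℝ := fun i => a + h * i
    have ht0 : t 0 = a := by simp [t]
    have htN : t (N + 1) = b := by
      simp only [t, hh, hL]; push_cast; field_simp; ring
    have hts : ∀ i, t (i + 1) = t i + h := fun i => by simp only [t]; push_cast; ring
    have htmono : Monotone t := monotone_nat_of_le_succ fun i => by rw [hts]; linarith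
    have hsum : ∀ j ≤ N + 1,
        (∫ r in Set.Ico a (t j), Real.exp (-δ * r) ∂μ) + Real.exp (-δ * t j) * v (y (t j))
          - Real.exp (-δ * a) * v z ≤
        (∫ r in a..(t j), f N r) + ε * (K * (t j - a)) + δ * h * (D (t j) - D a) := by
      intro j
      induction j with
      | zero => intro _; simp [ht0, hya]
      | succ j ih =>
        intro hj
        have ih := ih (by omega)
        have hta : a ≤ t j := ht0 ▸ htmono (Nat.zero_le j)
        have htb : t (j + 1) ≤ b := htN ▸ htmono hj
        have hst : t j ≤ t (j + 1) := htmono (Nat.le_succ j)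
        have hm1 : t j ∈ Set.Icc a b := ⟨hta, hst.trans htb⟩
        have hm2 : t (j + 1) ∈ Set.Icc a b := ⟨hta.trans hst, htb⟩
        have hadd : (∫ r in a..(t j), p r) + (∫ r in (t j)..(t (j + 1)), p r) =
            ∫ r in a..(t (j + 1)), p r :=
          intervalIntegral.integral_add_adjacent_intervals (hD.intervalIntegrable _ _)
            (hD.intervalIntegrable _ _)
        have hstep := hD.step_le hv hδ (ha.trans hta) hst (hpos _ hm1) (hpos _ hm2) (hyB _ hm1)
          (by
            have h1 := (le_abs_self _).trans (hD.abs_integral_le hm2.1)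
            have h2 := hD.mono hta
            have h3 : K * (t (j + 1) - a) ≤ K * (b - a) :=
              mul_le_mul_of_nonneg_left (by linarith) hD.K_nonneg
            rw [hy, hB]; linarith)
          (by rw [hy, hy, ← hadd]; ring) hε.le (fun ξ hξ hξy => by
            have := huc' ξ hξ (y (t j)) ⟨hpos _ hm1, hyB _ hm1⟩ (by
              rw [Real.dist_eq]
              refine hξy.trans_lt ?_
              rw [hts, add_sub_cancel_left]
              exact hN)
            rw [Real.dist_eq] at this
            exact this.le)
        have hcell : (∫ r in (t j)..(t (j + 1)), f N r) = ∫ r in (t j)..(t (j + 1)),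
            (Real.exp (-δ * t (j + 1)) * dv (y (t j)) * p r
              - δ * Real.exp (-δ * r) * v (y (t j))) := by
          -- The floor function belongs to cells closed on the left, the interval integral to cells
          -- closed on the right; the right end point is discarded as a null set.
          refine intervalIntegral.integral_congr_ae ?_
          filter_upwards [measure_eq_zero_iff_ae_notMem.1
            (Real.volume_singleton (a := t (j + 1)))] with r hr hr'
          rw [Set.uIoc_of_le hst] at hr'
          have hfl : ⌊(r - a) / h⌋ = (j : ℤ) := by
            rw [Int.floor_eq_iff]
            have hr2 : r < t (j + 1) := lt_of_le_of_ne hr'.2 hr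
            have hr1 := hr'.1
            simp only [t] at hr1 hr2
            push_cast at hr2 ⊢
            rw [le_div_iff₀ hhpos, div_lt_iff₀ hhpos]
            constructor <;> nlinarith
          have hlr : l N r = t j := by
            simp only [l, t, ← hh, hfl]; push_cast; ring
          simp only [f, ← hh, hlr, hts]
        have hIf : ∀ c d : ℝ, c ∈ Set.Icc a b → d ∈ Set.Icc a b →
            IntervalIntegrable (f N) volume c d := fun c d hc hd =>
          (hfint N).mono_set (by
            rw [Set.uIcc_of_le hab]; exact Set.uIcc_subset_Icc hc hd)
        have hIadd : (∫ r in a..(t j), f N r) + (∫ r in (t j)..(t (j + 1)), f N r) =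
            ∫ r in a..(t (j + 1)), f N r :=
          intervalIntegral.integral_add_adjacent_intervals
            (hIf _ _ ⟨le_rfl, hab⟩ hm1) (hIf _ _ hm1 hm2)
        have hμadd : (∫ r in Set.Ico a (t (j + 1)), Real.exp (-δ * r) ∂μ) =
            (∫ r in Set.Ico a (t j), Real.exp (-δ * r) ∂μ) +
              ∫ r in Set.Ico (t j) (t (j + 1)), Real.exp (-δ * r) ∂μ := by
          rw [← Set.Ico_union_Ico_eq_Ico hta hst]
          refine setIntegral_union ?_ measurableSet_Ico hD.integrableOn_exp hD.integrableOn_exp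
          exact Set.disjoint_left.2 fun x hx hx' => absurd hx.2 (not_lt.2 hx'.1)
        rw [hμadd, ← hIadd, hcell]
        have hh' : t (j + 1) - t j = h := by rw [hts]; ring
        rw [hh'] at hstep
        have : ε * (K * (t (j + 1) - a)) = ε * (K * (t j - a)) + ε * (K * h) := by
          rw [hts]; ring
        rw [this]
        linarith
    have := hsum (N + 1) le_rfl
    rw [htN] at this
    exact this
  rw [← sub_le_iff_le_add']
  refine le_of_forall_pos_le_add fun ε hε => ?_
  have hKL : 0 ≤ K * L := mul_nonneg hD.K_nonneg hLpos.le
  have hlim2 : Tendsto (fun N : ℕ => (∫ r in a..b, f N r) + ε / (K * L + 1) * (K * L) +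
      δ * (L / (N + 1)) * (D b - D a)) atTop
      (𝓝 ((∫ r in a..b, (Real.exp (-δ * r) * dv (y r) * p r - δ * Real.exp (-δ * r) * v (y r)))
        + ε / (K * L + 1) * (K * L) + δ * 0 * (D b - D a))) :=
    (hlim.add_const _).add ((hLN0.const_mul δ).mul_const _)
  have h9 := ge_of_tendsto hlim2 (hdisc (ε / (K * L + 1)) (by positivity))
  have h10 : ε / (K * L + 1) * (K * L) ≤ ε := by
    rw [div_mul_eq_mul_div, div_le_iff₀ (by positivity)]
    nlinarith
  linarith

end PathData

/-! ### Change of variables along a path with finitely many claims -/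

namespace PathData

variable {D : ℝ → ℝ} {μ : Measure ℝ} {p : ℝ → ℝ} {K : ℝ}

/-- Surplus before the claims at time `s`, for claims of size `c e` at times `T e`, `e ∈ E`. -/
def jumpPath (D p : ℝ → ℝ) {ι : Type*} (z : ℝ) (E : Finset ι) (T c : ι → ℝ) (s : ℝ) : ℝ :=
  z + (∫ r in (0 : ℝ)..s, p r) - (D s - D 0) - ∑ e ∈ E, if T e < s then c e else 0

theorem measurable_jumpPath (hD : PathData D μ p K) {ι : Type*} (z : ℝ) (E : Finset ι)
    (T c : ι → ℝ) : Measurable (jumpPath D p z E T c) := by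
  refine (hD.measurable_path 0 z).sub (Finset.measurable_sum _ fun e _ => ?_)
  exact Measurable.ite (measurableSet_lt measurable_const measurable_id) measurable_const
    measurable_const

theorem jumpPath_le (hD : PathData D μ p K) {ι : Type*} (z : ℝ) (E : Finset ι)
    (T c : ι → ℝ) (hc : ∀ e ∈ E, 0 ≤ c e) {s : ℝ} (hs : 0 ≤ s) :
    jumpPath D p z E T c s ≤ z + K * s := by
  have h1 := (le_abs_self _).trans (hD.abs_integral_le hs)
  have h2 := hD.mono hs
  have h3 : 0 ≤ ∑ e ∈ E, if T e < s then c e else 0 := Finset.sum_nonneg fun e he => by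
    split_ifs
    exacts [hc e he, le_rfl]
  rw [jumpPath]; linarith

/-- The drift of the discounted test function along a path. -/
def drift (δ : ℝ) (v dv p y : ℝ → ℝ) (r : ℝ) : ℝ :=
  Real.exp (-δ * r) * dv (y r) * p r - δ * Real.exp (-δ * r) * v (y r)

theorem intervalIntegrable_drift (hD : PathData D μ p K) {v dv : ℝ → ℝ}
    (hv : SlopeFunction v dv) {δ : ℝ} (hδ : 0 < δ) {b B : ℝ} (hb : 0 ≤ b) {y : ℝ → ℝ}
    (hmy : Measurable y) (hpos : ∀ s ∈ Set.Ioc 0 b, 0 ≤ y s ∧ y s ≤ B) :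
    IntervalIntegrable (drift δ v dv p y) volume 0 b := by
  obtain ⟨C, hC0, hC⟩ := hv.exists_bound B
  rw [intervalIntegrable_iff, Set.uIoc_of_le hb]
  have hm : Measurable (drift δ v dv p y) := by
    have h1 := hv.continuous_deriv.measurable.comp hmy
    have h2 := hv.continuous.measurable.comp hmy
    have h3 : Measurable fun r => Real.exp (-δ * r) := by fun_prop
    exact ((h3.mul h1).mul hD.measurable).sub ((h3.const_mul δ).mul h2)
  refine Measure.integrableOn_of_bounded (M := C * K + δ * C) (by simp) hm.aestronglyMeasurable
    ((ae_restrict_iff' measurableSet_Ioc).2 (ae_of_all _ fun r hr => ?_))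
  obtain ⟨hCv, hCd⟩ := hC (y r) (hpos r hr)
  have e2 : Real.exp (-δ * r) ≤ 1 := Real.exp_le_one_iff.2 (by nlinarith [hr.1])
  have g1 : |Real.exp (-δ * r) * dv (y r) * p r| ≤ C * K := by
    rw [abs_mul, abs_mul, abs_of_pos (Real.exp_pos _)]
    have := hD.bound r
    calc _ ≤ 1 * C * K := by gcongr
      _ = C * K := by ring
  have g2 : |δ * Real.exp (-δ * r) * v (y r)| ≤ δ * C := by
    rw [abs_mul, abs_mul, abs_of_pos (Real.exp_pos _), abs_of_pos hδ]
    calc _ ≤ δ * 1 * C := by gcongr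
      _ = δ * C := by ring
  exact (abs_sub _ _).trans (add_le_add g1 g2)

/-- Change of variables inequality along a surplus path with finitely many claims. -/
theorem jumpPath_chain (hD : PathData D μ p K) {v dv : ℝ → ℝ} (hv : SlopeFunction v dv)
    {δ : ℝ} (hδ : 0 < δ) {ι : Type*} {z : ℝ} (E : Finset ι) (T c : ι → ℝ) :
    ∀ b : ℝ, 0 ≤ b → (∀ e ∈ E, 0 ≤ c e) → Set.InjOn T E → (∀ e ∈ E, 0 < T e ∧ T e < b) →
    (∀ s ∈ Set.Icc 0 b, 0 ≤ jumpPath D p z E T c s) →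
    (∀ e ∈ E, 0 ≤ jumpPath D p z E T c (T e) - c e) →
    (∫ r in Set.Ico 0 b, Real.exp (-δ * r) ∂μ) + Real.exp (-δ * b) * v (jumpPath D p z E T c b) ≤
      v z + (∫ r in (0 : ℝ)..b, drift δ v dv p (jumpPath D p z E T c) r) +
      ∑ e ∈ E, Real.exp (-δ * T e) *
        (v (jumpPath D p z E T c (T e) - c e) - v (jumpPath D p z E T c (T e))) := by
  classical
  -- Remove the last claim: the induction hypothesis applies up to its time, which is why the
  -- horizon is quantified inside, and the claim-free inequality applies afterwards.
  induction E using Finset.induction_on_max_value T with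
  | empty =>
    intro b hb _ _ _ hpos _
    have := hD.path_le hv hδ le_rfl hb (z := z) (y := jumpPath D p z ∅ T c)
      (fun s => by simp [jumpPath]) hpos
    simpa [drift] using this
  | insert e₀ E he₀ hmax ih =>
    intro b hb hc hinj hT hpos hpost
    set Y := jumpPath D p z (insert e₀ E) T c with hY
    set Y' := jumpPath D p z E T c with hY'
    obtain ⟨hT0, hTb⟩ := hT e₀ (Finset.mem_insert_self _ _)
    have hlt : ∀ e ∈ E, T e < T e₀ := by
      intro e he
      refine lt_of_le_of_ne (hmax e he) fun h => ?_
      have := hinj (Finset.mem_coe.2 (Finset.mem_insert_of_mem he))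
        (Finset.mem_coe.2 (Finset.mem_insert_self e₀ E)) h
      exact he₀ (this ▸ he)
    have hYY' : ∀ s ≤ T e₀, Y s = Y' s := by
      intro s hs
      simp only [hY, hY', jumpPath, Finset.sum_insert he₀, if_neg (not_lt.2 hs), zero_add]
    have h1 := ih (T e₀) hT0.le (fun e he => hc e (Finset.mem_insert_of_mem he))
      (hinj.mono (by simp)) (fun e he => ⟨(hT e (Finset.mem_insert_of_mem he)).1, hlt e he⟩)
      (fun s hs => by
        rw [← hYY' s hs.2]; exact hpos s ⟨hs.1, hs.2.trans hTb.le⟩)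
      (fun e he => by
        rw [← hYY' _ (hlt e he).le]
        exact hpost e (Finset.mem_insert_of_mem he))
    -- the path after the last claim
    set z' := Y (T e₀) - c e₀ with hz'
    let y : ℝ → ℝ := fun s => z' + (∫ r in (T e₀)..s, p r) - (D s - D (T e₀))
    have hyY : ∀ s, T e₀ < s → y s = Y s := by
      intro s hs
      have hadd : (∫ r in (0 : ℝ)..(T e₀), p r) + (∫ r in (T e₀)..s, p r) =
          ∫ r in (0 : ℝ)..s, p r :=
        intervalIntegral.integral_add_adjacent_intervals (hD.intervalIntegrable _ _)
          (hD.intervalIntegrable _ _)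
      have hs1 : ∑ e ∈ E, (if T e < s then c e else 0) = ∑ e ∈ E, c e :=
        Finset.sum_congr rfl fun e he => if_pos ((hlt e he).trans hs)
      have hs2 : ∑ e ∈ E, (if T e < T e₀ then c e else 0) = ∑ e ∈ E, c e :=
        Finset.sum_congr rfl fun e he => if_pos (hlt e he)
      simp only [y, hz', hY, jumpPath, Finset.sum_insert he₀, if_pos hs, lt_irrefl, if_false,
        ← hadd, hs1, hs2]
      ring
    have h2 := hD.path_le hv hδ hT0.le hTb.le (z := z') (y := y) (fun s => rfl) (fun s hs => by
      rcases hs.1.eq_or_lt with h | h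
      · have : y s = z' := by simp [y, h]
        rw [this]; exact hpost e₀ (Finset.mem_insert_self _ _)
      · rw [hyY s h]; exact hpos s ⟨hT0.le.trans hs.1, hs.2⟩)
    rw [hyY b hTb] at h2
    have h3 : (∫ r in (T e₀)..b, (Real.exp (-δ * r) * dv (y r) * p r
        - δ * Real.exp (-δ * r) * v (y r))) = ∫ r in (T e₀)..b, drift δ v dv p Y r := by
      refine intervalIntegral.integral_congr_ae (ae_of_all _ fun r hr => ?_)
      rw [Set.uIoc_of_le hTb.le] at hr
      simp only [drift, hyY r hr.1]
    have h4 : (∫ r in (0 : ℝ)..(T e₀), drift δ v dv p Y' r) =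
        ∫ r in (0 : ℝ)..(T e₀), drift δ v dv p Y r := by
      refine intervalIntegral.integral_congr_ae (ae_of_all _ fun r hr => ?_)
      rw [Set.uIoc_of_le hT0.le] at hr
      simp only [drift, hYY' r hr.2]
    have hint : IntervalIntegrable (drift δ v dv p Y) volume 0 b := by
      refine hD.intervalIntegrable_drift hv hδ hb (B := z + K * b) (hD.measurable_jumpPath _ _ _ _)
        fun s hs => ⟨hpos s ⟨hs.1.le, hs.2⟩, ?_⟩
      refine (hD.jumpPath_le _ _ _ _ hc hs.1.le).trans ?_
      have := mul_le_mul_of_nonneg_left hs.2 hD.K_nonneg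
      linarith
    have h5 : (∫ r in (0 : ℝ)..(T e₀), drift δ v dv p Y r) +
        (∫ r in (T e₀)..b, drift δ v dv p Y r) = ∫ r in (0 : ℝ)..b, drift δ v dv p Y r := by
      refine intervalIntegral.integral_add_adjacent_intervals (hint.mono_set ?_) (hint.mono_set ?_)
      · rw [Set.uIcc_of_le hT0.le, Set.uIcc_of_le hb]
        exact Set.Icc_subset_Icc_right hTb.le
      · rw [Set.uIcc_of_le hTb.le, Set.uIcc_of_le hb]
        exact Set.Icc_subset_Icc_left hT0.le
    have h6 : (∫ r in Set.Ico 0 b, Real.exp (-δ * r) ∂μ) =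
        (∫ r in Set.Ico 0 (T e₀), Real.exp (-δ * r) ∂μ) +
          ∫ r in Set.Ico (T e₀) b, Real.exp (-δ * r) ∂μ := by
      rw [← Set.Ico_union_Ico_eq_Ico hT0.le hTb.le]
      refine setIntegral_union ?_ measurableSet_Ico hD.integrableOn_exp hD.integrableOn_exp
      exact Set.disjoint_left.2 fun x hx hx' => absurd hx.2 (not_lt.2 hx'.1)
    have h7 : ∑ e ∈ E, Real.exp (-δ * T e) * (v (Y' (T e) - c e) - v (Y' (T e))) =
        ∑ e ∈ E, Real.exp (-δ * T e) * (v (Y (T e) - c e) - v (Y (T e))) :=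
      Finset.sum_congr rfl fun e he => by rw [hYY' _ (hlt e he).le]
    rw [Finset.sum_insert he₀, h6, ← h5]
    rw [h3] at h2
    rw [h4, h7, ← hYY' _ le_rfl] at h1
    have h8 : Real.exp (-δ * T e₀) * v z' = Real.exp (-δ * T e₀) * (v z' - v (Y (T e₀))) +
      Real.exp (-δ * T e₀) * v (Y (T e₀)) := by ring
    linarith

end PathData

/-! ### Event counts, and predictability as invariance under later changes -/

section EventCount

variable {m n : ℕ}

/-- Event times are monotone in the index, so the events up to t form an initial segment. All later
reasoning about counts goes through this equivalence instead of cardinalities. -/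
theorem lt_eventCount_iff {k : Fin m} {i : ℕ} {t : ℝ≥0} {ω : Scenario m n} :
    i < eventCount k t ω ↔
      (∀ s : ℝ≥0, {i : ℕ | eventTime k i ω ≤ s}.Finite) ∧ eventTime k i ω ≤ t := by
  by_cases hfin : ∀ s : ℝ≥0, {i : ℕ | eventTime k i ω ≤ s}.Finite
  · rw [eventCount, if_pos hfin]
    simp only [hfin, implies_true, true_and]
    constructor
    · intro h
      by_contra hcon
      have hsub : {l : ℕ | eventTime k l ω ≤ t} ⊆ Set.Iio i := fun l hl => by
        by_contra hli
        exact hcon ((eventTime_mono k ω (not_lt.1 hli)).trans hl)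
      have := Set.ncard_le_ncard hsub (Set.finite_Iio i)
      simp at this
      omega
    · intro h
      have hsub : Set.Iic i ⊆ {l : ℕ | eventTime k l ω ≤ t} := fun l hl =>
        (eventTime_mono k ω hl).trans h
      have := Set.ncard_le_ncard hsub (hfin t)
      simp at this
      omega
  · rw [eventCount, if_neg hfin]
    simp [hfin]

/-- Replacing one mark can advance later events by at most the old waiting time. Hence explosion is
not affected by a change of one mark. -/
theorem eventTime_le_update_add (k : Fin m) (i l : ℕ) (ω : Scenario m n) (a : Mark n) :
    eventTime k l ω ≤ eventTime k l (Function.update ω (k, i) a) + (ω (k, i)).1 := by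
  have h1 : ∀ l', (ω (k, l')).1 ≤ (Function.update ω (k, i) a (k, l')).1 +
      (if l' = i then (ω (k, i)).1 else 0) := by
    intro l'
    by_cases h : l' = i
    · subst h; simp
    · rw [Function.update_of_ne (by simpa using h)]; simp
  calc eventTime k l ω ≤ ∑ l' ∈ Finset.range (l + 1), ((Function.update ω (k, i) a (k, l')).1 +
      (if l' = i then (ω (k, i)).1 else 0)) := Finset.sum_le_sum fun l' _ => h1 l'
    _ ≤ _ := by
        rw [Finset.sum_add_distrib, Finset.sum_ite_eq']
        refine add_le_add le_rfl ?_
        split_ifs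
        exacts [le_rfl, zero_le]

theorem finite_events_update {k k' : Fin m} {i : ℕ} {ω : Scenario m n} (a : Mark n)
    (h : ∀ s : ℝ≥0, {l : ℕ | eventTime k' l ω ≤ s}.Finite) (s : ℝ≥0) :
    {l : ℕ | eventTime k' l (Function.update ω (k, i) a) ≤ s}.Finite := by
  by_cases hk : k' = k
  · subst hk
    refine (h (s + (ω (k', i)).1)).subset fun l hl => ?_
    exact (eventTime_le_update_add k' i l ω a).trans (add_le_add hl le_rfl)
  · simpa only [eventTime_update_of_ne hk] using h s

theorem finite_events_update_iff {k k' : Fin m} {i : ℕ} {ω : Scenario m n} (a : Mark n) :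
    (∀ s : ℝ≥0, {l : ℕ | eventTime k' l (Function.update ω (k, i) a) ≤ s}.Finite) ↔
      ∀ s : ℝ≥0, {l : ℕ | eventTime k' l ω ≤ s}.Finite := by
  refine ⟨fun h s => ?_, finite_events_update a⟩
  have := finite_events_update (k := k) (i := i) (ω (k, i)) h s
  rwa [Function.update_idem, Function.update_eq_self] at this

/-- Changing an event at or after time `s` does not change the other events before `s`. -/
theorem eventTime_lt_update_iff {k : Fin m} {i : ℕ} {s : ℝ≥0} {ω : Scenario m n} {a : Mark n}
    (h₁ : s ≤ eventTime k i ω) (h₂ : s ≤ eventTime k i (Function.update ω (k, i) a))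
    (e : Fin m × ℕ) :
    eventTime e.1 e.2 (Function.update ω (k, i) a) < s ↔ eventTime e.1 e.2 ω < s := by
  obtain ⟨k', l⟩ := e
  by_cases hk : k' = k
  · subst hk
    rcases lt_or_ge l i with h | h
    · simp only [eventTime_update_of_lt k' h]
    · constructor <;> intro h'
      · exact absurd h' (not_lt.2 (h₂.trans (eventTime_mono k' _ h)))
      · exact absurd h' (not_lt.2 (h₁.trans (eventTime_mono k' _ h)))
  · simp only [eventTime_update_of_ne hk]

theorem eq_of_eventTime_lt {k : Fin m} {i : ℕ} {s : ℝ≥0} {ω : Scenario m n} {a : Mark n}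
    (h₁ : s ≤ eventTime k i ω) {e : Fin m × ℕ} (he : eventTime e.1 e.2 ω < s) :
    Function.update ω (k, i) a e = ω e ∧
      eventTime e.1 e.2 (Function.update ω (k, i) a) = eventTime e.1 e.2 ω := by
  obtain ⟨k', l⟩ := e
  by_cases hk : k' = k
  · subst hk
    have h : l < i := by
      by_contra hcon
      exact absurd he (not_lt.2 (h₁.trans (eventTime_mono k' _ (not_lt.1 hcon))))
    refine ⟨?_, eventTime_update_of_lt k' h _ _⟩
    rw [Function.update_of_ne]
    simp only [ne_eq, Prod.mk.injEq, true_and]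
    exact h.ne
  · refine ⟨?_, eventTime_update_of_ne hk _ _ _ _⟩
    rw [Function.update_of_ne]
    simp [hk]

theorem eventCount_update {k : Fin m} {i : ℕ} {s : ℝ≥0} {ω : Scenario m n} {a : Mark n}
    (h₁ : s ≤ eventTime k i ω) (h₂ : s ≤ eventTime k i (Function.update ω (k, i) a))
    {r : ℝ≥0} (hr : r < s) (k' : Fin m) :
    eventCount k' r (Function.update ω (k, i) a) = eventCount k' r ω := by
  refine eq_of_forall_lt_iff fun l => ?_
  rw [lt_eventCount_iff, lt_eventCount_iff, finite_events_update_iff]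
  refine and_congr_right fun _ => ?_
  constructor <;> intro h
  · have := (eventTime_lt_update_iff h₁ h₂ (k', l)).1 (h.trans_lt hr)
    rwa [← (eq_of_eventTime_lt (a := a) h₁ this).2]
  · have := h.trans_lt hr
    rwa [(eq_of_eventTime_lt (a := a) h₁ (e := (k', l)) this).2]

theorem update_eq_of_lt_eventCount {k : Fin m} {i : ℕ} {s : ℝ≥0} {ω : Scenario m n} {a : Mark n}
    (h₁ : s ≤ eventTime k i ω) {r : ℝ≥0} (hr : r < s) {k' : Fin m} {l : ℕ}
    (hl : l < eventCount k' r ω) : Function.update ω (k, i) a (k', l) = ω (k', l) ∧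
      eventTime k' l (Function.update ω (k, i) a) = eventTime k' l ω :=
  eq_of_eventTime_lt h₁ (e := (k', l)) ((lt_eventCount_iff.1 hl).2.trans_lt hr)

theorem lineClaims_update {k : Fin m} {i : ℕ} {s : ℝ≥0} {ω : Scenario m n} {a : Mark n}
    (h₁ : s ≤ eventTime k i ω) (h₂ : s ≤ eventTime k i (Function.update ω (k, i) a))
    {r : ℝ≥0} (hr : r < s) (j : Fin n) :
    lineClaims j r (Function.update ω (k, i) a) = lineClaims j r ω := by
  unfold lineClaims
  refine Finset.sum_congr rfl fun k' _ => ?_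
  rw [eventCount_update h₁ h₂ hr]
  refine Finset.sum_congr rfl fun l hl => ?_
  rw [(update_eq_of_lt_eventCount h₁ hr (Finset.mem_range.1 hl)).1]

/-- A function of the strict past at time `t` takes the same value at scenarios with the same
claims before `t`. -/
theorem eq_of_measurable_strictPast {α : Type*} [MeasurableSpace α] [MeasurableSingletonClass α]
    {t : ℝ≥0} {f : Scenario m n → α} (hf : Measurable[strictPast m n t] f) {ω ω' : Scenario m n}
    (h : ∀ j, ∀ s < t, lineClaims j s ω = lineClaims j s ω') : f ω = f ω' := by
  -- The σ-algebra of sets that do not separate ω from ω' contains every generator of the strict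
  -- past.
  let 𝒢 : MeasurableSpace (Scenario m n) :=
    { MeasurableSet' := fun S => ω ∈ S ↔ ω' ∈ S
      measurableSet_empty := by simp
      measurableSet_compl := fun S hS => by simpa using not_congr hS
      measurableSet_iUnion := fun S hS => by
        simp only [Set.mem_iUnion]
        exact exists_congr hS }
  have hle : strictPast m n t ≤ 𝒢 := by
    refine iSup_le fun j => iSup_le fun s => iSup_le fun hs => ?_
    rintro S ⟨B, -, rfl⟩
    change lineClaims j s ω ∈ B ↔ lineClaims j s ω' ∈ B
    rw [h j s hs]
  have := hle _ (hf (measurableSet_singleton (f ω)))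
  exact ((show ω ∈ f ⁻¹' {f ω} ↔ ω' ∈ f ⁻¹' {f ω} from this).1 rfl).symm

/-- The claims before s do not change when an event at or after s is moved within [s, ∞). As the
filtration is not completed, this turns measurability into a pointwise invariance valid in every
scenario. -/
theorem eventPredictable_of_past {α : Type*} [MeasurableSpace α] [MeasurableSingletonClass α]
    {H : ℝ≥0 → Scenario m n → α} (hH : ∀ t, Measurable[strictPast m n t] (H t)) :
    EventPredictable H := fun _ _ s _ _ h₁ h₂ =>
  eq_of_measurable_strictPast (hH s) fun j _ hr => lineClaims_update h₁ h₂ hr j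

@[fun_prop]
theorem measurable_eventCount (k : Fin m) :
    Measurable fun q : ℝ≥0 × Scenario m n => eventCount k q.1 q.2 := by
  refine measurable_of_Ioi fun i => ?_
  -- Non-explosion is a countable condition: for every N some event of the class is later than N.
  have : (fun q : ℝ≥0 × Scenario m n => eventCount k q.1 q.2) ⁻¹' Set.Ioi i =
      (⋂ N : ℕ, ⋃ l : ℕ, {q | (N : ℝ≥0) < eventTime k l q.2}) ∩ {q | eventTime k i q.2 ≤ q.1} := by
    ext q
    simp only [Set.mem_preimage, Set.mem_Ioi, Set.mem_inter_iff, Set.mem_iInter, Set.mem_iUnion,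
      Set.mem_ofPred_eq, lt_eventCount_iff]
    refine and_congr_left fun _ => ⟨fun h N => ?_, fun h s => ?_⟩
    · by_contra hcon
      push Not at hcon
      exact Set.infinite_univ ((h N).subset fun l _ => hcon l)
    · obtain ⟨N, hN⟩ := exists_nat_ge s
      obtain ⟨l, hl⟩ := h N
      refine (Set.finite_Iio l).subset fun l' hl' => ?_
      by_contra hcon
      exact absurd ((eventTime_mono k q.2 (not_lt.1 hcon)).trans (hl'.trans hN)) (not_le.2 hl)
  rw [this]
  refine MeasurableSet.inter ?_ (measurableSet_le (by fun_prop) (by fun_prop))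
  refine MeasurableSet.iInter fun N => MeasurableSet.iUnion fun l => ?_
  exact measurableSet_lt measurable_const (by fun_prop)

theorem measurable_eventCount_right (k : Fin m) (t : ℝ≥0) :
    Measurable (eventCount k t : Scenario m n → ℕ) :=
  (measurable_eventCount k).comp (f := fun ω : Scenario m n => (t, ω)) (by fun_prop)

/-- Random sums of measurable functions are measurable. -/
theorem measurable_sum_range {α β : Type*} [MeasurableSpace α] [MeasurableSpace β]
    [AddCommMonoid β] [MeasurableAdd₂ β] {N : α → ℕ} (hN : Measurable N) {f : ℕ → α → β}
    (hf : ∀ i, Measurable (f i)) : Measurable fun a => ∑ i ∈ Finset.range (N a), f i a := by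
  have h : Measurable fun q : ℕ × α => ∑ i ∈ Finset.range q.1, f i q.2 :=
    measurable_from_prod_countable_right fun N => by
      change Measurable fun a => ∑ i ∈ Finset.range N, f i a
      exact Finset.measurable_sum _ fun i _ => hf i
  exact h.comp (hN.prodMk measurable_id)

/-- The events up to time `t`. -/
def eventsUpTo {ω : Scenario m n} (hω : NonExplosive ω) (t : ℝ≥0) : Finset (Fin m × ℕ) :=
  Finset.univ.biUnion fun k => ((hω k t).toFinset.map ⟨fun i => (k, i), fun _ _ h => by
    simpa using h⟩)

theorem mem_eventsUpTo {ω : Scenario m n} (hω : NonExplosive ω) {t : ℝ≥0} {e : Fin m × ℕ} :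
    e ∈ eventsUpTo hω t ↔ eventTime e.1 e.2 ω ≤ t := by
  obtain ⟨k, i⟩ := e
  simp only [eventsUpTo, Finset.mem_biUnion, Finset.mem_univ, true_and, Finset.mem_map,
    Set.Finite.mem_toFinset, Set.mem_ofPred_eq]
  constructor
  · rintro ⟨k', i', h, he⟩
    obtain ⟨rfl, rfl⟩ := Prod.mk.inj he
    exact h
  · intro h; exact ⟨k, i, h, rfl⟩

theorem sum_eventCount {β : Type*} [AddCommMonoid β] {ω : Scenario m n} (hω : NonExplosive ω)
    (t : ℝ≥0) (f : Fin m × ℕ → β) :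
    ∑ k, ∑ i ∈ Finset.range (eventCount k t ω), f (k, i) = ∑ e ∈ eventsUpTo hω t, f e := by
  rw [Finset.sum_finset_product (eventsUpTo hω t) Finset.univ
    fun k => Finset.range (eventCount k t ω)]
  intro e
  rw [mem_eventsUpTo, Finset.mem_range, lt_eventCount_iff]
  simp [hω e.1]

end EventCount

theorem eventCount_mono {m n : ℕ} (k : Fin m) (ω : Scenario m n) :
    Monotone fun t => eventCount k t ω := fun s t h => by
  refine le_of_forall_lt fun i hi => ?_
  have := lt_eventCount_iff.1 hi
  exact lt_eventCount_iff.2 ⟨this.1, this.2.trans h⟩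

/-! ### The surplus of a strategy: measurability, predictability, ruin -/

namespace RiskModel

variable {m n : ℕ} (M : RiskModel m n)

/-- Measurable dependence of the premium rate on the contract. -/
theorem measurable_netPremium {α : Type*} [MeasurableSpace α] {R : α → Fin n → ℝ≥0 → ℝ≥0}
    (hR : ∀ j, Measurable fun q : α × ℝ≥0 => R q.1 j q.2) :
    Measurable fun a => M.netPremium (R a) := by
  have h1 : ∀ a, M.netPremium (R a) = M.grossPremium - (1 + M.η₁) * M.totalRate *
      ((∫ a, (a : ℝ) ∂(M.claimLaw fun _ => id)) -
        (∑ k, ENNReal.ofReal (M.β k / M.totalRate) *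
          ∫⁻ y, (retained (R a) y : ℝ≥0∞) ∂(M.hitLaw k)).toReal) := by
    intro a
    have hRa : ∀ j, Measurable (R a j) := fun j => (hR j).comp measurable_prodMk_left
    rw [netPremium, reinsurancePremium, M.integral_claimLaw_eq (R a),
      M.lintegral_claimLaw hRa measurable_coe_nnreal_ennreal]
  simp_rw [h1]
  refine Measurable.const_sub (Measurable.const_mul (Measurable.const_sub ?_ _) _) _
  refine Measurable.ennreal_toReal (Finset.measurable_sum _ fun k _ => Measurable.const_mul ?_ _)
  refine Measurable.lintegral_prod_right' (f := fun q : α × ((Fin n → Bool) × (Fin n → ℝ≥0)) =>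
    (retained (R q.1) q.2 : ℝ≥0∞)) (Measurable.coe_nnreal_ennreal ?_)
  unfold retained
  refine Finset.measurable_sum _ fun j _ => Measurable.ite ?_ ?_ measurable_const
  · exact measurableSet_eq_fun (by fun_prop) measurable_const
  · exact (hR j).comp (f := fun q : α × ((Fin n → Bool) × (Fin n → ℝ≥0)) => (q.1, q.2.2 j))
      (by fun_prop)

namespace Strategy

variable {M} (π : M.Strategy)

/-- The contract in force at time `s`. -/
def contract (s : ℝ≥0) (ω : Scenario m n) : Fin n → ℝ≥0 → ℝ≥0 := fun j => π.R j s ω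

theorem isContract (s : ℝ≥0) (ω : Scenario m n) : M.IsContract (π.contract s ω) :=
  fun j => π.R_mem j s ω

/-- Premium rate at real time `s`. -/
def premiumRate (ω : Scenario m n) (s : ℝ) : ℝ := M.netPremium (π.contract s.toNNReal ω)

/-- Retained part of the claims of the event `e`. -/
def claimSize (e : Fin m × ℕ) (ω : Scenario m n) : ℝ≥0 :=
  retained (π.contract (eventTime e.1 e.2 ω) ω) (ω e).2

/-- Retained claims before time `s`. -/
def pastClaims (s : ℝ≥0) (ω : Scenario m n) : ℝ≥0∞ :=
  ∑' e : Fin m × ℕ, if eventTime e.1 e.2 ω < s then (π.claimSize e ω : ℝ≥0∞) else 0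

/-- The surplus at time `s`, before the claims occurring at this time. -/
def preSurplus (x s : ℝ≥0) (ω : Scenario m n) : ℝ :=
  x + (∫ r in (0 : ℝ)..s, π.premiumRate ω r) - (π.pastClaims s ω).toReal - π.D s ω

/-- There is no ruin before time `s` (formulated with rational times). -/
def Alive (x s : ℝ≥0) (ω : Scenario m n) : Prop :=
  ∀ q : ℚ, (q : ℝ).toNNReal < s → 0 ≤ π.surplus x (q : ℝ).toNNReal ω

theorem measurable_contract_retained :
    Measurable fun q : (ℝ≥0 × Scenario m n) × ((Fin n → Bool) × (Fin n → ℝ≥0)) =>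
      retained (π.contract q.1.1 q.1.2) q.2 := by
  unfold retained
  refine Finset.measurable_sum _ fun j _ => Measurable.ite ?_ ?_ measurable_const
  · exact measurableSet_eq_fun (by fun_prop) measurable_const
  · exact (π.R_measurable j).comp
      (f := fun q : (ℝ≥0 × Scenario m n) × ((Fin n → Bool) × (Fin n → ℝ≥0)) =>
        (q.1.1, q.1.2, q.2.2 j)) (by fun_prop)

theorem measurable_claimSize (e : Fin m × ℕ) : Measurable (π.claimSize e) :=
  π.measurable_contract_retained.comp
    (f := fun ω : Scenario m n => ((eventTime e.1 e.2 ω, ω), (ω e).2)) (by fun_prop)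

theorem measurable_premiumRate : Measurable fun q : ℝ × Scenario m n => π.premiumRate q.2 q.1 := by
  refine M.measurable_netPremium (R := fun q : ℝ × Scenario m n => π.contract q.1.toNNReal q.2)
    fun j => ?_
  exact (π.R_measurable j).comp
    (f := fun q : (ℝ × Scenario m n) × ℝ≥0 => (q.1.1.toNNReal, q.1.2, q.2)) (by fun_prop)

theorem measurable_pastClaims : Measurable fun q : ℝ≥0 × Scenario m n => π.pastClaims q.1 q.2 := by
  refine Measurable.tsum fun e => Measurable.ite (measurableSet_lt (by fun_prop) (by fun_prop)) ?_
    measurable_const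
  exact ((π.measurable_claimSize e).comp measurable_snd).coe_nnreal_ennreal

theorem strictPast_le (t : ℝ≥0) : strictPast m n t ≤ inferInstanceAs (MeasurableSpace (Scenario m n)) := by
  refine iSup_le fun j => iSup_le fun s => iSup_le fun _ => ?_
  rw [← measurable_iff_comap_le]
  unfold lineClaims
  refine Finset.measurable_sum _ fun k _ => ?_
  refine measurable_sum_range (measurable_eventCount_right k s) fun i => ?_
  refine Measurable.ite ?_ (by fun_prop) measurable_const
  exact measurableSet_eq_fun (by fun_prop) measurable_const

theorem measurable_D_right (t : ℝ≥0) : Measurable (π.D t) := (π.D_past t).mono (strictPast_le t) le_rfl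

/-- By monotonicity and left continuity, D exceeds c at time t exactly if it does so at some
rational time not later than t; this gives joint measurability in time and scenario. -/
theorem measurable_D : Measurable fun q : ℝ≥0 × Scenario m n => π.D q.1 q.2 := by
  refine measurable_of_Ioi fun c => ?_
  have : (fun q : ℝ≥0 × Scenario m n => π.D q.1 q.2) ⁻¹' Set.Ioi c =
      ⋃ r : ℚ, {q : ℝ≥0 × Scenario m n | (r : ℝ).toNNReal ≤ q.1 ∧ c < π.D (r : ℝ).toNNReal q.2} := by
    ext ⟨t, ω⟩
    simp only [Set.mem_preimage, Set.mem_Ioi, Set.mem_iUnion, Set.mem_ofPred_eq]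
    constructor
    · intro h
      rcases eq_or_ne t 0 with rfl | ht
      · rw [π.D_zero] at h
        exact absurd h (not_lt.2 zero_le)
      · have h1 : ∀ᶠ s in 𝓝[≤] t, c < π.D s ω := (π.D_leftCont ω t).eventually_const_lt h
        have h2 : ∀ᶠ s in 𝓝[<] t, c < π.D s ω :=
          h1.filter_mono (nhdsWithin_mono _ Set.Iio_subset_Iic_self)
        obtain ⟨l, hl, hsub⟩ := (mem_nhdsLT_iff_exists_Ioo_subset'
          (pos_iff_ne_zero.2 ht)).1 h2
        obtain ⟨r, hr0, hlr, hrt⟩ := (NNReal.lt_iff_exists_rat_btwn l t).1 hl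
        exact ⟨r, hrt.le, hsub ⟨hlr, hrt⟩⟩
    · rintro ⟨r, hr, hc⟩
      exact hc.trans_le (π.D_mono ω hr)
  rw [this]
  refine MeasurableSet.iUnion fun r => ?_
  have h1 : Measurable fun q : ℝ≥0 × Scenario m n => π.D (r : ℝ).toNNReal q.2 :=
    (π.measurable_D_right (r : ℝ).toNNReal).comp measurable_snd
  have h2 := measurableSet_lt (measurable_const (a := c)) h1
  exact MeasurableSet.inter (measurableSet_le (by fun_prop) (by fun_prop)) h2

theorem measurable_premiumIntegral :
    Measurable fun q : ℝ≥0 × Scenario m n => ∫ r in (0 : ℝ)..q.1, π.premiumRate q.2 r := by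
  have h1 : ∀ q : ℝ≥0 × Scenario m n, (∫ r in (0 : ℝ)..q.1, π.premiumRate q.2 r) =
      ∫ r : ℝ, if 0 < r ∧ r ≤ q.1 then π.premiumRate q.2 r else 0 := by
    intro q
    rw [intervalIntegral.integral_of_le (NNReal.coe_nonneg q.1), ← integral_indicator measurableSet_Ioc]
    simp only [Set.indicator, Set.mem_Ioc]
  simp_rw [h1]
  refine StronglyMeasurable.measurable (StronglyMeasurable.integral_prod_right'
    (f := fun q : (ℝ≥0 × Scenario m n) × ℝ =>
      if 0 < q.2 ∧ q.2 ≤ q.1.1 then π.premiumRate q.1.2 q.2 else 0) ?_)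
  refine Measurable.stronglyMeasurable (Measurable.ite ?_ ?_ measurable_const)
  · have h2 : MeasurableSet {q : (ℝ≥0 × Scenario m n) × ℝ | 0 < q.2} :=
      measurableSet_lt (by fun_prop) (by fun_prop)
    have h3 : MeasurableSet {q : (ℝ≥0 × Scenario m n) × ℝ | q.2 ≤ q.1.1} :=
      measurableSet_le (by fun_prop) (by fun_prop)
    exact h2.inter h3
  · exact π.measurable_premiumRate.comp
      (f := fun q : (ℝ≥0 × Scenario m n) × ℝ => (q.2, q.1.2)) (by fun_prop)

theorem measurable_preSurplus (x : ℝ≥0) :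
    Measurable fun q : ℝ≥0 × Scenario m n => π.preSurplus x q.1 q.2 :=
  (((measurable_const.add π.measurable_premiumIntegral).sub
    π.measurable_pastClaims.ennreal_toReal).sub π.measurable_D.coe_nnreal_real)

theorem surplus_eq (x t : ℝ≥0) (ω : Scenario m n) :
    π.surplus x t ω = x + (∫ r in (0 : ℝ)..t, π.premiumRate ω r) -
      (∑ k, ∑ i ∈ Finset.range (eventCount k t ω), (π.claimSize (k, i) ω : ℝ)) - π.D t ω := by
  have h : ∀ k i, (π.claimSize (k, i) ω : ℝ) = ∑ j : Fin n, if (ω (k, i)).2.1 j = true then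
      (π.R j (eventTime k i ω) ω ((ω (k, i)).2.2 j) : ℝ) else 0 := by
    intro k i
    unfold claimSize retained contract
    push_cast
    refine Finset.sum_congr rfl fun j _ => ?_
    split_ifs <;> simp
  simp only [h]
  rfl

theorem measurable_surplus (x t : ℝ≥0) : Measurable (π.surplus x t) := by
  simp_rw [funext (π.surplus_eq x t)]
  refine Measurable.sub (Measurable.sub (Measurable.const_add ?_ _) ?_) ?_
  · exact π.measurable_premiumIntegral.comp (f := fun ω : Scenario m n => (t, ω)) (by fun_prop)
  · refine Finset.measurable_sum _ fun k _ => ?_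
    exact measurable_sum_range (β := ℝ) (measurable_eventCount_right k t)
      (f := fun i ω => (π.claimSize (k, i) ω : ℝ))
      fun i => (π.measurable_claimSize (k, i)).coe_nnreal_real
  · exact (π.measurable_D_right t).coe_nnreal_real

theorem measurableSet_alive (x : ℝ≥0) :
    MeasurableSet {q : ℝ≥0 × Scenario m n | π.Alive x q.1 q.2} := by
  have : {q : ℝ≥0 × Scenario m n | π.Alive x q.1 q.2} = ⋂ r : ℚ,
      ({q | (r : ℝ).toNNReal < q.1}ᶜ ∪ {q | 0 ≤ π.surplus x (r : ℝ).toNNReal q.2}) := by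
    ext q
    simp only [Alive, Set.mem_ofPred_eq, Set.mem_iInter, Set.mem_union, Set.mem_compl_iff]
    exact forall_congr' fun r => imp_iff_not_or
  rw [this]
  refine MeasurableSet.iInter fun r => MeasurableSet.union ?_ ?_
  · exact (measurableSet_lt (by fun_prop) (by fun_prop)).compl
  · exact measurableSet_le measurable_const ((π.measurable_surplus _ _).comp measurable_snd)

/-! Predictability -/

theorem contract_update {k : Fin m} {i : ℕ} {s : ℝ≥0} {ω : Scenario m n} {a : Mark n}
    (h₁ : s ≤ eventTime k i ω) (h₂ : s ≤ eventTime k i (Function.update ω (k, i) a))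
    {r : ℝ≥0} (hr : r ≤ s) : π.contract r (Function.update ω (k, i) a) = π.contract r ω := by
  funext j b
  exact eventPredictable_of_past (H := fun r ω => π.R j r ω b) (fun t => π.R_past j t b) k i r ω a
    (hr.trans h₁) (hr.trans h₂)

theorem claimSize_update {k : Fin m} {i : ℕ} {s : ℝ≥0} {ω : Scenario m n} {a : Mark n}
    (h₁ : s ≤ eventTime k i ω) (h₂ : s ≤ eventTime k i (Function.update ω (k, i) a))
    {e : Fin m × ℕ} (he : eventTime e.1 e.2 ω < s) :
    π.claimSize e (Function.update ω (k, i) a) = π.claimSize e ω := by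
  obtain ⟨h3, h4⟩ := eq_of_eventTime_lt (a := a) h₁ he
  rw [claimSize, h3, h4, π.contract_update h₁ h₂ he.le, ← claimSize]

theorem premiumIntegral_update {k : Fin m} {i : ℕ} {s : ℝ≥0} {ω : Scenario m n} {a : Mark n}
    (h₁ : s ≤ eventTime k i ω) (h₂ : s ≤ eventTime k i (Function.update ω (k, i) a))
    {r : ℝ≥0} (hr : r ≤ s) :
    (∫ t in (0 : ℝ)..r, π.premiumRate (Function.update ω (k, i) a) t) =
      ∫ t in (0 : ℝ)..r, π.premiumRate ω t := by
  refine intervalIntegral.integral_congr_ae (ae_of_all _ fun t ht => ?_)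
  rw [Set.uIoc_of_le (NNReal.coe_nonneg r)] at ht
  rw [premiumRate, π.contract_update h₁ h₂ ((Real.toNNReal_le_iff_le_coe.2 ht.2).trans hr),
    ← premiumRate]

theorem D_update {k : Fin m} {i : ℕ} {s : ℝ≥0} {ω : Scenario m n} {a : Mark n}
    (h₁ : s ≤ eventTime k i ω) (h₂ : s ≤ eventTime k i (Function.update ω (k, i) a))
    {r : ℝ≥0} (hr : r ≤ s) : π.D r (Function.update ω (k, i) a) = π.D r ω :=
  eventPredictable_of_past (H := π.D) π.D_past k i r ω a (hr.trans h₁) (hr.trans h₂)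

/-- Together with `alive_update` this makes the integrands of the verification argument admissible
in the compensation formula. -/
theorem eventPredictable_preSurplus (x : ℝ≥0) : EventPredictable fun s ω => π.preSurplus x s ω := by
  intro k i s ω a h₁ h₂
  have h3 : π.pastClaims s (Function.update ω (k, i) a) = π.pastClaims s ω := by
    refine tsum_congr fun e => ?_
    simp only [eventTime_lt_update_iff h₁ h₂ e]
    split_ifs with h
    · rw [π.claimSize_update h₁ h₂ h]
    · rfl
  simp only [preSurplus]
  rw [π.premiumIntegral_update h₁ h₂ le_rfl, h3, π.D_update h₁ h₂ le_rfl]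

theorem surplus_update (x : ℝ≥0) {k : Fin m} {i : ℕ} {s : ℝ≥0} {ω : Scenario m n} {a : Mark n}
    (h₁ : s ≤ eventTime k i ω) (h₂ : s ≤ eventTime k i (Function.update ω (k, i) a))
    {r : ℝ≥0} (hr : r < s) :
    π.surplus x r (Function.update ω (k, i) a) = π.surplus x r ω := by
  rw [surplus_eq, surplus_eq, π.premiumIntegral_update h₁ h₂ hr.le, π.D_update h₁ h₂ hr.le]
  congr 2
  refine Finset.sum_congr rfl fun k' _ => ?_
  rw [eventCount_update h₁ h₂ hr]
  refine Finset.sum_congr rfl fun l hl => ?_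
  rw [π.claimSize_update h₁ h₂ (e := (k', l))
    ((lt_eventCount_iff.1 (Finset.mem_range.1 hl)).2.trans_lt hr)]

theorem alive_update (x : ℝ≥0) {k : Fin m} {i : ℕ} {s : ℝ≥0} {ω : Scenario m n} {a : Mark n}
    (h₁ : s ≤ eventTime k i ω) (h₂ : s ≤ eventTime k i (Function.update ω (k, i) a)) :
    π.Alive x s (Function.update ω (k, i) a) ↔ π.Alive x s ω := by
  unfold Alive
  refine forall_congr' fun q => forall_congr' fun hq => ?_
  rw [π.surplus_update x h₁ h₂ hq]

/-! Paths -/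

theorem pathData (hm : 1 ≤ m) (ω : Scenario m n) :
    PathData (fun t : ℝ => (π.D t.toNNReal ω : ℝ)) (π.dividendMeasure ω) (π.premiumRate ω)
      M.premiumBound := by
  have hleft : ∀ t : ℝ, ContinuousWithinAt (fun t : ℝ => (π.D t.toNNReal ω : ℝ)) (Set.Iic t) t := by
    intro t
    have h1 : ContinuousWithinAt (fun t : ℝ => π.D t.toNNReal ω) (Set.Iic t) t :=
      (π.D_leftCont ω t.toNNReal).comp (continuous_real_toNNReal.continuousWithinAt)
        fun s hs => Real.toNNReal_le_toNNReal hs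
    exact NNReal.continuous_coe.continuousAt.comp_continuousWithinAt h1
  refine ⟨π.monotone_extend ω, hleft, fun s t _ => ?_, ?_, fun s => ?_⟩
  · have hl : ∀ t, Function.leftLim (π.monotone_extend ω).stieltjesFunction t =
        (π.D t.toNNReal ω : ℝ) := by
      intro t
      have h2 : ((π.monotone_extend ω).stieltjesFunction : ℝ → ℝ) =
        Function.rightLim fun t : ℝ => (π.D t.toNNReal ω : ℝ) := rfl
      rw [h2, leftLim_rightLim ((π.monotone_extend ω).tendsto_leftLim t)]
      exact (hleft t).leftLim_eq
    rw [dividendMeasure, StieltjesFunction.measure_Ico, hl, hl]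
  · exact π.measurable_premiumRate.comp (f := fun s : ℝ => (s, ω)) (by fun_prop)
  · exact M.abs_netPremium_le hm (π.isContract _ _)

/-- The surplus rises at most at a bounded rate and otherwise only drops, so once negative it stays
negative for a short while. Rational times therefore detect ruin. -/
theorem alive_iff (hm : 1 ≤ m) (x s : ℝ≥0) (ω : Scenario m n) :
    π.Alive x s ω ↔ ∀ t < s, 0 ≤ π.surplus x t ω := by
  refine ⟨fun h t ht => ?_, fun h q hq => h _ hq⟩
  by_contra hcon
  push Not at hcon
  set K := M.premiumBound
  have hK : 0 ≤ K := M.premiumBound_nonneg hm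
  -- Premiums collected during ε amount to at most K ε, which is less than the deficit. The summand
  -- 1 covers K = 0.
  set ε : ℝ≥0 := (-π.surplus x t ω / (K + 1)).toNNReal with hε
  have hεpos : 0 < ε := Real.toNNReal_pos.2 (div_pos (neg_pos.2 hcon) (by linarith))
  obtain ⟨q, hq0, htq, hqs⟩ := (NNReal.lt_iff_exists_rat_btwn t (min s (t + ε))).1
    (lt_min ht (lt_add_of_pos_right _ hεpos))
  set r : ℝ≥0 := (q : ℝ).toNNReal
  have h0 := h q (hqs.trans_le (min_le_left _ _))
  have hr : (r : ℝ) - t < ε := by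
    have h1 := hqs.trans_le (min_le_right _ _)
    have h2 : (r : ℝ) < t + ε := by exact_mod_cast h1
    linarith
  have htr : (t : ℝ) ≤ r := by exact_mod_cast htq.le
  have hP := π.pathData hm ω
  have hint : (∫ u in (0 : ℝ)..t, π.premiumRate ω u) + (∫ u in (t : ℝ)..r, π.premiumRate ω u) =
      ∫ u in (0 : ℝ)..r, π.premiumRate ω u :=
    intervalIntegral.integral_add_adjacent_intervals (hP.intervalIntegrable _ _)
      (hP.intervalIntegrable _ _)
  have hle := (le_abs_self _).trans (hP.abs_integral_le htr)
  have hD : (π.D t ω : ℝ) ≤ π.D r ω := NNReal.coe_le_coe.2 (π.D_mono ω htq.le)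
  have hc : ∑ k, ∑ i ∈ Finset.range (eventCount k t ω), (π.claimSize (k, i) ω : ℝ) ≤
      ∑ k, ∑ i ∈ Finset.range (eventCount k r ω), (π.claimSize (k, i) ω : ℝ) := by
    refine Finset.sum_le_sum fun k _ => Finset.sum_le_sum_of_subset_of_nonneg
      (Finset.range_mono (eventCount_mono k ω htq.le)) fun i _ _ => NNReal.coe_nonneg _
  have hXr : π.surplus x r ω ≤ π.surplus x t ω + K * (r - t) := by
    rw [surplus_eq, surplus_eq, ← hint]; linarith
  have hεv : (ε : ℝ) = -π.surplus x t ω / (K + 1) :=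
    Real.coe_toNNReal _ (div_nonneg (neg_pos.2 hcon).le (by linarith))
  have h3 : (K + 1) * ε = -π.surplus x t ω := by rw [hεv]; field_simp
  have h4 : K * (r - t) ≤ K * ε := mul_le_mul_of_nonneg_left hr.le hK
  have h5 : (0 : ℝ) < ε := by exact_mod_cast hεpos
  nlinarith

theorem pastClaims_eq {ω : Scenario m n} (hω : NonExplosive ω) {s t : ℝ≥0} (hst : s ≤ t) :
    (π.pastClaims s ω).toReal =
      ∑ e ∈ eventsUpTo hω t, if eventTime e.1 e.2 ω < s then (π.claimSize e ω : ℝ) else 0 := by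
  rw [pastClaims, tsum_eq_sum (s := eventsUpTo hω t), ENNReal.toReal_sum]
  · refine Finset.sum_congr rfl fun e _ => ?_
    split_ifs <;> simp
  · intro e _
    split_ifs <;> simp
  · intro e he
    rw [if_neg]
    intro h
    exact he ((mem_eventsUpTo hω).2 (h.le.trans hst))

theorem surplus_eq_sum {ω : Scenario m n} (hω : NonExplosive ω) (x t : ℝ≥0) :
    π.surplus x t ω = x + (∫ r in (0 : ℝ)..t, π.premiumRate ω r) -
      (∑ e ∈ eventsUpTo hω t, (π.claimSize e ω : ℝ)) - π.D t ω := by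
  rw [surplus_eq, ← sum_eventCount hω t fun e => (π.claimSize e ω : ℝ)]

/-- The surplus after an event is at most the surplus before, minus the retained claim. -/
theorem surplus_le_preSurplus_sub {ω : Scenario m n} (hω : NonExplosive ω) (x : ℝ≥0)
    (e : Fin m × ℕ) : π.surplus x (eventTime e.1 e.2 ω) ω ≤
      π.preSurplus x (eventTime e.1 e.2 ω) ω - π.claimSize e ω := by
  set t := eventTime e.1 e.2 ω with ht
  rw [π.surplus_eq_sum hω, preSurplus, π.pastClaims_eq hω le_rfl]
  have he : e ∈ eventsUpTo hω t := (mem_eventsUpTo hω).2 le_rfl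
  have : (∑ e' ∈ eventsUpTo hω t, if eventTime e'.1 e'.2 ω < t then (π.claimSize e' ω : ℝ) else 0)
      + π.claimSize e ω ≤ ∑ e' ∈ eventsUpTo hω t, (π.claimSize e' ω : ℝ) := by
    rw [← Finset.add_sum_erase _ _ he, ← Finset.add_sum_erase _ _ he, if_neg (lt_irrefl _), zero_add,
      add_comm]
    refine add_le_add le_rfl (Finset.sum_le_sum fun e' _ => ?_)
    split_ifs
    exacts [le_rfl, NNReal.coe_nonneg _]
  linarith

/-- For s > 0 the surplus before the claims at s is the left limit of the surplus: D is
left-continuous, and close to s from the left all claims before s have already occurred. For s = 0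
it equals x. -/
theorem preSurplus_nonneg (hm : 1 ≤ m) {ω : Scenario m n} (hω : NonExplosive ω) {x s : ℝ≥0}
    (h : ∀ t < s, 0 ≤ π.surplus x t ω) : 0 ≤ π.preSurplus x s ω := by
  rcases eq_or_ne s 0 with rfl | hs
  · rw [preSurplus, π.D_zero]
    simp [pastClaims]
  have hs0 : 0 < s := pos_iff_ne_zero.2 hs
  have : (𝓝[<] s).NeBot := nhdsLT_neBot_of_exists_lt ⟨0, hs0⟩
  have hP := π.pathData hm ω
  have hevent : ∀ᶠ t in 𝓝[<] s, ∀ e ∈ eventsUpTo hω s, eventTime e.1 e.2 ω < s →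
      eventTime e.1 e.2 ω ≤ t := by
    rw [Finset.eventually_all]
    intro e _
    by_cases he : eventTime e.1 e.2 ω < s
    · filter_upwards [Ioo_mem_nhdsLT he] with t ht _ using ht.1.le
    · exact Eventually.of_forall fun t h' => absurd h' he
  have hlow : ∀ᶠ t in 𝓝[<] s,
      -(M.premiumBound * ((s : ℝ) - t)) - ((π.D s ω : ℝ) - π.D t ω) ≤ π.preSurplus x s ω := by
    filter_upwards [hevent, self_mem_nhdsWithin] with t ht hts
    have hts' : t < s := hts
    have hX := h t hts'
    rw [π.surplus_eq_sum hω] at hX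
    have hsum : (π.pastClaims s ω).toReal = ∑ e ∈ eventsUpTo hω t, (π.claimSize e ω : ℝ) := by
      rw [π.pastClaims_eq hω le_rfl, ← Finset.sum_filter]
      congr 1
      ext e
      simp only [Finset.mem_filter, mem_eventsUpTo]
      constructor
      · rintro ⟨h1, h2⟩
        exact ht e ((mem_eventsUpTo hω).2 h1) h2
      · intro h1
        exact ⟨h1.trans hts'.le, h1.trans_lt hts'⟩
    have htsr : (t : ℝ) ≤ s := by exact_mod_cast hts'.le
    have hint : (∫ u in (0 : ℝ)..t, π.premiumRate ω u) + (∫ u in (t : ℝ)..s, π.premiumRate ω u) =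
        ∫ u in (0 : ℝ)..s, π.premiumRate ω u :=
      intervalIntegral.integral_add_adjacent_intervals (hP.intervalIntegrable _ _)
        (hP.intervalIntegrable _ _)
    have hle := (neg_le_abs _).trans (hP.abs_integral_le htsr)
    rw [preSurplus, hsum, ← hint]
    linarith
  refine le_of_tendsto ?_ hlow
  have h1 : Tendsto (fun t : ℝ≥0 => (t : ℝ)) (𝓝[<] s) (𝓝 (s : ℝ)) :=
    NNReal.continuous_coe.continuousAt.tendsto.mono_left nhdsWithin_le_nhds
  have h2 : Tendsto (fun t : ℝ≥0 => (π.D t ω : ℝ)) (𝓝[<] s) (𝓝 (π.D s ω : ℝ)) :=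
    (NNReal.continuous_coe.tendsto _).comp ((π.D_leftCont ω s).tendsto.mono_left
      (nhdsWithin_mono _ Set.Iio_subset_Iic_self))
  have h3 := ((((tendsto_const_nhds (x := (s : ℝ))).sub h1).const_mul M.premiumBound).neg).sub
    ((tendsto_const_nhds (x := (π.D s ω : ℝ))).sub h2)
  simpa using h3

theorem preSurplus_le (hm : 1 ≤ m) (x s : ℝ≥0) (ω : Scenario m n) :
    π.preSurplus x s ω ≤ x + M.premiumBound * s := by
  have h1 := (le_abs_self _).trans ((π.pathData hm ω).abs_integral_le (NNReal.coe_nonneg s))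
  have h2 : 0 ≤ (π.pastClaims s ω).toReal := ENNReal.toReal_nonneg
  have h3 : 0 ≤ (π.D s ω : ℝ) := NNReal.coe_nonneg _
  rw [sub_zero] at h1
  rw [preSurplus]
  change (∫ r in (0 : ℝ)..s, π.premiumRate ω r) ≤ _ at h1
  linarith

end Strategy
end RiskModel

/-! ### The change of variables inequality for the surplus of a strategy -/

section Regular

variable {m n : ℕ}

/-- Finitely many events in bounded time, at positive and distinct times. -/
structure RegularEvents (ω : Scenario m n) : Prop where
  nonExplosive : NonExplosive ω
  gap_pos : ∀ j : Fin m × ℕ, 0 < (ω j).1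
  time_ne : ∀ (k k' : Fin m) (i i' : ℕ), k ≠ k' → eventTime k i ω ≠ eventTime k' i' ω

theorem RegularEvents.time_pos {ω : Scenario m n} (h : RegularEvents ω) (k : Fin m) (i : ℕ) :
    0 < eventTime k i ω := by
  rw [eventTime_eq]
  exact add_pos_of_nonneg_of_pos zero_le (h.gap_pos _)

theorem RegularEvents.injective {ω : Scenario m n} (h : RegularEvents ω) :
    Function.Injective fun e : Fin m × ℕ => eventTime e.1 e.2 ω := by
  rintro ⟨k, i⟩ ⟨k', i'⟩ he
  by_cases hk : k = k'
  · subst hk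
    have : StrictMono fun i => eventTime k i ω := strictMono_nat_of_lt_succ fun i => by
      rw [eventTime_eq k (i + 1), prevTime_succ]
      exact lt_add_of_pos_right _ (h.gap_pos _)
    exact congrArg (Prod.mk k) (this.injective he)
  · exact absurd he (h.time_ne k k' i i' hk)

theorem RiskModel.ae_regularEvents (M : RiskModel m n) : ∀ᵐ ω ∂M.prob, RegularEvents ω := by
  filter_upwards [M.ae_nonExplosive, M.ae_gap_pos, M.ae_eventTime_ne] with ω h1 h2 h3
  exact ⟨h1, h2, h3⟩

end Regular

/-- Extension of a function on the surplus axis by zero after ruin. -/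
def killed (v : ℝ → ℝ) (z : ℝ) : ℝ := if 0 ≤ z then v z else 0

namespace RiskModel.Strategy

variable {m n : ℕ} {M : RiskModel m n} (π : M.Strategy)

theorem jumpPath_eq_preSurplus {ω : Scenario m n} (hω : NonExplosive ω) (x : ℝ≥0) {s b : ℝ≥0}
    (hs : s ≤ b) :
    PathData.jumpPath (fun t : ℝ => (π.D t.toNNReal ω : ℝ)) (π.premiumRate ω) x
      ((eventsUpTo hω b).filter fun e => eventTime e.1 e.2 ω < b)
      (fun e => (eventTime e.1 e.2 ω : ℝ)) (fun e => (π.claimSize e ω : ℝ)) s =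
    π.preSurplus x s ω := by
  rw [PathData.jumpPath, preSurplus, π.pastClaims_eq hω hs, Finset.sum_filter]
  simp only [Real.toNNReal_coe, Real.toNNReal_zero, π.D_zero, NNReal.coe_zero, sub_zero,
    NNReal.coe_lt_coe]
  have : ∀ e ∈ eventsUpTo hω b, (if eventTime e.1 e.2 ω < b then
      (if eventTime e.1 e.2 ω < s then (π.claimSize e ω : ℝ) else 0) else 0) =
      if eventTime e.1 e.2 ω < s then (π.claimSize e ω : ℝ) else 0 := by
    intro e _
    by_cases h : eventTime e.1 e.2 ω < s
    · rw [if_pos (h.trans_le hs)]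
    · simp [h]
  rw [Finset.sum_congr rfl this]
  ring

/-- The deterministic inequality is applied to the events strictly before b, and the values before
claims are moved to the left, so that both sums have nonnegative terms. An event exactly at b is
paid for by the terminal value. -/
theorem chain_le (hm : 1 ≤ m) {v dv : ℝ → ℝ} (hv : SlopeFunction v dv) {ω : Scenario m n}
    (hω : RegularEvents ω) (x : ℝ≥0) {b : ℝ≥0} (hb : ∀ t < b, 0 ≤ π.surplus x t ω) :
    (∫ r in Set.Ico 0 (b : ℝ), Real.exp (-M.δ * r) ∂(π.dividendMeasure ω)) +
      ∑ e ∈ eventsUpTo hω.nonExplosive b, Real.exp (-M.δ * eventTime e.1 e.2 ω) *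
        v (π.preSurplus x (eventTime e.1 e.2 ω) ω) ≤
    v x + (∫ r in (0 : ℝ)..b, PathData.drift M.δ v dv (π.premiumRate ω)
        (fun r => π.preSurplus x r.toNNReal ω) r) +
      ∑ e ∈ eventsUpTo hω.nonExplosive b, Real.exp (-M.δ * eventTime e.1 e.2 ω) *
        killed v (π.preSurplus x (eventTime e.1 e.2 ω) ω - π.claimSize e ω) := by
  classical
  have hne := hω.nonExplosive
  have hP := π.pathData hm ω
  set E := (eventsUpTo hne b).filter fun e => eventTime e.1 e.2 ω < b with hE
  have hYs : ∀ s : ℝ≥0, s ≤ b → 0 ≤ π.preSurplus x s ω := fun s hs =>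
    π.preSurplus_nonneg hm hne fun t ht => hb t (ht.trans_le hs)
  have hpost : ∀ e ∈ E, 0 ≤ π.preSurplus x (eventTime e.1 e.2 ω) ω - π.claimSize e ω := by
    intro e he
    exact (hb _ (Finset.mem_filter.1 he).2).trans (π.surplus_le_preSurplus_sub hne x e)
  have hJ : ∀ s : ℝ, 0 ≤ s → s ≤ b →
      PathData.jumpPath (fun t : ℝ => (π.D t.toNNReal ω : ℝ)) (π.premiumRate ω) x E
      (fun e => (eventTime e.1 e.2 ω : ℝ)) (fun e => (π.claimSize e ω : ℝ)) s =
      π.preSurplus x s.toNNReal ω := by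
    intro s hs hsb
    lift s to ℝ≥0 using hs
    rw [Real.toNNReal_coe]
    exact π.jumpPath_eq_preSurplus hne x (by exact_mod_cast hsb)
  have hJe : ∀ e ∈ E, PathData.jumpPath (fun t : ℝ => (π.D t.toNNReal ω : ℝ)) (π.premiumRate ω) x E
      (fun e => (eventTime e.1 e.2 ω : ℝ)) (fun e => (π.claimSize e ω : ℝ)) (eventTime e.1 e.2 ω) =
      π.preSurplus x (eventTime e.1 e.2 ω) ω := fun e he =>
    π.jumpPath_eq_preSurplus hne x (Finset.mem_filter.1 he).2.le
  have h := hP.jumpPath_chain hv M.δ_pos (z := (x : ℝ)) E (fun e => (eventTime e.1 e.2 ω : ℝ))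
    (fun e => (π.claimSize e ω : ℝ)) b (NNReal.coe_nonneg b) (fun e _ => NNReal.coe_nonneg _)
    (fun e _ e' _ hee => hω.injective (NNReal.coe_injective hee))
    (fun e he => ⟨by exact_mod_cast hω.time_pos _ _,
      by exact_mod_cast (Finset.mem_filter.1 he).2⟩)
    (fun s hs => by
      rw [hJ s hs.1 hs.2]
      exact hYs _ (Real.toNNReal_le_iff_le_coe.2 hs.2))
    (fun e he => by rw [hJe e he]; exact hpost e he)
  rw [hJ b (NNReal.coe_nonneg b) le_rfl, Real.toNNReal_coe] at h
  have hd : (∫ r in (0 : ℝ)..b, PathData.drift M.δ v dv (π.premiumRate ω)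
      (PathData.jumpPath (fun t : ℝ => (π.D t.toNNReal ω : ℝ)) (π.premiumRate ω) x E
      (fun e => (eventTime e.1 e.2 ω : ℝ)) (fun e => (π.claimSize e ω : ℝ))) r) =
      ∫ r in (0 : ℝ)..b, PathData.drift M.δ v dv (π.premiumRate ω)
        (fun r => π.preSurplus x r.toNNReal ω) r := by
    refine intervalIntegral.integral_congr_ae (ae_of_all _ fun r hr => ?_)
    rw [Set.uIoc_of_le (NNReal.coe_nonneg b)] at hr
    simp only [PathData.drift, hJ r hr.1.le hr.2]
  rw [hd] at h
  have hs : ∑ e ∈ E, Real.exp (-M.δ * eventTime e.1 e.2 ω) *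
      (v (PathData.jumpPath (fun t : ℝ => (π.D t.toNNReal ω : ℝ)) (π.premiumRate ω) x E
      (fun e => (eventTime e.1 e.2 ω : ℝ)) (fun e => (π.claimSize e ω : ℝ)) (eventTime e.1 e.2 ω)
        - π.claimSize e ω) -
      v (PathData.jumpPath (fun t : ℝ => (π.D t.toNNReal ω : ℝ)) (π.premiumRate ω) x E
      (fun e => (eventTime e.1 e.2 ω : ℝ)) (fun e => (π.claimSize e ω : ℝ))
        (eventTime e.1 e.2 ω))) =
      (∑ e ∈ E, Real.exp (-M.δ * eventTime e.1 e.2 ω) *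
        killed v (π.preSurplus x (eventTime e.1 e.2 ω) ω - π.claimSize e ω)) -
      ∑ e ∈ E, Real.exp (-M.δ * eventTime e.1 e.2 ω) *
        v (π.preSurplus x (eventTime e.1 e.2 ω) ω) := by
    rw [← Finset.sum_sub_distrib]
    refine Finset.sum_congr rfl fun e he => ?_
    rw [hJe e he, killed, if_pos (hpost e he)]
    ring
  rw [hs] at h
  have hsub : E ⊆ eventsUpTo hne b := Finset.filter_subset _ _
  have hkill : ∀ z, 0 ≤ killed v z := by
    intro z
    unfold killed
    split_ifs with hz
    exacts [hv.nonneg z hz, le_rfl]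
  have h1 : ∑ e ∈ E, Real.exp (-M.δ * eventTime e.1 e.2 ω) *
        killed v (π.preSurplus x (eventTime e.1 e.2 ω) ω - π.claimSize e ω) ≤
      ∑ e ∈ eventsUpTo hne b, Real.exp (-M.δ * eventTime e.1 e.2 ω) *
        killed v (π.preSurplus x (eventTime e.1 e.2 ω) ω - π.claimSize e ω) :=
    Finset.sum_le_sum_of_subset_of_nonneg hsub fun e _ _ =>
      mul_nonneg (Real.exp_pos _).le (hkill _)
  have h2 : ∑ e ∈ eventsUpTo hne b, Real.exp (-M.δ * eventTime e.1 e.2 ω) *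
        v (π.preSurplus x (eventTime e.1 e.2 ω) ω) ≤
      (∑ e ∈ E, Real.exp (-M.δ * eventTime e.1 e.2 ω) *
        v (π.preSurplus x (eventTime e.1 e.2 ω) ω)) +
      Real.exp (-M.δ * b) * v (π.preSurplus x b ω) := by
    rw [← Finset.sum_sdiff hsub, add_comm]
    refine add_le_add le_rfl ?_
    have hb0 : 0 ≤ Real.exp (-M.δ * b) * v (π.preSurplus x b ω) :=
      mul_nonneg (Real.exp_pos _).le (hv.nonneg _ (hYs b le_rfl))
    -- Event times are distinct, so at most one event takes place at b, and a single terminal term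
    -- compensates it.
    have hT : ∀ e ∈ eventsUpTo hne b \ E, eventTime e.1 e.2 ω = b := by
      intro e he
      rw [Finset.mem_sdiff, hE, Finset.mem_filter, not_and] at he
      exact le_antisymm ((mem_eventsUpTo hne).1 he.1) (not_lt.1 (he.2 he.1))
    have hcard : (eventsUpTo hne b \ E).card ≤ 1 := Finset.card_le_one.2 fun e he e' he' =>
      hω.injective ((hT e he).trans (hT e' he').symm)
    calc _ ≤ ∑ e ∈ eventsUpTo hne b \ E, Real.exp (-M.δ * b) * v (π.preSurplus x b ω) :=
          Finset.sum_le_sum fun e he => by rw [hT e he]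
      _ ≤ _ := by
          rw [Finset.sum_const, nsmul_eq_mul]
          have : ((eventsUpTo hne b \ E).card : ℝ) ≤ 1 := by exact_mod_cast hcard
          nlinarith
  linarith

end RiskModel.Strategy

namespace RiskModel.Strategy

variable {m n : ℕ} {M : RiskModel m n} (π : M.Strategy)

theorem Alive.mono {π : M.Strategy} {x s t : ℝ≥0} {ω : Scenario m n} (h : π.Alive x t ω)
    (hst : s ≤ t) : π.Alive x s ω := fun q hq => h q (hq.trans_le hst)

/-- Discounted value of a surplus process immediately before an event. -/
def preValue (v : ℝ → ℝ) (x s : ℝ≥0) (ω : Scenario m n) : ℝ≥0∞ :=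
  ENNReal.ofReal (Real.exp (-M.δ * s) * v (π.preSurplus x s ω))

/-- Discounted value immediately after an event with retained claim `c`. -/
def postValue (v : ℝ → ℝ) (x s c : ℝ≥0) (ω : Scenario m n) : ℝ≥0∞ :=
  ENNReal.ofReal (Real.exp (-M.δ * s) * killed v (π.preSurplus x s ω - c))

/-- Drift of the discounted value. -/
def valueDrift (v dv : ℝ → ℝ) (x : ℝ≥0) (ω : Scenario m n) : ℝ → ℝ :=
  PathData.drift M.δ v dv (π.premiumRate ω) (fun r => π.preSurplus x r.toNNReal ω)

theorem killed_nonneg {v dv : ℝ → ℝ} (hv : SlopeFunction v dv) (z : ℝ) : 0 ≤ killed v z := by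
  unfold killed
  split_ifs with hz
  exacts [hv.nonneg z hz, le_rfl]

open scoped Classical in
-- Splitting the drift into positive and negative parts removes all subtractions, so extended
-- nonnegative integrals can be used. The right side is enlarged to all times at which there has
-- been no ruin before, which makes it independent of b.
theorem chain_lintegral_le (hm : 1 ≤ m) {v dv : ℝ → ℝ} (hv : SlopeFunction v dv) {ω : Scenario m n}
    (hω : RegularEvents ω) (x : ℝ≥0) {b : ℝ≥0} (hb : π.Alive x b ω) :
    (∫⁻ r in Set.Ico 0 (b : ℝ), ENNReal.ofReal (Real.exp (-M.δ * r)) ∂(π.dividendMeasure ω)) +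
      ((∑' e : Fin m × ℕ, if eventTime e.1 e.2 ω ≤ b then
        π.preValue v x (eventTime e.1 e.2 ω) ω else 0) +
      ∫⁻ r in Set.Ioc 0 (b : ℝ), ENNReal.ofReal (-π.valueDrift v dv x ω r)) ≤
    ENNReal.ofReal (v x) +
      ((∑' e : Fin m × ℕ, if π.Alive x (eventTime e.1 e.2 ω) ω then
        π.postValue v x (eventTime e.1 e.2 ω) (π.claimSize e ω) ω else 0) +
      ∫⁻ r in Set.Ioi (0 : ℝ), if π.Alive x r.toNNReal ω then
        ENNReal.ofReal (π.valueDrift v dv x ω r) else 0) := by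
  have hne := hω.nonExplosive
  have hP := π.pathData hm ω
  have hb' := (π.alive_iff hm x b ω).1 hb
  have hYs : ∀ s : ℝ≥0, s ≤ b → 0 ≤ π.preSurplus x s ω := fun s hs =>
    π.preSurplus_nonneg hm hne fun t ht => hb' t (ht.trans_le hs)
  have h := π.chain_le hm hv hω x hb'
  have hmY : Measurable fun r : ℝ => π.preSurplus x r.toNNReal ω :=
    (π.measurable_preSurplus x).comp (f := fun r : ℝ => (r.toNNReal, ω)) (by fun_prop)
  have hint : IntervalIntegrable (π.valueDrift v dv x ω) volume 0 b := by
    refine hP.intervalIntegrable_drift hv M.δ_pos (B := x + M.premiumBound * b)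
      (NNReal.coe_nonneg b) hmY fun s hs => ?_
    have hsb : s.toNNReal ≤ b := Real.toNNReal_le_iff_le_coe.2 hs.2
    refine ⟨hYs _ hsb, (π.preSurplus_le hm x _ ω).trans ?_⟩
    have := mul_le_mul_of_nonneg_left (NNReal.coe_le_coe.2 hsb) (M.premiumBound_nonneg hm)
    linarith
  have hon : IntegrableOn (π.valueDrift v dv x ω) (Set.Ioc 0 b) volume := by
    rwa [intervalIntegrable_iff_integrableOn_Ioc_of_le (NNReal.coe_nonneg b)] at hint
  set GP := ∫⁻ r in Set.Ioc 0 (b : ℝ), ENNReal.ofReal (π.valueDrift v dv x ω r) with hGP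
  set GN := ∫⁻ r in Set.Ioc 0 (b : ℝ), ENNReal.ofReal (-π.valueDrift v dv x ω r) with hGN
  have hGPt : GP ≠ ⊤ := (hon.lintegral_lt_top).ne
  have hGNt : GN ≠ ⊤ := (hon.neg.lintegral_lt_top).ne
  have hd : (∫ r in (0 : ℝ)..b, π.valueDrift v dv x ω r) = GP.toReal - GN.toReal := by
    rw [intervalIntegral.integral_of_le (NNReal.coe_nonneg b)]
    exact integral_eq_lintegral_pos_part_sub_lintegral_neg_part hon
  have hF : (∫⁻ r in Set.Ico 0 (b : ℝ), ENNReal.ofReal (Real.exp (-M.δ * r))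
      ∂(π.dividendMeasure ω)) = ENNReal.ofReal (∫ r in Set.Ico 0 (b : ℝ), Real.exp (-M.δ * r)
      ∂(π.dividendMeasure ω)) := by
    rw [ofReal_integral_eq_lintegral_ofReal hP.integrableOn_exp
      (ae_of_all _ fun r => (Real.exp_pos _).le)]
  have hB : (∑' e : Fin m × ℕ, if eventTime e.1 e.2 ω ≤ b then
        π.preValue v x (eventTime e.1 e.2 ω) ω else 0) =
      ENNReal.ofReal (∑ e ∈ eventsUpTo hne b, Real.exp (-M.δ * eventTime e.1 e.2 ω) *
        v (π.preSurplus x (eventTime e.1 e.2 ω) ω)) := by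
    rw [tsum_eq_sum (s := eventsUpTo hne b), ENNReal.ofReal_sum_of_nonneg]
    · refine Finset.sum_congr rfl fun e he => ?_
      rw [if_pos ((mem_eventsUpTo hne).1 he), preValue]
    · intro e he
      exact mul_nonneg (Real.exp_pos _).le (hv.nonneg _ (hYs _ ((mem_eventsUpTo hne).1 he)))
    · intro e he
      rw [if_neg fun h => he ((mem_eventsUpTo hne).2 h)]
  have hA0 : 0 ≤ ∑ e ∈ eventsUpTo hne b, Real.exp (-M.δ * eventTime e.1 e.2 ω) *
        killed v (π.preSurplus x (eventTime e.1 e.2 ω) ω - π.claimSize e ω) :=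
    Finset.sum_nonneg fun e _ => mul_nonneg (Real.exp_pos _).le (killed_nonneg hv _)
  have hA : ENNReal.ofReal (∑ e ∈ eventsUpTo hne b, Real.exp (-M.δ * eventTime e.1 e.2 ω) *
        killed v (π.preSurplus x (eventTime e.1 e.2 ω) ω - π.claimSize e ω)) ≤
      ∑' e : Fin m × ℕ, if π.Alive x (eventTime e.1 e.2 ω) ω then
        π.postValue v x (eventTime e.1 e.2 ω) (π.claimSize e ω) ω else 0 := by
    rw [ENNReal.ofReal_sum_of_nonneg fun e _ =>
      mul_nonneg (Real.exp_pos _).le (killed_nonneg hv _)]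
    refine le_trans (Finset.sum_le_sum fun e he => ?_) (ENNReal.sum_le_tsum (eventsUpTo hne b))
    rw [if_pos (hb.mono ((mem_eventsUpTo hne).1 he)), postValue]
  have hG : GP ≤ ∫⁻ r in Set.Ioi (0 : ℝ), if π.Alive x r.toNNReal ω then
        ENNReal.ofReal (π.valueDrift v dv x ω r) else 0 := by
    rw [hGP, ← lintegral_indicator measurableSet_Ioc, ← lintegral_indicator measurableSet_Ioi]
    refine lintegral_mono fun r => ?_
    by_cases hr : r ∈ Set.Ioc 0 (b : ℝ)
    · rw [Set.indicator_of_mem hr, Set.indicator_of_mem (show r ∈ Set.Ioi (0 : ℝ) from hr.1),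
        if_pos (hb.mono (Real.toNNReal_le_iff_le_coe.2 hr.2))]
    · rw [Set.indicator_of_notMem hr]; exact zero_le
  have hv0 := hv.nonneg x (NNReal.coe_nonneg x)
  have hB0 : 0 ≤ ∑ e ∈ eventsUpTo hne b, Real.exp (-M.δ * eventTime e.1 e.2 ω) *
        v (π.preSurplus x (eventTime e.1 e.2 ω) ω) :=
    Finset.sum_nonneg fun e he =>
      mul_nonneg (Real.exp_pos _).le (hv.nonneg _ (hYs _ ((mem_eventsUpTo hne).1 he)))
  refine le_trans ?_ (add_le_add le_rfl (add_le_add hA hG))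
  rw [hF, hB, ← ENNReal.ofReal_toReal hGPt, ← ENNReal.ofReal_toReal hGNt,
    ← ENNReal.ofReal_add hB0 ENNReal.toReal_nonneg, ← ENNReal.ofReal_add hA0 ENNReal.toReal_nonneg,
    ← ENNReal.ofReal_add hv0 (add_nonneg hA0 ENNReal.toReal_nonneg), ← ENNReal.ofReal_add
      (integral_nonneg fun _ => (Real.exp_pos _).le) (add_nonneg hB0 ENNReal.toReal_nonneg)]
  refine ENNReal.ofReal_le_ofReal ?_
  change _ ≤ v x + (∫ r in (0 : ℝ)..b, π.valueDrift v dv x ω r) + _ at h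
  rw [hd] at h
  linarith

theorem alive_iff_le_ruinTime (hm : 1 ≤ m) (x s : ℝ≥0) (ω : Scenario m n) :
    π.Alive x s ω ↔ (s : ℝ≥0∞) ≤ π.ruinTime x ω := by
  rw [π.alive_iff hm, ruinTime, le_iInf₂_iff]
  refine forall_congr' fun t => ?_
  rw [ENNReal.coe_le_coe, ← not_lt, ← not_lt (b := s)]
  exact imp_not_comm

theorem tendsto_setLIntegral_of_monotone {α : Type*} [MeasurableSpace α] (μ : Measure α)
    (f : α → ℝ≥0∞) {S : ℕ → Set α} (hS : ∀ i, MeasurableSet (S i)) (hmono : Monotone S)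
    {U : Set α} (hU : ⋃ i, S i = U) :
    Tendsto (fun i => ∫⁻ a in S i, f a ∂μ) atTop (𝓝 (∫⁻ a in U, f a ∂μ)) := by
  have h1 : ∀ i, ∫⁻ a in S i, f a ∂μ = (μ.withDensity f) (S i) := fun i =>
    (withDensity_apply f (hS i)).symm
  rw [← hU, ← withDensity_apply f (MeasurableSet.iUnion hS)]
  simp_rw [h1]
  exact tendsto_measure_iUnion_atTop hmono

open scoped Classical in
-- Let b run through min(τ, N). The intervals [0, b) fill [0, τ), the times s ≤ b exhaust those with
-- `Alive`, and the left side converges by monotonicity while the right side does not depend on N.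
theorem path_lintegral_le (hm : 1 ≤ m) {v dv : ℝ → ℝ} (hv : SlopeFunction v dv) {ω : Scenario m n}
    (hω : RegularEvents ω) (x : ℝ≥0) :
    (∫⁻ s in {s : ℝ | 0 ≤ s ∧ ENNReal.ofReal s < π.ruinTime x ω},
      ENNReal.ofReal (Real.exp (-M.δ * s)) ∂(π.dividendMeasure ω)) +
      ((∑' e : Fin m × ℕ, if π.Alive x (eventTime e.1 e.2 ω) ω then
        π.preValue v x (eventTime e.1 e.2 ω) ω else 0) +
      ∫⁻ r in Set.Ioi (0 : ℝ), if π.Alive x r.toNNReal ω then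
        ENNReal.ofReal (-π.valueDrift v dv x ω r) else 0) ≤
    ENNReal.ofReal (v x) +
      ((∑' e : Fin m × ℕ, if π.Alive x (eventTime e.1 e.2 ω) ω then
        π.postValue v x (eventTime e.1 e.2 ω) (π.claimSize e ω) ω else 0) +
      ∫⁻ r in Set.Ioi (0 : ℝ), if π.Alive x r.toNNReal ω then
        ENNReal.ofReal (π.valueDrift v dv x ω r) else 0) := by
  have hal := π.alive_iff_le_ruinTime hm x
  set τ := π.ruinTime x ω with hτ
  let b : ℕ → ℝ≥0 := fun N => (min τ N).toNNReal
  have hbt : ∀ N : ℕ, min τ N ≠ ⊤ := fun N => (min_lt_of_right_lt (ENNReal.natCast_lt_top N)).ne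
  have hbc : ∀ N, ((b N : ℝ≥0) : ℝ≥0∞) = min τ N := fun N => ENNReal.coe_toNNReal (hbt N)
  have hbmono : Monotone b := fun N N' h => by
    rw [← ENNReal.coe_le_coe, hbc, hbc]
    exact min_le_min le_rfl (by exact_mod_cast h)
  have hbal : ∀ N, π.Alive x (b N) ω := fun N => by
    rw [hal, hbc]; exact min_le_left _ _
  have hcov : ∀ s : ℝ≥0, (∃ N, s ≤ b N) ↔ π.Alive x s ω := by
    intro s
    refine ⟨fun ⟨N, hN⟩ => (hbal N).mono hN, fun h => ?_⟩
    obtain ⟨N, hN⟩ := exists_nat_ge s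
    refine ⟨N, ?_⟩
    rw [← ENNReal.coe_le_coe, hbc]
    exact le_min ((hal s ω).1 h) (by exact_mod_cast hN)
  have hF : Tendsto (fun N => ∫⁻ r in Set.Ico 0 (b N : ℝ), ENNReal.ofReal (Real.exp (-M.δ * r))
      ∂(π.dividendMeasure ω)) atTop (𝓝 (∫⁻ s in {s : ℝ | 0 ≤ s ∧ ENNReal.ofReal s < τ},
      ENNReal.ofReal (Real.exp (-M.δ * s)) ∂(π.dividendMeasure ω))) := by
    refine tendsto_setLIntegral_of_monotone _ _ (fun _ => measurableSet_Ico)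
      (fun N N' h => Set.Ico_subset_Ico_right (NNReal.coe_le_coe.2 (hbmono h))) ?_
    ext s
    simp only [Set.mem_iUnion, Set.mem_Ico, Set.mem_ofPred_eq]
    constructor
    · rintro ⟨N, h0, hs⟩
      refine ⟨h0, ?_⟩
      lift s to ℝ≥0 using h0
      rw [ENNReal.ofReal_coe_nnreal]
      refine lt_of_lt_of_le (ENNReal.coe_lt_coe.2 (by exact_mod_cast hs)) ((hbc N).trans_le
        (min_le_left _ _))
    · rintro ⟨h0, hs⟩
      lift s to ℝ≥0 using h0
      rw [ENNReal.ofReal_coe_nnreal] at hs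
      obtain ⟨N, hN⟩ := exists_nat_gt s
      refine ⟨N, NNReal.coe_nonneg s, ?_⟩
      rw [NNReal.coe_lt_coe, ← ENNReal.coe_lt_coe, hbc]
      exact lt_min hs (by exact_mod_cast hN)
  have hG : Tendsto (fun N => ∫⁻ r in Set.Ioc 0 (b N : ℝ), ENNReal.ofReal
      (-π.valueDrift v dv x ω r)) atTop (𝓝 (∫⁻ r in Set.Ioi (0 : ℝ), if π.Alive x r.toNNReal ω then
        ENNReal.ofReal (-π.valueDrift v dv x ω r) else 0)) := by
    have h1 := tendsto_setLIntegral_of_monotone volume (fun r => ENNReal.ofReal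
      (-π.valueDrift v dv x ω r)) (S := fun N => Set.Ioc 0 (b N : ℝ)) (fun _ => measurableSet_Ioc)
      (fun N N' h => Set.Ioc_subset_Ioc_right (NNReal.coe_le_coe.2 (hbmono h))) rfl
    convert h1 using 2
    have hm1 : MeasurableSet (⋃ N, Set.Ioc 0 (b N : ℝ)) :=
      MeasurableSet.iUnion fun _ => measurableSet_Ioc
    rw [← lintegral_indicator hm1, ← lintegral_indicator measurableSet_Ioi]
    refine lintegral_congr fun r => ?_
    by_cases hr : r ∈ ⋃ N, Set.Ioc 0 (b N : ℝ)
    · rw [Set.indicator_of_mem hr]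
      obtain ⟨N, hN⟩ := Set.mem_iUnion.1 hr
      rw [Set.indicator_of_mem (show r ∈ Set.Ioi (0 : ℝ) from hN.1),
        if_pos ((hbal N).mono (Real.toNNReal_le_iff_le_coe.2 hN.2))]
    · rw [Set.indicator_of_notMem hr]
      by_cases h0 : 0 < r
      · rw [Set.indicator_of_mem (show r ∈ Set.Ioi (0 : ℝ) from h0), if_neg]
        intro h
        obtain ⟨N, hN⟩ := (hcov _).2 h
        exact hr (Set.mem_iUnion.2 ⟨N, h0, Real.toNNReal_le_iff_le_coe.1 hN⟩)
      · rw [Set.indicator_of_notMem (show r ∉ Set.Ioi (0 : ℝ) from h0)]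
  have hB : Tendsto (fun N => ∑' e : Fin m × ℕ, if eventTime e.1 e.2 ω ≤ b N then
        π.preValue v x (eventTime e.1 e.2 ω) ω else 0) atTop
      (𝓝 (∑' e : Fin m × ℕ, if π.Alive x (eventTime e.1 e.2 ω) ω then
        π.preValue v x (eventTime e.1 e.2 ω) ω else 0)) := by
    simp_rw [← lintegral_count]
    refine lintegral_tendsto_of_tendsto_of_monotone (fun N => Measurable.aemeasurable
      (measurable_of_countable _)) (ae_of_all _ fun e N N' h => ?_) (ae_of_all _ fun e => ?_)
    · by_cases h1 : eventTime e.1 e.2 ω ≤ b N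
      · simp only [if_pos h1, if_pos (h1.trans (hbmono h)), le_refl]
      · simp only [if_neg h1, zero_le]
    · by_cases h1 : π.Alive x (eventTime e.1 e.2 ω) ω
      · obtain ⟨N, hN⟩ := (hcov _).2 h1
        rw [if_pos h1]
        refine tendsto_const_nhds.congr' ?_
        filter_upwards [eventually_ge_atTop N] with N' hN'
        rw [if_pos (hN.trans (hbmono hN'))]
      · rw [if_neg h1]
        refine tendsto_const_nhds.congr fun N => ?_
        rw [if_neg fun h => h1 ((hcov _).1 ⟨N, h⟩)]
  exact le_of_tendsto' (hF.add (hB.add hG)) fun N => π.chain_lintegral_le hm hv hω x (hbal N)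

end RiskModel.Strategy

theorem measurable_killed {v : ℝ → ℝ} (hv : Measurable v) : Measurable (killed v) :=
  Measurable.ite (measurableSet_le measurable_const measurable_id) hv measurable_const

/-! ### Verification: smooth supersolutions dominate the value of every strategy -/

namespace RiskModel

variable {m n : ℕ} (M : RiskModel m n)

theorem lintegral_all_events
    {h : ℝ≥0 → ((Fin n → Bool) × (Fin n → ℝ≥0)) → Scenario m n → ℝ≥0∞}
    (hm : Measurable fun q : ℝ≥0 × ((Fin n → Bool) × (Fin n → ℝ≥0)) × Scenario m n =>
      h q.1 q.2.1 q.2.2)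
    (hp : ∀ y, EventPredictable fun s ω => h s y ω) :
    ∫⁻ ω, ∑' e : Fin m × ℕ, h (eventTime e.1 e.2 ω) (ω e).2 ω ∂M.prob =
      ∫⁻ ω, (∫⁻ s in Set.Ioi (0 : ℝ), ∑ k,
          ENNReal.ofReal (M.β k) * ∫⁻ y, h s.toNNReal y ω ∂(M.hitLaw k)) ∂M.prob := by
  have h1 : ∀ ω, ∑' e : Fin m × ℕ, h (eventTime e.1 e.2 ω) (ω e).2 ω =
      ∑ k, ∑' i, h (eventTime k i ω) (ω (k, i)).2 ω := fun ω => by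
    rw [ENNReal.tsum_prod', tsum_fintype]
  have h2 : ∀ k i, Measurable fun ω : Scenario m n => h (eventTime k i ω) (ω (k, i)).2 ω :=
    fun k i => hm.comp (f := fun ω : Scenario m n => (eventTime k i ω, (ω (k, i)).2, ω))
      (by fun_prop)
  have h3 : ∀ k, Measurable fun q : Scenario m n × ℝ => ENNReal.ofReal (M.β k) *
      ∫⁻ y, h q.2.toNNReal y q.1 ∂(M.hitLaw k) := fun k =>
    (Measurable.lintegral_prod_right' (f := fun q : (Scenario m n × ℝ) ×
      ((Fin n → Bool) × (Fin n → ℝ≥0)) => h q.1.2.toNNReal q.2 q.1.1)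
      (hm.comp (f := fun q : (Scenario m n × ℝ) × ((Fin n → Bool) × (Fin n → ℝ≥0)) =>
        (q.1.2.toNNReal, q.2, q.1.1)) (by fun_prop))).const_mul _
  have h4 : ∀ ω, (∫⁻ s in Set.Ioi (0 : ℝ), ∑ k,
          ENNReal.ofReal (M.β k) * ∫⁻ y, h s.toNNReal y ω ∂(M.hitLaw k)) =
      ∑ k, ∫⁻ s in Set.Ioi (0 : ℝ),
          ENNReal.ofReal (M.β k) * ∫⁻ y, h s.toNNReal y ω ∂(M.hitLaw k) := fun ω =>
    lintegral_finsetSum _ fun k _ => (h3 k).comp measurable_prodMk_left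
  simp_rw [h1, h4]
  rw [lintegral_finsetSum _ fun k _ => Measurable.tsum fun i => h2 k i,
    lintegral_finsetSum _ fun k _ => (h3 k).lintegral_prod_right']
  exact Finset.sum_congr rfl fun k _ => M.lintegral_events k hm hp

theorem ofReal_totalRate : ENNReal.ofReal M.totalRate = ∑ k, ENNReal.ofReal (M.β k) :=
  ENNReal.ofReal_sum_of_nonneg fun k _ => (M.β_pos k).le

/-- Killing v below zero has the same effect as restricting the integral to claims that do not
exceed the surplus. -/
theorem generator_integral_eq {v dv : ℝ → ℝ} (hv : SlopeFunction v dv) {R : Fin n → ℝ≥0 → ℝ≥0}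
    {e : ℝ} (he : 0 ≤ e) (z : ℝ≥0) [IsProbabilityMeasure (M.claimLaw R)] :
    ∫⁻ a, ENNReal.ofReal (e * killed v (z - (a : ℝ≥0))) ∂(M.claimLaw R) =
      ENNReal.ofReal (e * ∫ a in Set.Iic z, v ((z - a : ℝ≥0) : ℝ) ∂(M.claimLaw R)) := by
  obtain ⟨C, hC0, hC⟩ := hv.exists_bound z
  have hint : IntegrableOn (fun a : ℝ≥0 => v ((z - a : ℝ≥0) : ℝ)) (Set.Iic z) (M.claimLaw R) := by
    refine Measure.integrableOn_of_bounded (M := C) (measure_ne_top _ _)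
      (hv.continuous.comp (by fun_prop)).measurable.aestronglyMeasurable
      (ae_of_all _ fun a => (hC _ ⟨NNReal.coe_nonneg _, ?_⟩).1)
    exact_mod_cast tsub_le_self
  rw [← integral_const_mul, ofReal_integral_eq_lintegral_ofReal (hint.const_mul e)
    (ae_of_all _ fun a => mul_nonneg he (hv.nonneg _ (NNReal.coe_nonneg _))),
    ← lintegral_indicator measurableSet_Iic]
  refine lintegral_congr fun a => ?_
  by_cases h : a ∈ Set.Iic z
  · rw [Set.indicator_of_mem h, killed, if_pos (sub_nonneg.2 (NNReal.coe_le_coe.2 h)),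
      NNReal.coe_sub h]
  · have h' : (z : ℝ) < a := by exact_mod_cast not_le.1 h
    rw [Set.indicator_of_notMem h, killed, if_neg (by linarith)]
    simp

/-- This is the generator inequality multiplied by the discount factor e, with negative terms moved
to the other side; a case distinction on the sign of the drift handles its two parts. -/
theorem jump_add_drift_le (hm : 1 ≤ m) {v dv : ℝ → ℝ} (hv : SlopeFunction v dv)
    {R : Fin n → ℝ≥0 → ℝ≥0} (hR : M.IsContract R) {z : ℝ≥0}
    (hgen : M.generator R (fun y : ℝ≥0 => v y) (dv z) z ≤ 0) {e : ℝ} (he : 0 ≤ e) :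
    ENNReal.ofReal M.totalRate *
        ∫⁻ a, ENNReal.ofReal (e * killed v (z - (a : ℝ≥0))) ∂(M.claimLaw R) +
      ENNReal.ofReal (e * dv z * M.netPremium R - M.δ * e * v z) ≤
    ENNReal.ofReal M.totalRate * ENNReal.ofReal (e * v z) +
      ENNReal.ofReal (-(e * dv z * M.netPremium R - M.δ * e * v z)) := by
  have hβ := (M.totalRate_pos hm).le
  have := M.isProbabilityMeasure_claimLaw hm hR.measurable
  rw [M.generator_integral_eq hv he z, ← ENNReal.ofReal_mul hβ, ← ENNReal.ofReal_mul hβ]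
  rw [generator] at hgen
  have hv0 := hv.nonneg z (NNReal.coe_nonneg z)
  set J := ∫ a in Set.Iic z, v ((z - a : ℝ≥0) : ℝ) ∂(M.claimLaw R) with hJ
  have hJ0 : 0 ≤ J := integral_nonneg fun a => hv.nonneg _ (NNReal.coe_nonneg _)
  have key := mul_le_mul_of_nonneg_left hgen he
  set d := e * dv z * M.netPremium R - M.δ * e * v z with hd
  have h1 : M.totalRate * (e * J) + d ≤ M.totalRate * (e * v z) := by
    rw [hd]; linarith
  rcases le_total 0 d with h | h
  · rw [← ENNReal.ofReal_add (by positivity) h]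
    exact (ENNReal.ofReal_le_ofReal h1).trans le_self_add
  · rw [ENNReal.ofReal_of_nonpos h, add_zero, ← ENNReal.ofReal_add (by positivity) (neg_nonneg.2 h)]
    exact ENNReal.ofReal_le_ofReal (by linarith)

theorem lintegral_exp_linear_lt_top {δ : ℝ} (hδ : 0 < δ) (a b : ℝ) :
    ∫⁻ s in Set.Ioi (0 : ℝ), ENNReal.ofReal (Real.exp (-δ * s) * (a + b * s)) < ⊤ := by
  have h1 : IntegrableOn (fun s : ℝ => Real.exp (-δ * s)) (Set.Ioi 0) :=
    integrableOn_exp_mul_Ioi (by linarith) 0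
  have h2 : IntegrableOn (fun s : ℝ => s ^ (1 : ℝ) * Real.exp (-δ * s)) (Set.Ioi 0) :=
    (integrableOn_rpow_mul_exp_neg_mul_rpow (p := 1) (s := 1) (by norm_num) (by norm_num)
      hδ).congr_fun (fun s _ => by simp) measurableSet_Ioi
  have h3 : IntegrableOn (fun s : ℝ => Real.exp (-δ * s) * (a + b * s)) (Set.Ioi 0) :=
    IntegrableOn.congr_fun ((h1.const_mul a).add (h2.const_mul b))
      (fun s _ => by simp only [Pi.add_apply, Real.rpow_one]; ring) measurableSet_Ioi
  exact h3.lintegral_lt_top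

namespace Strategy

variable {M} (π : M.Strategy)

open scoped Classical in
-- Integrate `path_lintegral_le`. By compensation the expected values before and after claims become
-- time integrals, and the generator inequality yields E[A + GP] ≤ E[B + GN]. The latter is finite
-- thanks to discounting and linear growth, so it cancels.
theorem value_le (hm : 1 ≤ m) {v dv : ℝ → ℝ} (hv : SlopeFunction v dv) {C : ℝ}
    (hC : ∀ z, 0 ≤ z → v z ≤ z + C ∧ dv z ≤ C)
    (hgen : ∀ R, M.IsContract R → ∀ z : ℝ≥0, M.generator R (fun y : ℝ≥0 => v y) (dv z) z ≤ 0)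
    (x : ℝ≥0) : π.value x ≤ ENNReal.ofReal (v x) := by
  set B : Scenario m n → ℝ≥0∞ := fun ω => ∑' e : Fin m × ℕ,
    if π.Alive x (eventTime e.1 e.2 ω) ω then π.preValue v x (eventTime e.1 e.2 ω) ω else 0 with hB
  set A : Scenario m n → ℝ≥0∞ := fun ω => ∑' e : Fin m × ℕ,
    if π.Alive x (eventTime e.1 e.2 ω) ω then
      π.postValue v x (eventTime e.1 e.2 ω) (π.claimSize e ω) ω else 0 with hA
  set GN : Scenario m n → ℝ≥0∞ := fun ω => ∫⁻ r in Set.Ioi (0 : ℝ),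
    if π.Alive x r.toNNReal ω then ENNReal.ofReal (-π.valueDrift v dv x ω r) else 0 with hGN
  set GP : Scenario m n → ℝ≥0∞ := fun ω => ∫⁻ r in Set.Ioi (0 : ℝ),
    if π.Alive x r.toNNReal ω then ENNReal.ofReal (π.valueDrift v dv x ω r) else 0 with hGP
  -- measurability
  have hmv := hv.continuous.measurable
  have mY : Measurable fun q : ℝ × Scenario m n => π.preSurplus x q.1.toNNReal q.2 :=
    (π.measurable_preSurplus x).comp (f := fun q : ℝ × Scenario m n => (q.1.toNNReal, q.2))
      (by fun_prop)
  have mAl : MeasurableSet {q : ℝ × Scenario m n | π.Alive x q.1.toNNReal q.2} :=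
    (π.measurableSet_alive x).preimage
      (f := fun q : ℝ × Scenario m n => (q.1.toNNReal, q.2)) (by fun_prop)
  have mE : Measurable fun q : ℝ × Scenario m n => Real.exp (-M.δ * q.1) := by fun_prop
  have mD : Measurable fun q : ℝ × Scenario m n => π.valueDrift v dv x q.2 q.1 :=
    ((mE.mul (hv.continuous_deriv.measurable.comp mY)).mul π.measurable_premiumRate).sub
      ((mE.const_mul M.δ).mul (hmv.comp mY))
  have mpre : Measurable fun q : ℝ≥0 × Scenario m n => π.preValue v x q.1 q.2 :=
    ENNReal.measurable_ofReal.comp (Measurable.mul (by fun_prop)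
      (hmv.comp (π.measurable_preSurplus x)))
  have mGN2 : Measurable fun q : ℝ × Scenario m n =>
      if π.Alive x q.1.toNNReal q.2 then ENNReal.ofReal (-π.valueDrift v dv x q.2 q.1) else 0 :=
    Measurable.ite mAl mD.neg.ennreal_ofReal measurable_const
  have mGN : Measurable GN := Measurable.lintegral_prod_left' mGN2
  have mGP : Measurable GP := Measurable.lintegral_prod_left' (f := fun q : ℝ × Scenario m n =>
      if π.Alive x q.1.toNNReal q.2 then ENNReal.ofReal (π.valueDrift v dv x q.2 q.1) else 0)
    (Measurable.ite mAl mD.ennreal_ofReal measurable_const)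
  have mBh : Measurable fun q : ℝ≥0 × ((Fin n → Bool) × (Fin n → ℝ≥0)) × Scenario m n =>
      if π.Alive x q.1 q.2.2 then π.preValue v x q.1 q.2.2 else 0 :=
    (Measurable.ite (π.measurableSet_alive x) mpre measurable_const).comp
      (f := fun q : ℝ≥0 × ((Fin n → Bool) × (Fin n → ℝ≥0)) × Scenario m n => (q.1, q.2.2))
      (by fun_prop)
  have mAh : Measurable fun q : ℝ≥0 × ((Fin n → Bool) × (Fin n → ℝ≥0)) × Scenario m n =>
      if π.Alive x q.1 q.2.2 then
        π.postValue v x q.1 (retained (π.contract q.1 q.2.2) q.2.1) q.2.2 else 0 := by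
    refine Measurable.ite ((π.measurableSet_alive x).preimage
      (f := fun q : ℝ≥0 × ((Fin n → Bool) × (Fin n → ℝ≥0)) × Scenario m n => (q.1, q.2.2))
      (by fun_prop)) (ENNReal.measurable_ofReal.comp (Measurable.mul (by fun_prop)
        ((measurable_killed hmv).comp (Measurable.sub ?_ ?_)))) measurable_const
    · exact (π.measurable_preSurplus x).comp
        (f := fun q : ℝ≥0 × ((Fin n → Bool) × (Fin n → ℝ≥0)) × Scenario m n => (q.1, q.2.2))
        (by fun_prop)
    · exact (π.measurable_contract_retained.comp
        (f := fun q : ℝ≥0 × ((Fin n → Bool) × (Fin n → ℝ≥0)) × Scenario m n =>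
          ((q.1, q.2.2), q.2.1)) (by fun_prop)).coe_nnreal_real
  -- compensation
  have eB := M.lintegral_all_events (h := fun s _ ω =>
    if π.Alive x s ω then π.preValue v x s ω else 0) mBh (by
      intro y k i s ω a h₁ h₂
      simp only [π.alive_update x h₁ h₂, preValue, π.eventPredictable_preSurplus x k i s ω a h₁ h₂])
  have eA := M.lintegral_all_events (h := fun s y ω =>
    if π.Alive x s ω then π.postValue v x s (retained (π.contract s ω) y) ω else 0) mAh (by
      intro y k i s ω a h₁ h₂
      simp only [π.alive_update x h₁ h₂, postValue, π.eventPredictable_preSurplus x k i s ω a h₁ h₂,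
        π.contract_update h₁ h₂ le_rfl])
  have sB : ∀ (s : ℝ) ω, ∑ k, ENNReal.ofReal (M.β k) * ∫⁻ _, (if π.Alive x s.toNNReal ω then
      π.preValue v x s.toNNReal ω else 0) ∂(M.hitLaw k) =
      if π.Alive x s.toNNReal ω then
        ENNReal.ofReal M.totalRate * π.preValue v x s.toNNReal ω else 0 := by
    intro s ω
    rw [M.ofReal_totalRate, Finset.sum_mul]
    split_ifs <;> simp
  have sA : ∀ (s : ℝ) ω, ∑ k, ENNReal.ofReal (M.β k) * ∫⁻ y, (if π.Alive x s.toNNReal ω then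
      π.postValue v x s.toNNReal (retained (π.contract s.toNNReal ω) y) ω else 0) ∂(M.hitLaw k) =
      if π.Alive x s.toNNReal ω then ENNReal.ofReal M.totalRate *
        ∫⁻ a, π.postValue v x s.toNNReal a ω ∂(M.claimLaw (π.contract s.toNNReal ω)) else 0 := by
    intro s ω
    split_ifs with h
    · rw [M.rate_mul_lintegral_claimLaw hm (π.isContract _ _).measurable
        (f := fun a => π.postValue v x s.toNNReal a ω)]
      refine ENNReal.measurable_ofReal.comp (Measurable.const_mul
        ((measurable_killed hmv).comp (by fun_prop)) _)
    · simp
  simp_rw [sB] at eB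
  simp_rw [sA] at eA
  have mBk : ∀ ω, Measurable fun s : ℝ => if π.Alive x s.toNNReal ω then
        ENNReal.ofReal M.totalRate * π.preValue v x s.toNNReal ω else 0 := fun ω => by
    have : Measurable fun q : ℝ≥0 × Scenario m n => if π.Alive x q.1 q.2 then
        ENNReal.ofReal M.totalRate * π.preValue v x q.1 q.2 else 0 :=
      Measurable.ite (π.measurableSet_alive x) (mpre.const_mul _) measurable_const
    exact this.comp (f := fun s : ℝ => (s.toNNReal, ω)) (by fun_prop)
  have mB2 : Measurable B := by
    refine Measurable.tsum fun e => ?_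
    exact mBh.comp (f := fun ω : Scenario m n => (eventTime e.1 e.2 ω, (ω e).2, ω)) (by fun_prop)
  have mG1 : ∀ ω, Measurable fun s : ℝ => if π.Alive x s.toNNReal ω then
      ENNReal.ofReal (-π.valueDrift v dv x ω s) else 0 := fun ω =>
    mGN2.comp (f := fun s : ℝ => (s, ω)) (by fun_prop)
  have mG2 : ∀ ω, Measurable fun s : ℝ => if π.Alive x s.toNNReal ω then
      ENNReal.ofReal (π.valueDrift v dv x ω s) else 0 := fun ω =>
    (Measurable.ite mAl mD.ennreal_ofReal measurable_const).comp
      (f := fun s : ℝ => (s, ω)) (by fun_prop)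
  -- comparison of the expectations
  have hXY : (∫⁻ ω, A ω ∂M.prob) + ∫⁻ ω, GP ω ∂M.prob ≤ (∫⁻ ω, B ω ∂M.prob) + ∫⁻ ω, GN ω ∂M.prob := by
    rw [show (∫⁻ ω, A ω ∂M.prob) = _ from eA, show (∫⁻ ω, B ω ∂M.prob) = _ from eB,
      ← lintegral_add_right _ mGP, ← lintegral_add_right _ mGN]
    refine lintegral_mono_ae ?_
    filter_upwards [M.ae_regularEvents] with ω hω
    rw [hGP, hGN, ← lintegral_add_right _ (mG2 ω), ← lintegral_add_right _ (mG1 ω)]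
    refine setLIntegral_mono' measurableSet_Ioi fun s hs => ?_
    split_ifs with h
    · have hY := π.preSurplus_nonneg hm hω.nonExplosive ((π.alive_iff hm x _ ω).1 h)
      have hs0 : (0 : ℝ) ≤ s := (show (0 : ℝ) < s from hs).le
      have hco : ((π.preSurplus x s.toNNReal ω).toNNReal : ℝ) = π.preSurplus x s.toNNReal ω :=
        Real.coe_toNNReal _ hY
      have := M.jump_add_drift_le hm hv (π.isContract s.toNNReal ω)
        (hgen _ (π.isContract s.toNNReal ω) (π.preSurplus x s.toNNReal ω).toNNReal)
        (Real.exp_pos (-M.δ * s)).le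
      rw [hco] at this
      simpa only [preValue, postValue, valueDrift, PathData.drift, premiumRate,
        Real.coe_toNNReal s hs0] using this
    · simp
  -- finiteness
  have hfin : (∫⁻ ω, B ω ∂M.prob) + ∫⁻ ω, GN ω ∂M.prob < ⊤ := by
    have hK := M.premiumBound_nonneg hm
    have hβ := M.totalRate_pos hm
    set K := M.premiumBound
    -- Before ruin the surplus is at most x + K s, so v is at most x + K s + C along the path; c1
    -- and c2 collect the constant and linear parts of the resulting bound for B and GN.
    set c1 : ℝ := M.totalRate * (x + C) + (C * K + M.δ * (x + C)) with hc1
    set c2 : ℝ := M.totalRate * K + M.δ * K with hc2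
    rw [show (∫⁻ ω, B ω ∂M.prob) = _ from eB, ← lintegral_add_right _ mGN]
    refine lt_of_le_of_lt (b := ∫⁻ _, (∫⁻ s in Set.Ioi (0 : ℝ),
      ENNReal.ofReal (Real.exp (-M.δ * s) * (c1 + c2 * s))) ∂M.prob) ?_ ?_
    · refine lintegral_mono_ae ?_
      filter_upwards [M.ae_regularEvents] with ω hω
      rw [hGN, ← lintegral_add_right _ (mG1 ω)]
      refine setLIntegral_mono' measurableSet_Ioi fun s hs => ?_
      split_ifs with h
      · have hs0 : (0 : ℝ) ≤ s := (show (0 : ℝ) < s from hs).le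
        have hY := π.preSurplus_nonneg hm hω.nonExplosive ((π.alive_iff hm x _ ω).1 h)
        have hY2 := π.preSurplus_le hm x s.toNNReal ω
        rw [Real.coe_toNNReal s hs0] at hY2
        obtain ⟨hC1, hC2⟩ := hC _ hY
        have hp := (π.pathData hm ω).bound s
        have hdv := hv.one_le _ hY
        have hv0 := hv.nonneg _ hY
        have he := Real.exp_pos (-M.δ * s)
        have hdp : -(dv (π.preSurplus x s.toNNReal ω) * π.premiumRate ω s) ≤ C * K := by
          have h1 : -(π.premiumRate ω s) ≤ K := (neg_le_abs _).trans hp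
          nlinarith
        rw [preValue, ← ENNReal.ofReal_mul hβ.le, Real.coe_toNNReal s hs0, valueDrift, PathData.drift]
        have hvY : v (π.preSurplus x s.toNNReal ω) ≤ x + K * s + C := by linarith
        have hneg : -(Real.exp (-M.δ * s) * dv (π.preSurplus x s.toNNReal ω) * π.premiumRate ω s -
            M.δ * Real.exp (-M.δ * s) * v (π.preSurplus x s.toNNReal ω)) ≤
            Real.exp (-M.δ * s) * (C * K + M.δ * (x + K * s + C)) := by
          have h1 := mul_le_mul_of_nonneg_left hdp he.le
          have h2 := mul_le_mul_of_nonneg_left (mul_le_mul_of_nonneg_left hvY M.δ_pos.le) he.le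
          linarith
        have hC0 : 0 ≤ C := by linarith
        have hδ := M.δ_pos
        have hsum : 0 ≤ Real.exp (-M.δ * s) * (C * K + M.δ * (x + K * s + C)) := by positivity
        refine (add_le_add (ENNReal.ofReal_le_ofReal (q := M.totalRate *
          (Real.exp (-M.δ * s) * (x + K * s + C))) (by gcongr))
          (ENNReal.ofReal_le_ofReal hneg)).trans ?_
        rw [← ENNReal.ofReal_add (by positivity) hsum]
        refine ENNReal.ofReal_le_ofReal (le_of_eq ?_)
        rw [hc1, hc2]; ring
      · simp
    · rw [lintegral_const, measure_univ, mul_one]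
      exact lintegral_exp_linear_lt_top M.δ_pos _ _
  have hmain : π.value x + ((∫⁻ ω, B ω ∂M.prob) + ∫⁻ ω, GN ω ∂M.prob) ≤
      ENNReal.ofReal (v x) + ((∫⁻ ω, A ω ∂M.prob) + ∫⁻ ω, GP ω ∂M.prob) := by
    have h1 : ENNReal.ofReal (v x) = ∫⁻ _, ENNReal.ofReal (v x) ∂M.prob := by simp
    rw [value, h1, ← lintegral_add_right _ mGN, ← lintegral_add_right _ mGP,
      ← lintegral_add_right _ (show Measurable fun ω => B ω + GN ω from mB2.add mGN),
      ← lintegral_add_left measurable_const]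
    refine lintegral_mono_ae ?_
    filter_upwards [M.ae_regularEvents] with ω hω
    exact π.path_lintegral_le hm hv hω x
  have := hmain.trans (add_le_add le_rfl hXY)
  -- Finiteness of the common term is what permits its cancellation in extended nonnegative numbers.
  exact (ENNReal.add_le_add_iff_right hfin.ne).1 this

end Strategy
end RiskModel

/-! ### One-sided differentials and the class L -/

/-- Extension of a function on `[0, ∞)` to the real line. -/
def extendReal (u : ℝ≥0 → ℝ) (s : ℝ) : ℝ := u s.toNNReal

theorem extendReal_coe (u : ℝ≥0 → ℝ) (x : ℝ≥0) : extendReal u x = u x := by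
  rw [extendReal, Real.toNNReal_coe]

section Differentials

variable {u v : ℝ≥0 → ℝ} {x : ℝ≥0}

theorem nhdsLT_neBot_nnreal (hx : 0 < x) : (𝓝[<] x).NeBot := nhdsLT_neBot_of_exists_lt ⟨0, hx⟩

theorem tendsto_diffQuot {φ : ℝ → ℝ} {d : ℝ} {s : Set ℝ≥0} {t : Set ℝ}
    (h : HasDerivWithinAt φ d t x) (hst : ∀ y ∈ s, (y : ℝ) ∈ t ∧ (y : ℝ) ≠ x) :
    Tendsto (diffQuot (fun y => φ y) x) (𝓝[s] x) (𝓝 (d : EReal)) := by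
  have h1 := hasDerivWithinAt_iff_tendsto_slope.1 h
  have h2 : Tendsto (fun y : ℝ≥0 => (y : ℝ)) (𝓝[s] x) (𝓝[t \ {(x : ℝ)}] (x : ℝ)) :=
    tendsto_nhdsWithin_iff.2 ⟨NNReal.continuous_coe.continuousAt.tendsto.mono_left
      nhdsWithin_le_nhds, eventually_mem_nhdsWithin.mono fun y hy => hst y hy⟩
  refine ((continuous_coe_real_ereal.tendsto d).comp (h1.comp h2)).congr fun y => ?_
  simp only [Function.comp_apply, diffQuot, slope_def_field]

theorem mem_diffs_of_hasDerivAt (hx : 0 < x) {d : ℝ} (h : HasDerivAt (extendReal u) d x) :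
    d ∈ subDiff u x := by
  have := nhdsLT_neBot_nnreal hx
  have hu : (fun y : ℝ≥0 => extendReal u y) = u := funext (extendReal_coe u)
  have h1 := tendsto_diffQuot (s := Set.Ioi x) h.hasDerivWithinAt (t := Set.univ)
    fun y hy => ⟨trivial, by exact_mod_cast (ne_of_gt hy)⟩
  have h2 := tendsto_diffQuot (s := Set.Iio x) h.hasDerivWithinAt (t := Set.univ)
    fun y hy => ⟨trivial, by exact_mod_cast (ne_of_lt hy)⟩
  rw [hu] at h1 h2
  exact ⟨h1.liminf_eq.ge, h2.limsup_eq.le⟩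

theorem diffQuot_le_of_gt (hx : u x = v x) {y : ℝ≥0} (hy : x < y) (h : u y ≤ v y) :
    diffQuot u x y ≤ diffQuot v x y := by
  unfold diffQuot
  rw [EReal.coe_le_coe_iff, hx]
  have : (0 : ℝ) < y - x := sub_pos.2 (by exact_mod_cast hy)
  gcongr

theorem diffQuot_le_of_lt (hx : u x = v x) {y : ℝ≥0} (hy : y < x) (h : u y ≤ v y) :
    diffQuot v x y ≤ diffQuot u x y := by
  unfold diffQuot
  rw [EReal.coe_le_coe_iff, hx]
  have : ((y : ℝ) - x) < 0 := sub_neg.2 (by exact_mod_cast hy)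
  exact div_le_div_of_nonpos_of_le this.le (by linarith)

/-- If u touches v from below at x, difference quotients are ordered one way on the right and the
other way on the left, which is what both defining inequalities need. -/
theorem subDiff_subset (hx : u x = v x) (h : ∀ᶠ y in 𝓝 x, u y ≤ v y) :
    subDiff u x ⊆ subDiff v x := by
  rintro d ⟨h1, h2⟩
  refine ⟨h1.trans (liminf_le_liminf ?_), le_trans (limsup_le_limsup ?_) h2⟩
  · filter_upwards [self_mem_nhdsWithin, nhdsWithin_le_nhds h] with y hy hy'
    exact diffQuot_le_of_gt hx hy hy'
  · filter_upwards [self_mem_nhdsWithin, nhdsWithin_le_nhds h] with y hy hy'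
    exact diffQuot_le_of_lt hx hy hy'

/-- A smooth function touching from above. -/
theorem mem_superDiff_of_touching (hx : 0 < x) {φ : ℝ → ℝ} {d : ℝ} (hφ : HasDerivAt φ d x)
    (h0 : u x = φ x) (h : ∀ y, u y ≤ φ y) : d ∈ superDiff u x := by
  have := nhdsLT_neBot_nnreal hx
  have h1 := tendsto_diffQuot (s := Set.Ioi x) hφ.hasDerivWithinAt (t := Set.univ)
    fun y hy => ⟨trivial, by exact_mod_cast (ne_of_gt hy)⟩
  have h2 := tendsto_diffQuot (s := Set.Iio x) hφ.hasDerivWithinAt (t := Set.univ)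
    fun y hy => ⟨trivial, by exact_mod_cast (ne_of_lt hy)⟩
  refine ⟨h2.liminf_eq.ge.trans (liminf_le_liminf ?_), le_trans (limsup_le_limsup ?_) h1.limsup_eq.le⟩
  · filter_upwards [self_mem_nhdsWithin] with y hy
    exact diffQuot_le_of_lt h0 hy (h y)
  · filter_upwards [self_mem_nhdsWithin] with y hy
    exact diffQuot_le_of_gt h0 hy (h y)

/-- Bounds for subdifferentials at points touched from above by a function with one-sided
Lipschitz bounds. -/
theorem le_of_mem_subDiff {d C : ℝ} (hd : d ∈ subDiff u x)
    (h : ∀ᶠ y in 𝓝[>] x, u y - u x ≤ C * ((y : ℝ) - x)) : d ≤ C := by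
  have h1 : liminf (diffQuot u x) (𝓝[>] x) ≤ (C : EReal) := by
    refine (liminf_le_limsup).trans (limsup_le_of_le (h := ?_))
    filter_upwards [h, self_mem_nhdsWithin] with y hy hxy
    have : (0 : ℝ) < y - x := sub_pos.2 (by exact_mod_cast hxy)
    unfold diffQuot
    rw [EReal.coe_le_coe_iff, div_le_iff₀ this]
    exact hy
  exact_mod_cast hd.1.trans h1

theorem ge_of_mem_subDiff (hx : 0 < x) {d C : ℝ} (hd : d ∈ subDiff u x)
    (h : ∀ᶠ y in 𝓝[<] x, C * ((x : ℝ) - y) ≤ u x - u y) : C ≤ d := by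
  have := nhdsLT_neBot_nnreal hx
  have h1 : (C : EReal) ≤ limsup (diffQuot u x) (𝓝[<] x) := by
    refine (le_liminf_of_le (h := ?_)).trans liminf_le_limsup
    filter_upwards [h, self_mem_nhdsWithin] with y hy hxy
    have : ((y : ℝ) - x) < 0 := sub_neg.2 (by exact_mod_cast hxy)
    unfold diffQuot
    rw [EReal.coe_le_coe_iff, le_div_iff_of_neg this]
    linarith
  exact_mod_cast h1.trans hd.2

end Differentials

namespace RiskModel

variable {m n : ℕ} {M : RiskModel m n}

theorem hjb_nonpos_iff {u : ℝ≥0 → ℝ} {d : ℝ} {x : ℝ≥0} : M.hjb u d x ≤ 0 ↔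
    1 ≤ d ∧ ∀ R, M.IsContract R → M.generator R u d x ≤ 0 := by
  rw [hjb, max_le_iff, iSup₂_le_iff]
  refine and_congr ?_ (forall₂_congr fun R _ => ?_)
  · rw [← EReal.coe_zero, EReal.coe_le_coe_iff, sub_nonpos]
  · rw [← EReal.coe_zero, EReal.coe_le_coe_iff]

end RiskModel

namespace ClassL

variable {u : ℝ≥0 → ℝ}

theorem add_le (hu : ClassL u) {x y : ℝ≥0} (h : x ≤ y) : u x + ((y : ℝ) - x) ≤ u y := by
  rcases h.eq_or_lt with rfl | h
  · simp
  · linarith [hu.increment x y h]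

theorem monotone (hu : ClassL u) : Monotone u := fun x y h => by
  have := hu.add_le h
  have h' : (x : ℝ) ≤ y := by exact_mod_cast h
  linarith

theorem continuous (hu : ClassL u) : Continuous u := hu.locallyLipschitz.continuous

theorem continuous_extendReal (hu : ClassL u) : Continuous (extendReal u) :=
  hu.continuous.comp continuous_real_toNNReal

theorem extendReal_mono (hu : ClassL u) : Monotone (extendReal u) := fun _ _ h =>
  hu.monotone (Real.toNNReal_le_toNNReal h)

theorem locallyLipschitz_extendReal (hu : ClassL u) : LocallyLipschitz (extendReal u) :=
  hu.locallyLipschitz.comp Real.lipschitzWith_toNNReal.locallyLipschitz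

end ClassL

/-! ### Smoothing supersolutions by forward averages -/

/-- Forward averages of a function. -/
def forwardMean (u : ℝ≥0 → ℝ) (ε z : ℝ) : ℝ := ε⁻¹ * ∫ s in z..(z + ε), extendReal u s

/-- The derivative of `forwardMean`. Averaging forward uses, for z ≥ 0, only values of u on the
original half-line. -/
def forwardSlope (u : ℝ≥0 → ℝ) (ε z : ℝ) : ℝ := ε⁻¹ * (extendReal u (z + ε) - extendReal u z)

namespace ClassL

variable {u : ℝ≥0 → ℝ}

theorem hasDerivAt_forwardMean (hu : ClassL u) (ε z : ℝ) :
    HasDerivAt (forwardMean u ε) (forwardSlope u ε z) z := by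
  have hc := hu.continuous_extendReal
  have h1 : ∀ b, HasDerivAt (fun b => ∫ s in (0 : ℝ)..b, extendReal u s) (extendReal u b) b :=
    fun b => hc.integral_hasStrictDerivAt 0 b |>.hasDerivAt
  have h2 : HasDerivAt (fun z => ∫ s in (0 : ℝ)..(z + ε), extendReal u s)
      (extendReal u (z + ε)) z := HasDerivAt.comp_add_const z ε (h1 (z + ε))
  have h3 := (h2.sub (h1 z)).const_mul ε⁻¹
  refine h3.congr_of_eventuallyEq (Eventually.of_forall fun y => ?_)
  simp only [forwardMean, Pi.sub_apply]
  rw [intervalIntegral.integral_interval_sub_left] <;> exact hc.intervalIntegrable _ _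

theorem one_le_forwardSlope (hu : ClassL u) {ε z : ℝ} (hε : 0 < ε) (hz : 0 ≤ z) :
    1 ≤ forwardSlope u ε z := by
  lift z to ℝ≥0 using hz
  lift ε to ℝ≥0 using hε.le
  have := hu.add_le (x := z) (y := z + ε) le_self_add
  rw [forwardSlope, ← NNReal.coe_add, extendReal_coe, extendReal_coe, inv_mul_eq_div,
    le_div_iff₀ hε]
  push_cast at this
  linarith

theorem le_forwardMean (hu : ClassL u) {ε z : ℝ} (hε : 0 < ε) :
    extendReal u z ≤ forwardMean u ε z := by
  rw [forwardMean, inv_mul_eq_div, le_div_iff₀ hε]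
  have := intervalIntegral.integral_mono_on (a := z) (b := z + ε) (by linarith)
    (f := fun _ => extendReal u z) (g := extendReal u) (intervalIntegrable_const (μ := volume))
    (hu.continuous_extendReal.intervalIntegrable _ _) fun s hs => hu.extendReal_mono hs.1
  rw [intervalIntegral.integral_const, smul_eq_mul] at this
  linarith

theorem forwardMean_le (hu : ClassL u) {ε z : ℝ} (hε : 0 < ε) :
    forwardMean u ε z ≤ extendReal u (z + ε) := by
  rw [forwardMean, inv_mul_eq_div, div_le_iff₀ hε]
  have := intervalIntegral.integral_mono_on (a := z) (b := z + ε) (by linarith)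
    (g := fun _ => extendReal u (z + ε)) (f := extendReal u)
    (hu.continuous_extendReal.intervalIntegrable _ _) (intervalIntegrable_const (μ := volume)) fun s hs => hu.extendReal_mono hs.2
  rw [intervalIntegral.integral_const, smul_eq_mul] at this
  linarith

theorem slopeFunction (hu : ClassL u) (h0 : 0 ≤ u 0) {ε : ℝ} (hε : 0 < ε) :
    SlopeFunction (forwardMean u ε) (forwardSlope u ε) := by
  refine ⟨hu.hasDerivAt_forwardMean ε, ?_, fun z => hu.one_le_forwardSlope hε, fun z _ => ?_⟩
  · have hc := hu.continuous_extendReal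
    unfold forwardSlope
    fun_prop
  · exact (h0.trans (hu.monotone zero_le)).trans (hu.le_forwardMean hε)

/-- Local Lipschitz continuity gives absolute continuity on compact intervals, so the almost
everywhere derivative integrates back to u. -/
theorem integral_deriv (hu : ClassL u) (a b : ℝ) :
    IntervalIntegrable (deriv (extendReal u)) volume a b ∧
      ∫ s in a..b, deriv (extendReal u) s = extendReal u b - extendReal u a := by
  obtain ⟨K, hK⟩ := LocallyLipschitzOn.exists_lipschitzOnWith_of_compact
    (isCompact_uIcc (a := a) (b := b)) hu.locallyLipschitz_extendReal.locallyLipschitzOn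
  have := hK.absolutelyContinuousOnInterval
  exact ⟨this.intervalIntegrable_deriv, this.integral_deriv_eq_sub⟩

theorem integrableOn_shift (hu : ClassL u) (G : Measure ℝ≥0) [IsFiniteMeasure G] (x : ℝ≥0) :
    IntegrableOn (fun a => u (x - a)) (Set.Iic x) G := by
  refine Measure.integrableOn_of_bounded (M := max |u 0| |u x|) (measure_ne_top _ _)
    (hu.continuous.comp (by fun_prop)).measurable.aestronglyMeasurable (ae_of_all _ fun a => ?_)
  exact abs_le_max_abs_abs (hu.monotone zero_le) (hu.monotone tsub_le_self)

end ClassL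

namespace RiskModel

variable {m n : ℕ} {M : RiskModel m n} {u : ℝ≥0 → ℝ}

/-- Functions in L are increasing, hence differentiable almost everywhere, and at a point of
differentiability the derivative lies in the subdifferential. -/
theorem IsViscositySuper.ae_generator_le (hs : M.IsViscositySuper u) (hu : ClassL u) :
    ∀ᵐ s : ℝ, 0 < s → 1 ≤ deriv (extendReal u) s ∧ ∀ R, M.IsContract R →
      M.generator R u (deriv (extendReal u) s) s.toNNReal ≤ 0 := by
  filter_upwards [hu.extendReal_mono.ae_differentiableAt] with s hd hs0
  have h1 : ((s.toNNReal : ℝ≥0) : ℝ) = s := Real.coe_toNNReal _ hs0.le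
  have h2 : HasDerivAt (extendReal u) (deriv (extendReal u) s) (s.toNNReal : ℝ) := by
    rw [h1]; exact hd.hasDerivAt
  have hpos : 0 < s.toNNReal := Real.toNNReal_pos.2 hs0
  exact hjb_nonpos_iff.1 (hs.2 _ hpos _ (mem_diffs_of_hasDerivAt hpos h2))

/-- Suppose u(0) < 0 and let R have nonnegative premium. Close to 0 the premium term is nonnegative,
the claim integral is at least u(0) since a subprobability multiplies a negative number, and (δ + β)
u < β u(0). So the generator is positive, a contradiction. -/
theorem IsViscositySuper.zero_nonneg (hm : 1 ≤ m)
    (hM : ∃ R : Fin n → ℝ≥0 → ℝ≥0, M.IsContract R ∧ 0 ≤ M.netPremium R)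
    (hs : M.IsViscositySuper u) (hu : ClassL u) : 0 ≤ u 0 := by
  obtain ⟨R, hR, hp⟩ := hM
  by_contra hneg
  push Not at hneg
  have hβ := M.totalRate_pos hm
  have hδ := M.δ_pos
  have hc : ContinuousAt (fun s => (M.δ + M.totalRate) * extendReal u s) 0 :=
    (hu.continuous_extendReal.const_mul _).continuousAt
  have h0 : extendReal u 0 = u 0 := by simp [extendReal]
  have hlt : ∀ᶠ s in 𝓝 (0 : ℝ), (M.δ + M.totalRate) * extendReal u s < M.totalRate * u 0 := by
    refine hc.eventually_lt_const ?_
    change (M.δ + M.totalRate) * extendReal u 0 < _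
    rw [h0]; nlinarith
  obtain ⟨r, hr, hr'⟩ := Metric.eventually_nhds_iff.1 hlt
  have hne : (ae (volume.restrict (Set.Ioo 0 r))).NeBot := by
    rw [ae_neBot, Ne, Measure.restrict_eq_zero]
    simp [hr]
  have hae : ∀ᵐ s ∂(volume.restrict (Set.Ioo 0 r)), 0 < s ∧ s < r ∧ 0 ≤ deriv (extendReal u) s ∧
      M.generator R u (deriv (extendReal u) s) s.toNNReal ≤ 0 := by
    filter_upwards [ae_restrict_mem measurableSet_Ioo,
      ae_restrict_of_ae (hs.ae_generator_le hu)] with s hs1 hs2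
    exact ⟨hs1.1, hs1.2, zero_le_one.trans (hs2 hs1.1).1, (hs2 hs1.1).2 R hR⟩
  obtain ⟨s, hs0, hsr, hd, hgen⟩ := hae.exists
  have hlt' := hr' (show dist s 0 < r by rw [Real.dist_0_eq_abs, abs_of_pos hs0]; exact hsr)
  have := M.isProbabilityMeasure_claimLaw hm hR.measurable
  have hint : u 0 ≤ ∫ a in Set.Iic s.toNNReal, u (s.toNNReal - a) ∂(M.claimLaw R) := by
    have h1 : ∫ a in Set.Iic s.toNNReal, u 0 ∂(M.claimLaw R) ≤
        ∫ a in Set.Iic s.toNNReal, u (s.toNNReal - a) ∂(M.claimLaw R) :=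
      setIntegral_mono_on (integrableOn_const (measure_ne_top _ _)) (hu.integrableOn_shift _ _)
        measurableSet_Iic fun a _ => hu.monotone zero_le
    rw [setIntegral_const, smul_eq_mul] at h1
    have h2 : (M.claimLaw R).real (Set.Iic s.toNNReal) ≤ 1 := measureReal_le_one
    nlinarith
  rw [generator] at hgen
  have h3 := mul_nonneg hp hd
  have h4 := mul_le_mul_of_nonneg_left hint hβ.le
  rw [extendReal] at hlt'
  linarith

/-- The generator is linear in the function, so the almost everywhere inequality may be averaged
over (z, z + ε). Fubini turns the averaged claim integral into that of the average, up to the range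
of claims. -/
theorem IsViscositySuper.generator_forwardMean_le (hm : 1 ≤ m) (hs : M.IsViscositySuper u)
    (hu : ClassL u) (h0 : 0 ≤ u 0) {ε : ℝ} (hε : 0 < ε) {R : Fin n → ℝ≥0 → ℝ≥0}
    (hR : M.IsContract R) (z : ℝ≥0) :
    M.generator R (fun y : ℝ≥0 => forwardMean u ε y) (forwardSlope u ε z) z ≤ 0 := by
  have hG := M.isProbabilityMeasure_claimLaw hm hR.measurable
  have hβ := M.totalRate_pos hm
  set G := M.claimLaw R with hGdef
  have hc := hu.continuous_extendReal
  have hnn : ∀ s, 0 ≤ extendReal u s := fun s => h0.trans (hu.monotone zero_le)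
  let F : ℝ → ℝ≥0 → ℝ := fun s a => extendReal u (s - a)
  have hFc : Continuous (Function.uncurry F) := hc.comp (by fun_prop)
  let I : ℝ → ℝ := fun s => ∫ a in Set.Iic z, F s a ∂G
  have hzε : (z : ℝ) ≤ z + ε := by linarith
  have hbd : ∀ s ∈ Set.Ioc (z : ℝ) (z + ε), ∀ a, ‖F s a‖ ≤ extendReal u (z + ε) := fun s hs a => by
    rw [Real.norm_of_nonneg (hnn _)]
    exact hu.extendReal_mono (by linarith [hs.2, NNReal.coe_nonneg a])
  have hFint : Integrable (Function.uncurry F)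
      ((volume.restrict (Set.Ioc (z : ℝ) (z + ε))).prod (G.restrict (Set.Iic z))) := by
    refine Integrable.of_bound hFc.measurable.aestronglyMeasurable (extendReal u (z + ε)) ?_
    rw [Measure.prod_restrict]
    filter_upwards [ae_restrict_mem (measurableSet_Ioc.prod measurableSet_Iic)] with q hq
    exact hbd q.1 hq.1 q.2
  have hIint : IntervalIntegrable I volume z (z + ε) := by
    rw [intervalIntegrable_iff_integrableOn_Ioc_of_le hzε]
    exact hFint.integral_prod_left
  have hswap : ∫ a in Set.Iic z, forwardMean u ε ((z - a : ℝ≥0) : ℝ) ∂G =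
      ε⁻¹ * ∫ s in (z : ℝ)..(z + ε), I s := by
    have h1 : ∀ a ∈ Set.Iic z, forwardMean u ε ((z - a : ℝ≥0) : ℝ) =
        ε⁻¹ * ∫ s in Set.Ioc (z : ℝ) (z + ε), F s a := by
      intro a ha
      rw [forwardMean, NNReal.coe_sub ha, ← intervalIntegral.integral_of_le hzε]
      simp only [F]
      rw [intervalIntegral.integral_comp_sub_right (fun s => extendReal u s) (a : ℝ)]
      congr 2
      ring
    rw [setIntegral_congr_fun measurableSet_Iic h1, integral_const_mul,
      intervalIntegral.integral_of_le hzε]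
    congr 1
    exact (integral_integral_swap hFint).symm
  obtain ⟨hdi, hde⟩ := hu.integral_deriv z (z + ε)
  have hineq : ∫ s in (z : ℝ)..(z + ε), (M.netPremium R * deriv (extendReal u) s -
      (M.δ + M.totalRate) * extendReal u s + M.totalRate * I s) ≤ 0 := by
    rw [intervalIntegral.integral_of_le hzε]
    refine integral_nonpos_of_ae ?_
    filter_upwards [ae_restrict_mem measurableSet_Ioc, ae_restrict_of_ae (hs.ae_generator_le hu)]
      with s hs1 hs2
    have hs0 : 0 < s := (NNReal.coe_nonneg z).trans_lt hs1.1
    have hgen := (hs2 hs0).2 R hR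
    have hzs : z ≤ s.toNNReal := (Real.le_toNNReal_iff_coe_le hs0.le).2 hs1.1.le
    -- At surplus s > z larger claims are survivable; since u ≥ 0, dropping those above z only
    -- decreases the integral. This is why forward averages have the right sign.
    have hI : I s ≤ ∫ a in Set.Iic s.toNNReal, u (s.toNNReal - a) ∂G := by
      have h1 : I s = ∫ a in Set.Iic z, u (s.toNNReal - a) ∂G := by
        refine setIntegral_congr_fun measurableSet_Iic fun a ha => ?_
        simp only [F, extendReal]
        rw [NNReal.sub_def, Real.coe_toNNReal s hs0.le]
      rw [h1]
      exact setIntegral_mono_set (hu.integrableOn_shift _ _)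
        (ae_of_all _ fun a => h0.trans (hu.monotone zero_le))
        (Set.Iic_subset_Iic.2 hzs).eventuallyLE
    have := mul_le_mul_of_nonneg_left hI hβ.le
    rw [generator] at hgen
    simp only [Pi.zero_apply]
    change _ * deriv (extendReal u) s - _ * extendReal u s + _ ≤ _
    have he : extendReal u s = u s.toNNReal := rfl
    rw [he]
    linarith
  rw [intervalIntegral.integral_add ((hdi.const_mul _).sub
    ((hc.intervalIntegrable _ _).const_mul _)) (hIint.const_mul _),
    intervalIntegral.integral_sub (hdi.const_mul _) ((hc.intervalIntegrable _ _).const_mul _),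
    intervalIntegral.integral_const_mul, intervalIntegral.integral_const_mul,
    intervalIntegral.integral_const_mul, hde] at hineq
  rw [generator, hswap, forwardSlope, forwardMean]
  have := mul_nonpos_of_nonneg_of_nonpos (inv_pos.2 hε).le hineq
  linarith

/-- Verification applied to the forward averages, which are at most u(x + ε), followed by ε → 0. -/
theorem Strategy.value_le_of_super (hm : 1 ≤ m)
    (hM : ∃ R : Fin n → ℝ≥0 → ℝ≥0, M.IsContract R ∧ 0 ≤ M.netPremium R)
    (hs : M.IsViscositySuper u) (hu : ClassL u) (π : M.Strategy) (x : ℝ≥0) :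
    π.value x ≤ ENNReal.ofReal (u x) := by
  have h0 := hs.zero_nonneg hm hM hu
  obtain ⟨k, hk0, hk⟩ := hu.growth
  have key : ∀ ε : ℝ, 0 < ε → π.value x ≤ ENNReal.ofReal (extendReal u (x + ε)) := by
    intro ε hε
    refine (π.value_le hm (hu.slopeFunction h0 hε) (C := max (ε + k) (ε⁻¹ * (ε + k)))
      (fun z hz => ?_) (fun R hR z => hs.generator_forwardMean_le hm hu h0 hε hR z) x).trans
      (ENNReal.ofReal_le_ofReal (hu.forwardMean_le hε))
    have h1 : extendReal u (z + ε) ≤ z + ε + k := by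
      have := hk (z + ε).toNNReal
      rwa [Real.coe_toNNReal _ (by linarith)] at this
    have h2 : z ≤ extendReal u z := by
      have := hu.add_le (zero_le (a := z.toNNReal))
      rw [Real.coe_toNNReal _ hz, NNReal.coe_zero] at this
      rw [extendReal]; linarith
    refine ⟨?_, ?_⟩
    · have := hu.forwardMean_le (z := z) hε
      have := le_max_left (ε + k) (ε⁻¹ * (ε + k))
      linarith
    · refine le_trans ?_ (le_max_right _ _)
      rw [forwardSlope]
      exact mul_le_mul_of_nonneg_left (by linarith) (inv_pos.2 hε).le
  have hlim : Tendsto (fun ε : ℝ => ENNReal.ofReal (extendReal u (x + ε))) (𝓝[>] 0)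
      (𝓝 (ENNReal.ofReal (u x))) := by
    have h1 : Continuous fun ε : ℝ => ENNReal.ofReal (extendReal u (x + ε)) :=
      ENNReal.continuous_ofReal.comp (hu.continuous_extendReal.comp (by fun_prop))
    have := h1.tendsto 0
    rw [add_zero, extendReal_coe] at this
    exact this.mono_left nhdsWithin_le_nhds
  exact ge_of_tendsto hlim (by filter_upwards [self_mem_nhdsWithin] with ε hε using key ε hε)

theorem optimalValue_le_of_super (hm : 1 ≤ m)
    (hM : ∃ R : Fin n → ℝ≥0 → ℝ≥0, M.IsContract R ∧ 0 ≤ M.netPremium R)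
    (hs : M.IsViscositySuper u) (hu : ClassL u) (x : ℝ≥0) :
    M.optimalValue x ≤ ENNReal.ofReal (u x) := iSup_le fun π => π.value_le_of_super hm hM hs hu x

/-- The function z + k satisfies the generator inequality once δ k dominates all premium rates,
since the expected value after a claim is at most z + k. -/
theorem exists_optimalValue_le (hm : 1 ≤ m) :
    ∃ k : ℝ, 0 < k ∧ ∀ x : ℝ≥0, M.optimalValue x ≤ ENNReal.ofReal (x + k) := by
  have hK := M.premiumBound_nonneg hm
  have hδ := M.δ_pos
  have hβ := M.totalRate_pos hm
  set k := M.premiumBound / M.δ + 1 with hk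
  have hk0 : 0 < k := by positivity
  have hkδ : M.premiumBound ≤ M.δ * k := by
    rw [hk, mul_add, mul_div_cancel₀ _ hδ.ne']; linarith
  refine ⟨k, hk0, fun x => iSup_le fun π => ?_⟩
  refine π.value_le hm (v := fun z => z + k) (dv := fun _ => 1) (C := k + 1)
    ⟨fun z => (hasDerivAt_id z).add_const k, continuous_const, fun _ _ => le_rfl,
      fun z hz => by positivity⟩ (fun z _ => ⟨by linarith, by linarith⟩) (fun R hR z => ?_) x
  have := M.isProbabilityMeasure_claimLaw hm hR.measurable
  have hp := (le_abs_self _).trans (M.abs_netPremium_le hm hR)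
  have hz := NNReal.coe_nonneg z
  have hint : ∫ a in Set.Iic z, (((z - a : ℝ≥0) : ℝ) + k) ∂(M.claimLaw R) ≤ z + k := by
    have h1 : ∫ a in Set.Iic z, (((z - a : ℝ≥0) : ℝ) + k) ∂(M.claimLaw R) ≤
        ∫ a in Set.Iic z, ((z : ℝ) + k) ∂(M.claimLaw R) := by
      refine integral_mono_of_nonneg (ae_of_all _ fun a => by positivity)
        (integrable_const _) (ae_of_all _ fun a => ?_)
      have : ((z - a : ℝ≥0) : ℝ) ≤ z := by exact_mod_cast tsub_le_self
      simp only; linarith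
    rw [setIntegral_const, smul_eq_mul] at h1
    have h2 : (M.claimLaw R).real (Set.Iic z) ≤ 1 := measureReal_le_one
    have h3 : (M.claimLaw R).real (Set.Iic z) * (z + k) ≤ 1 * (z + k) :=
      mul_le_mul_of_nonneg_right h2 (by linarith)
    linarith
  rw [generator]
  have := mul_le_mul_of_nonneg_left hint hβ.le
  nlinarith

end RiskModel

/-! ### Comparison of subsolutions with supersolutions -/

namespace RiskModel

variable {m n : ℕ} {M : RiskModel m n} {u v : ℝ≥0 → ℝ}

/-- Subsolutions in the class `L` lie below smooth supersolutions which dominate them at `0`. -/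
theorem IsViscositySub.le_mul_forwardMean (hm : 1 ≤ m) (hus : M.IsViscositySub u) (hu : ClassL u)
    (hvs : M.IsViscositySuper v) (hv : ClassL v) (h0 : 0 ≤ v 0) (hle : u 0 ≤ v 0)
    {γ ε : ℝ} (hγ : 1 < γ) (hε : 0 < ε) (x : ℝ≥0) : u x ≤ γ * forwardMean v ε x := by
  have hS := hv.slopeFunction h0 hε
  have hγ0 : 0 < γ := zero_lt_one.trans hγ
  by_contra hcon
  push Not at hcon
  obtain ⟨k, hk0, hk⟩ := hu.growth
  -- The factor γ > 1 serves two purposes: it makes f negative for large y, because u grows at most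
  -- like y + k and v at least like y, and it makes the slope of the test function strictly larger
  -- than one.
  let f : ℝ≥0 → ℝ := fun y => u y - γ * forwardMean v ε y
  have hfc : Continuous f := hu.continuous.sub
    ((hS.continuous.comp NNReal.continuous_coe).const_mul γ)
  have hvle : ∀ y : ℝ≥0, v y ≤ forwardMean v ε y := fun y => by
    have := hv.le_forwardMean (z := y) hε
    rwa [extendReal_coe] at this
  have hfx : 0 < f x := sub_pos.2 hcon
  -- the maximum is attained
  set B : ℝ≥0 := max x (k / (γ - 1)).toNNReal with hB
  have hout : ∀ y : ℝ≥0, B ≤ y → f y ≤ 0 := by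
    intro y hy
    have h1 := hk y
    have h2 := hv.add_le (zero_le (a := y))
    have h3 := hvle y
    rw [NNReal.coe_zero] at h2
    have h4 : k / (γ - 1) ≤ y :=
      (Real.le_coe_toNNReal _).trans (by exact_mod_cast (le_max_right _ _).trans hy)
    rw [div_le_iff₀ (by linarith)] at h4
    have h5 : γ * (y : ℝ) ≤ γ * forwardMean v ε y := mul_le_mul_of_nonneg_left (by linarith) hγ0.le
    simp only [f]
    linarith
  obtain ⟨z, hz, hmax⟩ := (isCompact_Icc (a := (0 : ℝ≥0)) (b := B)).exists_isMaxOn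
    ⟨x, zero_le, le_max_left _ _⟩ hfc.continuousOn
  have hfz : 0 < f z := hfx.trans_le (hmax (show x ∈ Set.Icc 0 B from ⟨zero_le, le_max_left _ _⟩))
  have hmax' : ∀ y, f y ≤ f z := by
    intro y
    rcases le_total y B with h | h
    · exact hmax ⟨zero_le, h⟩
    · exact (hout y h).trans hfz.le
  have hz0 : 0 < z := by
    rw [pos_iff_ne_zero]
    rintro rfl
    have h1 := hvle 0
    have : f 0 ≤ 0 := by
      simp only [f]
      nlinarith
    linarith
  have hφ : HasDerivAt (fun s => γ * forwardMean v ε s + f z) (γ * forwardSlope v ε z) z :=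
    ((hv.hasDerivAt_forwardMean ε z).const_mul γ).add_const _
  have hd := mem_superDiff_of_touching (u := u) hz0 hφ (by simp [f]) fun y => by
    have := hmax' y
    simp only [f] at this ⊢
    linarith
  have hjb := hus.2 z hz0 _ hd
  have hslope := hv.one_le_forwardSlope hε (NNReal.coe_nonneg z)
  have hδ := M.δ_pos
  have hβ := M.totalRate_pos hm
  -- The test function is γ times the average plus the constant f z. The first summand contributes a
  -- nonpositive generator; the constant contributes at most -δ f z, because at most all of its mass
  -- survives a claim. Both entries of the maximum are negative, contradicting the subsolution
  -- property.
  have hneg : M.hjb u (γ * forwardSlope v ε z) z ≤ ((max (1 - γ) (-(M.δ * f z)) : ℝ) : EReal) := by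
    rw [RiskModel.hjb]
    refine max_le ?_ (iSup₂_le fun R hR => ?_)
    · rw [EReal.coe_le_coe_iff]
      refine le_trans ?_ (le_max_left _ _)
      nlinarith
    · rw [EReal.coe_le_coe_iff]
      refine le_trans ?_ (le_max_right _ _)
      have := M.isProbabilityMeasure_claimLaw hm hR.measurable
      have hgen := hvs.generator_forwardMean_le hm hv h0 hε hR z
      rw [generator] at hgen ⊢
      have hcont : Continuous fun a : ℝ≥0 => forwardMean v ε ((z - a : ℝ≥0) : ℝ) :=
        hS.continuous.comp (by fun_prop)
      have hi1 : IntegrableOn (fun a : ℝ≥0 => forwardMean v ε ((z - a : ℝ≥0) : ℝ)) (Set.Iic z)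
          (M.claimLaw R) := by
        rw [← Set.Icc_bot]
        exact hcont.continuousOn.integrableOn_compact isCompact_Icc
      have hi2 : IntegrableOn (fun a : ℝ≥0 => γ * forwardMean v ε ((z - a : ℝ≥0) : ℝ) + f z)
          (Set.Iic z) (M.claimLaw R) :=
        (hi1.const_mul γ).add
          (integrableOn_const (measure_ne_top _ _))
      have hint : ∫ a in Set.Iic z, u (z - a) ∂(M.claimLaw R) ≤
          γ * (∫ a in Set.Iic z, forwardMean v ε ((z - a : ℝ≥0) : ℝ) ∂(M.claimLaw R)) + f z := by
        calc ∫ a in Set.Iic z, u (z - a) ∂(M.claimLaw R)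
            ≤ ∫ a in Set.Iic z, (γ * forwardMean v ε ((z - a : ℝ≥0) : ℝ) + f z) ∂(M.claimLaw R) := by
              refine setIntegral_mono_on (hu.integrableOn_shift _ _) hi2 measurableSet_Iic
                fun a _ => ?_
              have := hmax' (z - a)
              simp only [f] at this ⊢
              linarith
          _ = γ * (∫ a in Set.Iic z, forwardMean v ε ((z - a : ℝ≥0) : ℝ) ∂(M.claimLaw R)) +
              (M.claimLaw R).real (Set.Iic z) * f z := by
              rw [integral_add, integral_const_mul, setIntegral_const, smul_eq_mul]
              · exact hi1.const_mul γ
              · exact integrableOn_const (measure_ne_top _ _)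
          _ ≤ _ := by
              have h2 : (M.claimLaw R).real (Set.Iic z) ≤ 1 := measureReal_le_one
              nlinarith
      have huz : u z = γ * forwardMean v ε z + f z := by simp [f]
      rw [huz]
      have h1 := mul_le_mul_of_nonneg_left hint hβ.le
      have h2 := mul_le_mul_of_nonneg_left hgen hγ0.le
      linarith
  have h1 := hjb.trans hneg
  rw [← EReal.coe_zero, EReal.coe_le_coe_iff, le_max_iff] at h1
  rcases h1 with h1 | h1
  · linarith
  · have := mul_pos hδ hfz
    linarith

/-- Use the factor 1 + ε and the averaging length ε simultaneously, and let ε → 0. -/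
theorem IsViscositySub.le_of_super (hm : 1 ≤ m) (hus : M.IsViscositySub u) (hu : ClassL u)
    (hvs : M.IsViscositySuper v) (hv : ClassL v) (h0 : 0 ≤ v 0) (hle : u 0 ≤ v 0) (x : ℝ≥0) :
    u x ≤ v x := by
  have hc : Continuous fun ε : ℝ => (1 + ε) * extendReal v (x + ε) :=
    Continuous.mul (by fun_prop) (hv.continuous_extendReal.comp (by fun_prop))
  have hlim := (hc.tendsto 0).mono_left (nhdsWithin_le_nhds (s := Set.Ioi 0))
  rw [add_zero, add_zero, one_mul, extendReal_coe] at hlim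
  refine ge_of_tendsto hlim ?_
  filter_upwards [self_mem_nhdsWithin] with ε hε
  have hε' : (0 : ℝ) < ε := hε
  refine (hus.le_mul_forwardMean hm hu hvs hv h0 hle (γ := 1 + ε) (by linarith) hε' x).trans ?_
  exact mul_le_mul_of_nonneg_left (hv.forwardMean_le hε') (by linarith)

end RiskModel

/-! ### Semicontinuity in the contract and uniformity by compactness -/

namespace RiskModel

variable {m n : ℕ} (M : RiskModel m n)

/-- Law of the hits and severities of an event of unspecified class. -/
def eventLaw : Measure ((Fin n → Bool) × (Fin n → ℝ≥0)) :=
  ∑ k : Fin m, ENNReal.ofReal (M.β k / M.totalRate) • M.hitLaw k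

theorem isProbabilityMeasure_eventLaw (hm : 1 ≤ m) : IsProbabilityMeasure M.eventLaw := by
  constructor
  simp [eventLaw, M.sum_ofReal_rate hm]

/-- All retained claims are realized on one probability space independent of the contract, so
pointwise convergence of contracts becomes pointwise convergence of integrands. -/
theorem lintegral_claimLaw_eq_eventLaw {R : Fin n → ℝ≥0 → ℝ≥0} (hR : ∀ j, Measurable (R j))
    {f : ℝ≥0 → ℝ≥0∞} (hf : Measurable f) :
    ∫⁻ a, f a ∂(M.claimLaw R) = ∫⁻ y, f (retained R y) ∂M.eventLaw := by
  rw [M.lintegral_claimLaw hR hf, eventLaw, lintegral_finsetSum_measure]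
  simp only [lintegral_smul_measure, smul_eq_mul]

theorem IsContract.retained_le {M : RiskModel m n} {R : Fin n → ℝ≥0 → ℝ≥0} (hR : M.IsContract R)
    (y) : retained R y ≤ retained (fun _ => id) y := retained_mono (fun j a => hR.le j a) y

/-- Pointwise convergence of contracts implies convergence of the retained claims. -/
theorem tendsto_retained {R : ℕ → Fin n → ℝ≥0 → ℝ≥0} {S : Fin n → ℝ≥0 → ℝ≥0}
    (h : ∀ j a, Tendsto (fun i => R i j a) atTop (𝓝 (S j a))) (y) :
    Tendsto (fun i => retained (R i) y) atTop (𝓝 (retained S y)) := by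
  unfold retained
  refine tendsto_finsetSum _ fun j _ => ?_
  split_ifs
  exacts [h j _, tendsto_const_nhds]

theorem tendsto_netPremium {R : ℕ → Fin n → ℝ≥0 → ℝ≥0} {S : Fin n → ℝ≥0 → ℝ≥0}
    (hR : ∀ i, M.IsContract (R i)) (hS : M.IsContract S)
    (h : ∀ j a, Tendsto (fun i => R i j a) atTop (𝓝 (S j a))) :
    Tendsto (fun i => M.netPremium (R i)) atTop (𝓝 (M.netPremium S)) := by
  have hid : ∀ j : Fin n, Measurable ((fun _ => id : Fin n → ℝ≥0 → ℝ≥0) j) :=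
    fun _ => measurable_id
  have e : ∀ {R : Fin n → ℝ≥0 → ℝ≥0}, (∀ j, Measurable (R j)) → ∫ a, (a : ℝ) ∂(M.claimLaw R) =
      (∫⁻ y, (retained R y : ℝ≥0∞) ∂M.eventLaw).toReal := fun hR => by
    rw [M.integral_claimLaw_eq, M.lintegral_claimLaw_eq_eventLaw hR measurable_coe_nnreal_ennreal]
  have hfin : ∫⁻ y, (retained (fun _ => id) y : ℝ≥0∞) ∂M.eventLaw ≠ ⊤ := by
    rw [← M.lintegral_claimLaw_eq_eventLaw hid measurable_coe_nnreal_ennreal]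
    exact (M.lintegral_claimLaw_lt_top hid fun _ _ => le_rfl).ne
  have key : Tendsto (fun i => ∫⁻ y, (retained (R i) y : ℝ≥0∞) ∂M.eventLaw) atTop
      (𝓝 (∫⁻ y, (retained S y : ℝ≥0∞) ∂M.eventLaw)) := by
    refine tendsto_lintegral_of_dominated_convergence
      (fun y => (retained (fun _ => id) y : ℝ≥0∞)) (fun i =>
        (measurable_retained (hR i).measurable).coe_nnreal_ennreal)
      (fun i => ae_of_all _ fun y => ENNReal.coe_le_coe.2 ((hR i).retained_le y)) hfin
      (ae_of_all _ fun y => ENNReal.tendsto_coe.2 (tendsto_retained h y))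
  have hSfin : ∫⁻ y, (retained S y : ℝ≥0∞) ∂M.eventLaw ≠ ⊤ :=
    ne_top_of_le_ne_top hfin (lintegral_mono fun y => ENNReal.coe_le_coe.2 (hS.retained_le y))
  unfold netPremium reinsurancePremium
  simp only [e hS.measurable, fun i => e (hR i).measurable]
  exact ((((ENNReal.tendsto_toReal hSfin).comp key).const_sub _).const_mul _).const_sub _

/-- There are finitely many lines, so successive extraction of subsequences suffices. -/
theorem exists_subseq_contract (hc : ∀ j, IsSeqCompact (M.fam j)) {R : ℕ → Fin n → ℝ≥0 → ℝ≥0}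
    (hR : ∀ i, M.IsContract (R i)) :
    ∃ (S : Fin n → ℝ≥0 → ℝ≥0) (φ : ℕ → ℕ), M.IsContract S ∧ StrictMono φ ∧
      ∀ j a, Tendsto (fun i => R (φ i) j a) atTop (𝓝 (S j a)) := by
  classical
  have key : ∀ s : Finset (Fin n), ∃ φ : ℕ → ℕ, StrictMono φ ∧ ∀ j ∈ s, ∃ S ∈ M.fam j,
      ∀ a, Tendsto (fun i => R (φ i) j a) atTop (𝓝 (S a)) := by
    intro s
    induction s using Finset.induction_on with
    | empty => exact ⟨id, strictMono_id, by simp⟩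
    | insert j s _ ih =>
      obtain ⟨φ, hφ, h⟩ := ih
      obtain ⟨S, hS, ψ, hψ, hlim⟩ := hc j (x := fun i => R (φ i) j) fun i => hR (φ i) j
      refine ⟨φ ∘ ψ, hφ.comp hψ, fun j' hj' => ?_⟩
      rcases Finset.mem_insert.1 hj' with rfl | hj'
      · exact ⟨S, hS, fun a => (tendsto_pi_nhds.1 hlim a)⟩
      · obtain ⟨S', hS', h'⟩ := h j' hj'
        exact ⟨S', hS', fun a => (h' a).comp hψ.tendsto_atTop⟩
  obtain ⟨φ, hφ, h⟩ := key Finset.univ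
  choose! S hS hlim using h
  exact ⟨S, φ, fun j => hS j (Finset.mem_univ j), hφ, fun j a => hlim j (Finset.mem_univ j) a⟩

/-- The expected value after an event, as an integral of nonnegative functions. -/
theorem ofReal_setIntegral_claimLaw {u : ℝ≥0 → ℝ} (hu : ClassL u) (h0 : 0 ≤ u 0) (hm : 1 ≤ m)
    {R : Fin n → ℝ≥0 → ℝ≥0} (hR : ∀ j, Measurable (R j)) (x : ℝ≥0) :
    ENNReal.ofReal (∫ a in Set.Iic x, u (x - a) ∂(M.claimLaw R)) =
      ∫⁻ y, (Set.Iic x).indicator (fun a => ENNReal.ofReal (u (x - a))) (retained R y)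
        ∂M.eventLaw := by
  have := M.isProbabilityMeasure_claimLaw hm hR
  rw [← M.lintegral_claimLaw_eq_eventLaw hR, lintegral_indicator measurableSet_Iic,
    ofReal_integral_eq_lintegral_ofReal (hu.integrableOn_shift _ x)
      (ae_of_all _ fun a => h0.trans (hu.monotone zero_le))]
  exact Measurable.indicator (ENNReal.measurable_ofReal.comp
    (hu.continuous.comp (by fun_prop)).measurable) measurableSet_Iic

/-- Only upper semicontinuity is claimed: retained claims may approach the surplus from above and
kill the value before the limit. If the limiting claim exceeds x, the integrands vanish eventually;
otherwise continuity of u applies. The reverse Fatou lemma with the constant bound u(B) concludes.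
-/
theorem limsup_claims_le {u : ℝ≥0 → ℝ} (hu : ClassL u) (h0 : 0 ≤ u 0) (hm : 1 ≤ m)
    {R : ℕ → Fin n → ℝ≥0 → ℝ≥0} {S : Fin n → ℝ≥0 → ℝ≥0}
    (hR : ∀ i, M.IsContract (R i)) (hS : M.IsContract S)
    (h : ∀ j a, Tendsto (fun i => R i j a) atTop (𝓝 (S j a))) {y : ℕ → ℝ≥0} {x B : ℝ≥0}
    (hy : Tendsto y atTop (𝓝 x)) (hB : ∀ i, y i ≤ B) :
    limsup (fun i => ENNReal.ofReal (∫ a in Set.Iic (y i), u (y i - a) ∂(M.claimLaw (R i)))) atTop ≤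
      ENNReal.ofReal (∫ a in Set.Iic x, u (x - a) ∂(M.claimLaw S)) := by
  have := M.isProbabilityMeasure_eventLaw hm
  simp_rw [M.ofReal_setIntegral_claimLaw hu h0 hm hS.measurable,
    fun i => M.ofReal_setIntegral_claimLaw hu h0 hm (hR i).measurable (y i)]
  refine (limsup_lintegral_le (fun _ => ENNReal.ofReal (u B)) (fun i => ?_)
    (fun i => ae_of_all _ fun z => ?_) (by simp)).trans (lintegral_mono fun z => ?_)
  · exact (Measurable.indicator (ENNReal.measurable_ofReal.comp
      (hu.continuous.comp (by fun_prop)).measurable) measurableSet_Iic).comp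
      (measurable_retained (hR i).measurable)
  · refine (Set.indicator_le_self' (fun _ _ => zero_le) _).trans ?_
    exact ENNReal.ofReal_le_ofReal (hu.monotone (tsub_le_self.trans (hB i)))
  · have hr := tendsto_retained h z
    rcases le_or_gt (retained S z) x with hx | hx
    · rw [Set.indicator_of_mem (show _ ∈ Set.Iic x from hx)]
      have hlim : Tendsto (fun i => ENNReal.ofReal (u (y i - retained (R i) z))) atTop
          (𝓝 (ENNReal.ofReal (u (x - retained S z)))) :=
        ((ENNReal.continuous_ofReal.comp hu.continuous).tendsto _).comp (hy.sub hr)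
      rw [← hlim.limsup_eq]
      exact limsup_le_limsup (Eventually.of_forall fun i =>
        Set.indicator_le_self' (fun _ _ => zero_le) _)
    · refine (limsup_le_of_le (a := 0) (h := ?_)).trans zero_le
      filter_upwards [hy.eventually_lt hr hx] with i hi
      rw [Set.indicator_of_notMem (show _ ∉ Set.Iic (y i) from not_le.2 hi)]

/-- If the claim failed, points converging to x and contracts violating the bound would have a
limiting contract, by sequential compactness, that violates the hypothesis at x. -/
theorem exists_radius {u : ℝ≥0 → ℝ} (hu : ClassL u) (h0 : 0 ≤ u 0) (hm : 1 ≤ m)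
    (hc : ∀ j, IsSeqCompact (M.fam j)) {x : ℝ≥0} {d η : ℝ} (hη : 0 < η)
    (hgen : ∀ R, M.IsContract R → M.generator R u d x ≤ -η) :
    ∃ r : ℝ, 0 < r ∧ ∀ y : ℝ≥0, |(y : ℝ) - x| < r → ∀ R, M.IsContract R →
      M.netPremium R * d - (M.δ + M.totalRate) * u x +
        M.totalRate * ∫ a in Set.Iic y, u (y - a) ∂(M.claimLaw R) ≤ -(η / 2) := by
  by_contra hcon
  push Not at hcon
  have hβ := M.totalRate_pos hm
  choose y hy R hR hlt using fun i : ℕ => hcon (1 / ((i : ℝ) + 1)) (by positivity)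
  obtain ⟨S, φ, hS, hφ, hlim⟩ := M.exists_subseq_contract hc hR
  have hone := tendsto_one_div_add_atTop_nhds_zero_nat (𝕜 := ℝ)
  have hyx : Tendsto y atTop (𝓝 x) := by
    rw [← NNReal.tendsto_coe, tendsto_iff_dist_tendsto_zero]
    refine squeeze_zero (fun _ => dist_nonneg) (fun i => ?_) hone
    rw [Real.dist_eq]; exact (hy i).le
  have hyB : ∀ i, y (φ i) ≤ x + 1 := by
    intro i
    have h1 : (1 : ℝ) / ((φ i : ℝ) + 1) ≤ 1 := by
      rw [div_le_one (by positivity)]; linarith [(Nat.cast_nonneg (φ i) : (0 : ℝ) ≤ _)]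
    have h2 := (le_abs_self _).trans (hy (φ i)).le
    rw [← NNReal.coe_le_coe]
    push_cast
    linarith
  have hsup := M.limsup_claims_le hu h0 hm (fun i => hR (φ i)) hS hlim
    (hyx.comp hφ.tendsto_atTop) hyB
  have hp := M.tendsto_netPremium (fun i => hR (φ i)) hS hlim
  set c : ℝ := (M.δ + M.totalRate) * u x - η / 2 with hcdef
  have hlow : Tendsto (fun i => ENNReal.ofReal ((c - M.netPremium (R (φ i)) * d) / M.totalRate)) atTop
      (𝓝 (ENNReal.ofReal ((c - M.netPremium S * d) / M.totalRate))) :=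
    (ENNReal.continuous_ofReal.tendsto _).comp (((hp.mul_const d).const_sub c).div_const _)
  have h1 : ENNReal.ofReal ((c - M.netPremium S * d) / M.totalRate) ≤
      ENNReal.ofReal (∫ a in Set.Iic x, u (x - a) ∂(M.claimLaw S)) := by
    refine le_trans ?_ hsup
    rw [← hlow.limsup_eq]
    refine limsup_le_limsup (Eventually.of_forall fun i => ENNReal.ofReal_le_ofReal ?_)
    rw [div_le_iff₀ hβ]
    have := hlt (φ i)
    simp only [Function.comp_apply]
    linarith
  rw [ENNReal.ofReal_le_ofReal_iff (integral_nonneg fun a => h0.trans (hu.monotone zero_le)),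
    div_le_iff₀ hβ] at h1
  have := hgen S hS
  rw [generator] at this
  linarith

end RiskModel

/-! ### Perron's method: lowering a supersolution by a cone -/

theorem eventually_le_of_mem_superDiff {u : ℝ≥0 → ℝ} {x : ℝ≥0} {d κ : ℝ} (hd : d ∈ superDiff u x)
    (hκ : 0 < κ) : ∀ᶠ y in 𝓝 x, u y ≤ u x + d * ((y : ℝ) - x) + κ * |(y : ℝ) - x| := by
  have hr : ∀ᶠ y in 𝓝[>] x, u y ≤ u x + d * ((y : ℝ) - x) + κ * |(y : ℝ) - x| := by
    have h1 : limsup (diffQuot u x) (𝓝[>] x) < ((d + κ : ℝ) : EReal) :=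
      hd.2.trans_lt (EReal.coe_lt_coe_iff.2 (by linarith))
    filter_upwards [eventually_lt_of_limsup_lt h1, self_mem_nhdsWithin] with y hy hxy
    have hpos : (0 : ℝ) < y - x := sub_pos.2 (by exact_mod_cast hxy)
    rw [diffQuot, EReal.coe_lt_coe_iff, div_lt_iff₀ hpos] at hy
    rw [abs_of_pos hpos]
    linarith
  have hl : ∀ᶠ y in 𝓝[<] x, u y ≤ u x + d * ((y : ℝ) - x) + κ * |(y : ℝ) - x| := by
    have h1 : ((d - κ : ℝ) : EReal) < liminf (diffQuot u x) (𝓝[<] x) :=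
      lt_of_lt_of_le (EReal.coe_lt_coe_iff.2 (by linarith)) hd.1
    filter_upwards [eventually_lt_of_lt_liminf h1, self_mem_nhdsWithin] with y hy hxy
    have hneg : (y : ℝ) - x < 0 := sub_neg.2 (by exact_mod_cast hxy)
    rw [diffQuot, EReal.coe_lt_coe_iff, lt_div_iff_of_neg hneg] at hy
    rw [abs_of_neg hneg]
    linarith
  have h := eventually_sup.2 ⟨hl, hr⟩
  rw [nhdsLT_sup_nhdsGT, eventually_nhdsWithin_iff] at h
  filter_upwards [h] with y hy
  by_cases hyx : y = x
  · simp [hyx]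
  · exact hy hyx

/-- A cone below the graph of a function. -/
def bump (c d κ : ℝ) (x y : ℝ≥0) : ℝ := c + d * ((y : ℝ) - x) + κ * |(y : ℝ) - x|

theorem bump_sub_le {c d κ : ℝ} (hκ : 0 ≤ κ) {x y z : ℝ≥0} (h : y ≤ z) :
    (d - κ) * ((z : ℝ) - y) ≤ bump c d κ x z - bump c d κ x y ∧
      bump c d κ x z - bump c d κ x y ≤ (d + κ) * ((z : ℝ) - y) := by
  have hyz : (y : ℝ) ≤ z := by exact_mod_cast h
  have h1 : |(z : ℝ) - x| - |(y : ℝ) - x| ≤ z - y := by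
    have := abs_sub_abs_le_abs_sub ((z : ℝ) - x) (y - x)
    rw [show (z : ℝ) - x - (y - x) = z - y by ring, abs_of_nonneg (sub_nonneg.2 hyz)] at this
    exact this
  have h2 : |(y : ℝ) - x| - |(z : ℝ) - x| ≤ z - y := by
    have := abs_sub_abs_le_abs_sub ((y : ℝ) - x) (z - x)
    rw [show (y : ℝ) - x - (z - x) = -(z - y) by ring, abs_neg,
      abs_of_nonneg (sub_nonneg.2 hyz)] at this
    exact this
  have h3 := mul_le_mul_of_nonneg_left h1 hκ
  have h4 := mul_le_mul_of_nonneg_left h2 hκ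
  unfold bump
  constructor <;> linarith

open scoped Classical in
/-- Replace `u` near `x` by the minimum with a cone. -/
def lowered (u : ℝ≥0 → ℝ) (c d κ r : ℝ) (x y : ℝ≥0) : ℝ :=
  if |(y : ℝ) - x| < r then min (u y) (bump c d κ x y) else u y

theorem lowered_le (u : ℝ≥0 → ℝ) (c d κ r : ℝ) (x y : ℝ≥0) : lowered u c d κ r x y ≤ u y := by
  unfold lowered
  split_ifs
  exacts [min_le_left _ _, le_rfl]

/-- The cone has slopes at least d - κ ≥ 1. On the annulus between r / 2 and r it lies above u, so
the definitions by cases agree there and the gluing is locally Lipschitz. -/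
theorem classL_lowered {u : ℝ≥0 → ℝ} (hu : ClassL u) {c d κ r : ℝ} {x : ℝ≥0} (hr : 0 < r)
    (hκ : 0 ≤ κ) (hd : 1 ≤ d - κ)
    (hout : ∀ y : ℝ≥0, r / 2 ≤ |(y : ℝ) - x| → |(y : ℝ) - x| < r → u y ≤ bump c d κ x y) :
    ClassL (lowered u c d κ r x) := by
  have hin : ∀ y : ℝ≥0, |(y : ℝ) - x| < r → lowered u c d κ r x y = min (u y) (bump c d κ x y) :=
    fun y hy => if_pos hy
  have hfar : ∀ y : ℝ≥0, r / 2 ≤ |(y : ℝ) - x| → lowered u c d κ r x y = u y := by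
    intro y hy
    unfold lowered
    split_ifs with h
    · exact min_eq_left (hout y hy h)
    · rfl
  have hbump : ∀ y z : ℝ≥0, y ≤ z → bump c d κ x y + ((z : ℝ) - y) ≤ bump c d κ x z := by
    intro y z h
    have h1 := (bump_sub_le (c := c) (d := d) (x := x) hκ h).1
    have h2 : (0 : ℝ) ≤ z - y := sub_nonneg.2 (by exact_mod_cast h)
    nlinarith
  have hblip : LocallyLipschitz (bump c d κ x) := by
    refine LipschitzWith.locallyLipschitz (K := (|d| + κ).toNNReal) ?_
    refine LipschitzWith.of_le_add_mul' _ fun y z => ?_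
    rw [NNReal.dist_eq]
    have h1 : d * ((y : ℝ) - z) ≤ |d| * |(y : ℝ) - z| := by
      rw [← abs_mul]; exact le_abs_self _
    have h2 := mul_le_mul_of_nonneg_left (abs_sub_abs_le_abs_sub ((y : ℝ) - x) (z - x)) hκ
    rw [show (y : ℝ) - x - (z - x) = y - z by ring] at h2
    unfold bump
    linarith
  have hcont : Continuous fun y : ℝ≥0 => |(y : ℝ) - x| := by fun_prop
  refine ⟨?_, fun y z hyz => ?_, ?_⟩
  · intro y
    have hcongr : ∀ f : ℝ≥0 → ℝ, LocallyLipschitz f →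
        (∀ᶠ z in 𝓝 y, lowered u c d κ r x z = f z) →
        ∃ K, ∃ t ∈ 𝓝 y, LipschitzOnWith K (lowered u c d κ r x) t := by
      intro f hf hev
      obtain ⟨K, t, ht, hK⟩ := hf y
      refine ⟨K, t ∩ {z | lowered u c d κ r x z = f z}, inter_mem ht hev, ?_⟩
      intro a ha b hb
      rw [ha.2, hb.2]
      exact hK ha.1 hb.1
    rcases lt_or_ge |(y : ℝ) - x| r with h | h
    · refine hcongr _ (hu.locallyLipschitz.min hblip) ?_
      filter_upwards [(hcont.tendsto y).eventually_lt_const h] with z hz using hin z hz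
    · refine hcongr _ hu.locallyLipschitz ?_
      filter_upwards [(hcont.tendsto y).eventually_const_lt (show r / 2 < |(y : ℝ) - x| by linarith)]
        with z hz using hfar z hz.le
  · have hyz' : (y : ℝ) < z := by exact_mod_cast hyz
    have huyz := hu.increment y z hyz
    have hly := lowered_le u c d κ r x y
    rcases le_or_gt (r / 2) |(z : ℝ) - x| with hz | hz
    · rw [hfar z hz]; linarith
    rw [hin z (by linarith)]
    rcases le_total (u z) (bump c d κ x z) with hm | hm
    · rw [min_eq_left hm]; linarith
    rw [min_eq_right hm]
    rcases lt_or_ge |(y : ℝ) - x| r with hy | hy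
    · rw [hin y hy]
      have := min_le_right (u y) (bump c d κ x y)
      have := hbump y z hyz.le
      linarith
    · -- pass through the point `x - r / 2`
      obtain ⟨hz1, hz2⟩ := abs_lt.1 hz
      have hyx : (y : ℝ) ≤ x - r := by
        rcases le_abs.1 hy with h | h <;> linarith
      have h0 := NNReal.coe_nonneg y
      set w : ℝ≥0 := ⟨x - r / 2, by linarith⟩ with hw
      have hwv : (w : ℝ) = x - r / 2 := rfl
      have habs : |(w : ℝ) - x| = r / 2 := by
        rw [hwv, show (x : ℝ) - r / 2 - x = -(r / 2) by ring, abs_neg, abs_of_pos (by linarith)]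
      have hw1 := hout w habs.ge (by rw [habs]; linarith)
      have hwz : w ≤ z := by
        rw [← NNReal.coe_le_coe, hwv]; linarith
      have hyw : y ≤ w := by
        rw [← NNReal.coe_le_coe, hwv]; linarith
      have h1 := hbump w z hwz
      have h2 := hu.add_le hyw
      linarith
  · obtain ⟨k, hk0, hk⟩ := hu.growth
    exact ⟨k, hk0, fun y => (lowered_le u c d κ r x y).trans (hk y)⟩

namespace RiskModel

variable {m n : ℕ} {M : RiskModel m n}

/-- The least supersolution is a subsolution. -/
theorem isViscositySub_of_least {u : ℝ≥0 → ℝ} (hu : ClassL u) (hus : M.IsViscositySuper u)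
    (h0 : 0 ≤ u 0) (hm : 1 ≤ m) (hc : ∀ j, IsSeqCompact (M.fam j))
    (hleast : ∀ w, ClassL w → M.IsViscositySuper w → ∀ x, u x ≤ w x) : M.IsViscositySub u := by
  refine ⟨hu.locallyLipschitz, fun x hx d hd => ?_⟩
  by_contra hneg
  push Not at hneg
  rw [hjb, max_lt_iff] at hneg
  obtain ⟨hd1, hsup⟩ := hneg
  rw [← EReal.coe_zero, EReal.coe_lt_coe_iff] at hd1
  obtain ⟨η', hη'1, hη'2⟩ := EReal.lt_iff_exists_real_btwn.1 hsup
  have hη' : η' < 0 := by exact_mod_cast hη'2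
  set η := -η' with hηdef
  have hη : 0 < η := by linarith
  have hgen : ∀ R, M.IsContract R → M.generator R u d x ≤ -η := by
    intro R hR
    have h1 : (M.generator R u d x : EReal) ≤ η' :=
      (le_iSup₂ (f := fun (R : Fin n → ℝ≥0 → ℝ≥0) (_ : M.IsContract R) =>
        (M.generator R u d x : EReal)) R hR).trans hη'1.le
    have h2 : M.generator R u d x ≤ η' := by exact_mod_cast h1
    linarith
  have hβ := M.totalRate_pos hm
  have hδ := M.δ_pos
  have hP := M.premiumBound_nonneg hm
  set P := M.premiumBound with hPdef
  set q := M.δ + M.totalRate with hq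
  have hq0 : 0 < q := by linarith
  obtain ⟨r₁, hr₁, hrad⟩ := M.exists_radius hu h0 hm hc hη hgen
  -- The first bound keeps all slopes of the cone at least one; the second makes replacing d by a
  -- slope within κ of it cost at most η / 8 in the premium term.
  set κ := min (d - 1) (η / (8 * (P + 1))) with hκdef
  have hκ : 0 < κ := lt_min (by linarith) (by positivity)
  have hκ1 : κ ≤ d - 1 := min_le_left _ _
  have hκ2 : P * κ ≤ η / 8 := by
    have h1 : κ * (8 * (P + 1)) ≤ η := by
      have := min_le_right (d - 1) (η / (8 * (P + 1)))
      rwa [← hκdef, le_div_iff₀ (by positivity)] at this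
    nlinarith
  obtain ⟨r₂, hr₂, hsuper⟩ := Metric.eventually_nhds_iff.1
    (eventually_le_of_mem_superDiff hd (half_pos hκ))
  have hdκ : 0 < d + κ := by linarith
  -- Within r the compactness bound and the superdifferential bound hold, and the cone falls below
  -- its apex by at most (d + κ) r, which costs another η / 8.
  set r := min (min r₁ r₂) (η / (8 * (q * (d + κ)))) with hrdef
  have hr : 0 < r := lt_min (lt_min hr₁ hr₂) (by positivity)
  have hr3 : q * ((d + κ) * r) ≤ η / 8 := by
    have := min_le_right (min r₁ r₂) (η / (8 * (q * (d + κ))))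
    rw [← hrdef, le_div_iff₀ (by positivity)] at this
    linarith
  -- The superdifferential bound is used with κ / 2, so at distance r / 2 the cone with κ gains κ r
  -- / 4. Lowering the apex by at most this amount keeps the cone above u on the annulus; the second
  -- bound is the last η / 8.
  set ε := min (κ * r / 4) (η / (8 * q)) with hεdef
  have hε : 0 < ε := lt_min (by positivity) (by positivity)
  have hε1 : ε ≤ κ * r / 4 := min_le_left _ _
  have hε2 : q * ε ≤ η / 8 := by
    have := min_le_right (κ * r / 4) (η / (8 * q))
    rw [← hεdef, le_div_iff₀ (by positivity)] at this
    linarith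
  set c := u x - ε with hcdef
  have hnear : ∀ y : ℝ≥0, |(y : ℝ) - x| < r →
      u y ≤ u x + d * ((y : ℝ) - x) + κ / 2 * |(y : ℝ) - x| := by
    intro y hy
    refine hsuper ?_
    rw [NNReal.dist_eq]
    exact hy.trans_le ((min_le_left _ _).trans (min_le_right _ _))
  have hout : ∀ y : ℝ≥0, r / 2 ≤ |(y : ℝ) - x| → |(y : ℝ) - x| < r → u y ≤ bump c d κ x y := by
    intro y h1 h2
    have h3 := hnear y h2
    have h4 := mul_le_mul_of_nonneg_left h1 hκ.le
    unfold bump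
    linarith
  set w := lowered u c d κ r x with hw
  have hwL : ClassL w := classL_lowered hu hr hκ.le (by linarith) hout
  have hwle : ∀ y, w y ≤ u y := lowered_le u c d κ r x
  have hwx : w x < u x := by
    have : w x = min (u x) (bump c d κ x x) := if_pos (by simpa using hr)
    rw [this]
    refine (min_le_right _ _).trans_lt ?_
    simp only [bump, sub_self, abs_zero, mul_zero, add_zero]
    linarith
  have hws : M.IsViscositySuper w := by
    refine ⟨hwL.locallyLipschitz, fun y hy e he => ?_⟩
    -- Where the functions agree, the lowered one touches u from below, its subdifferential is
    -- contained in that of u, and the claim integral only decreases. Elsewhere it equals the cone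
    -- locally from below, so subgradients lie within κ of d.
    by_cases hwy : w y = u y
    · have h1 := hjb_nonpos_iff.1 (hus.2 y hy e
        (subDiff_subset hwy (Eventually.of_forall hwle) he))
      refine hjb_nonpos_iff.2 ⟨h1.1, fun R hR => le_trans ?_ (h1.2 R hR)⟩
      have := M.isProbabilityMeasure_claimLaw hm hR.measurable
      have hint : ∫ a in Set.Iic y, w (y - a) ∂(M.claimLaw R) ≤
          ∫ a in Set.Iic y, u (y - a) ∂(M.claimLaw R) :=
        setIntegral_mono_on (hwL.integrableOn_shift _ _) (hu.integrableOn_shift _ _)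
          measurableSet_Iic fun a _ => hwle _
      rw [generator, generator, hwy]
      have := mul_le_mul_of_nonneg_left hint hβ.le
      linarith
    · have hyr : |(y : ℝ) - x| < r := by
        by_contra h
        exact hwy (if_neg h)
      have hwmin : ∀ z : ℝ≥0, |(z : ℝ) - x| < r → w z = min (u z) (bump c d κ x z) :=
        fun z hz => if_pos hz
      have hwb : w y = bump c d κ x y := by
        rw [hwmin y hyr] at hwy ⊢
        rcases min_choice (u y) (bump c d κ x y) with h | h
        exacts [absurd h hwy, h]
      have hcont : Continuous fun y : ℝ≥0 => |(y : ℝ) - x| := by fun_prop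
      have hev : ∀ᶠ z in 𝓝 y, w z ≤ bump c d κ x z := by
        filter_upwards [(hcont.tendsto y).eventually_lt_const hyr] with z hz
        rw [hwmin z hz]
        exact min_le_right _ _
      have he1 : e ≤ d + κ := by
        refine le_of_mem_subDiff he ?_
        filter_upwards [nhdsWithin_le_nhds hev, self_mem_nhdsWithin] with z hz hyz
        have := (bump_sub_le (c := c) (d := d) (x := x) hκ.le (le_of_lt hyz)).2
        rw [hwb]; linarith
      have he2 : d - κ ≤ e := by
        refine ge_of_mem_subDiff hy he ?_
        filter_upwards [nhdsWithin_le_nhds hev, self_mem_nhdsWithin] with z hz hyz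
        have := (bump_sub_le (c := c) (d := d) (x := x) hκ.le (le_of_lt hyz)).1
        rw [hwb]; linarith
      -- The compactness bound provides -η / 2, and the three perturbations cost at most 3 η / 8.
      refine hjb_nonpos_iff.2 ⟨by linarith, fun R hR => ?_⟩
      have := M.isProbabilityMeasure_claimLaw hm hR.measurable
      have hint : ∫ a in Set.Iic y, w (y - a) ∂(M.claimLaw R) ≤
          ∫ a in Set.Iic y, u (y - a) ∂(M.claimLaw R) :=
        setIntegral_mono_on (hwL.integrableOn_shift _ _) (hu.integrableOn_shift _ _)
          measurableSet_Iic fun a _ => hwle _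
      have h1 := hrad y (hyr.trans_le ((min_le_left _ _).trans (min_le_left _ _))) R hR
      have h2 := mul_le_mul_of_nonneg_left hint hβ.le
      have h3 : M.netPremium R * e ≤ M.netPremium R * d + P * κ := by
        have h4 : M.netPremium R * (e - d) ≤ P * κ := by
          calc M.netPremium R * (e - d) ≤ |M.netPremium R| * |e - d| := by
                rw [← abs_mul]; exact le_abs_self _
            _ ≤ P * κ := mul_le_mul (M.abs_netPremium_le hm hR)
                (abs_le.2 ⟨by linarith, by linarith⟩) (abs_nonneg _) hP
        linarith
      have h5 : u x - ε - (d + κ) * r ≤ w y := by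
        rw [hwb]
        unfold bump
        have h6 := (abs_lt.1 hyr).1
        have h7 := abs_nonneg ((y : ℝ) - x)
        have hd0 : 0 < d := by linarith
        nlinarith
      have h6 := mul_le_mul_of_nonneg_left h5 hq0.le
      rw [generator]
      linarith
  exact absurd (hleast w hwL hws x) (not_le.2 hwx)

end RiskModel

/-! ### The scenario after a fixed time -/

section Restart

variable {m n : ℕ}

/-- The scenario seen from time `h` on. -/
def restart (h : ℝ≥0) (ω : Scenario m n) : Scenario m n := fun e =>
  (if e.2 = 0 then eventTime e.1 (eventCount e.1 h ω) ω - h else (ω (e.1, eventCount e.1 h ω + e.2)).1,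
    (ω (e.1, eventCount e.1 h ω + e.2)).2)

theorem measurable_comp_nat {α β : Type*} [MeasurableSpace α] [MeasurableSpace β] {N : α → ℕ}
    (hN : Measurable N) {f : ℕ → α → β} (hf : ∀ i, Measurable (f i)) :
    Measurable fun a => f (N a) a := by
  have h : Measurable fun q : ℕ × α => f q.1 q.2 := measurable_from_prod_countable_right hf
  exact h.comp (hN.prodMk measurable_id)

theorem measurable_restart (h : ℝ≥0) : Measurable (restart h : Scenario m n → Scenario m n) := by
  refine measurable_pi_lambda _ fun e => ?_
  refine measurable_comp_nat (measurable_eventCount_right e.1 h) (f := fun N ω =>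
    ((if e.2 = 0 then eventTime e.1 N ω - h else (ω (e.1, N + e.2)).1,
      (ω (e.1, N + e.2)).2) : Mark n)) fun N => ?_
  split_ifs
  · exact Measurable.prodMk (by fun_prop) (by fun_prop)
  · exact Measurable.prodMk (by fun_prop) (by fun_prop)

theorem eventTime_succ (k : Fin m) (i : ℕ) (ω : Scenario m n) :
    eventTime k (i + 1) ω = eventTime k i ω + (ω (k, i + 1)).1 := by
  rw [eventTime_eq, prevTime_succ]

theorem eventTime_restart_le (h : ℝ≥0) (k : Fin m) (i : ℕ) (ω : Scenario m n) :
    eventTime k i (restart h ω) ≤ eventTime k (eventCount k h ω + i) ω := by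
  induction i with
  | zero =>
    have : eventTime k 0 (restart h ω) = eventTime k (eventCount k h ω) ω - h := by
      simp [eventTime, restart]
    rw [this]; exact tsub_le_self
  | succ i ih =>
    rw [eventTime_succ, ← add_assoc, eventTime_succ]
    refine add_le_add ih (le_of_eq ?_)
    simp [restart, add_assoc]

theorem eventTime_restart {h : ℝ≥0} {k : Fin m} {ω : Scenario m n}
    (hF : ∀ s : ℝ≥0, {i : ℕ | eventTime k i ω ≤ s}.Finite) (i : ℕ) :
    eventTime k i (restart h ω) + h = eventTime k (eventCount k h ω + i) ω := by
  induction i with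
  | zero =>
    have h1 : eventTime k 0 (restart h ω) = eventTime k (eventCount k h ω) ω - h := by
      simp [eventTime, restart]
    have h2 : h ≤ eventTime k (eventCount k h ω) ω := by
      by_contra hcon
      exact lt_irrefl _ (lt_eventCount_iff.2 ⟨hF, (not_le.1 hcon).le⟩)
    rw [h1, tsub_add_cancel_of_le h2, add_zero]
  | succ i ih =>
    rw [eventTime_succ, ← add_assoc (eventCount k h ω), eventTime_succ, ← ih,
      add_right_comm]
    simp [restart, add_assoc]

/-- An exploding class has count zero by convention, and restarting it still yields an exploding
class. Thus the identities for counts and claims hold in every scenario, as an uncompleted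
filtration demands. -/
theorem finite_restart_iff (h : ℝ≥0) (k : Fin m) (ω : Scenario m n) :
    (∀ s : ℝ≥0, {i : ℕ | eventTime k i (restart h ω) ≤ s}.Finite) ↔
      ∀ s : ℝ≥0, {i : ℕ | eventTime k i ω ≤ s}.Finite := by
  constructor
  · intro hF
    by_contra hcon
    have hN : eventCount k h ω = 0 := by rw [eventCount, if_neg hcon]
    refine hcon fun s => (hF s).subset fun i hi => ?_
    have := eventTime_restart_le h k i ω
    rw [hN, zero_add] at this
    exact this.trans hi
  · intro hF s
    have := ((hF (s + h)).preimage (f := fun i => eventCount k h ω + i)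
      (fun i _ j _ hij => by simpa using hij))
    refine this.subset fun i hi => ?_
    change eventTime k (eventCount k h ω + i) ω ≤ s + h
    rw [← eventTime_restart hF]
    exact add_le_add hi le_rfl

theorem eventCount_restart (h r : ℝ≥0) (k : Fin m) (ω : Scenario m n) :
    eventCount k h ω + eventCount k r (restart h ω) = eventCount k (h + r) ω := by
  by_cases hF : ∀ s : ℝ≥0, {i : ℕ | eventTime k i ω ≤ s}.Finite
  · have key : ∀ i, i < eventCount k r (restart h ω) ↔
        eventCount k h ω + i < eventCount k (h + r) ω := by
      intro i
      rw [lt_eventCount_iff, lt_eventCount_iff, finite_restart_iff, ← eventTime_restart hF,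
        add_comm h r, add_le_add_iff_right]
    have hmono : eventCount k h ω ≤ eventCount k (h + r) ω := eventCount_mono k ω le_self_add
    have h1 := key (eventCount k r (restart h ω))
    have h2 := key (eventCount k (h + r) ω - eventCount k h ω)
    omega
  · have h1 := mt (finite_restart_iff h k ω).1 hF
    simp only [eventCount, if_neg hF, if_neg h1]

theorem sum_eventCount_restart {β : Type*} [AddCommMonoid β] (h r : ℝ≥0) (k : Fin m)
    (ω : Scenario m n) (g : ℕ → β) :
    ∑ i ∈ Finset.range (eventCount k (h + r) ω), g i =
      ∑ i ∈ Finset.range (eventCount k h ω), g i +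
        ∑ i ∈ Finset.range (eventCount k r (restart h ω)), g (eventCount k h ω + i) := by
  rw [← eventCount_restart, Finset.sum_range_add]

theorem lineClaims_restart (j : Fin n) (h r : ℝ≥0) (ω : Scenario m n) :
    lineClaims j (h + r) ω = lineClaims j h ω + lineClaims j r (restart h ω) := by
  unfold lineClaims
  rw [← Finset.sum_add_distrib]
  refine Finset.sum_congr rfl fun k _ => ?_
  rw [sum_eventCount_restart]
  rfl

theorem measurable_lineClaims_past (j : Fin n) {s t : ℝ≥0} (hst : s < t) :
    Measurable[strictPast m n t] (lineClaims j s : Scenario m n → ℝ≥0) := by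
  rw [measurable_iff_comap_le]
  exact le_iSup_of_le j (le_iSup_of_le s (le_iSup_of_le hst le_rfl))

/-- The claims of the restarted scenario up to s are the difference of the original claims at h + s
and at h, both observed strictly before h + r. -/
theorem measurable_restart_past (h r : ℝ≥0) :
    @Measurable _ _ (strictPast m n (h + r)) (strictPast m n r) (restart h) := by
  rw [measurable_iff_comap_le]
  simp only [strictPast, MeasurableSpace.comap_iSup, MeasurableSpace.comap_comp]
  refine iSup_le fun j => iSup_le fun s => iSup_le fun hs => ?_
  change _ ≤ strictPast m n (h + r)
  rw [← measurable_iff_comap_le]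
  have h1 : lineClaims j s ∘ restart h = fun ω : Scenario m n =>
      lineClaims j (h + s) ω - lineClaims j h ω := by
    funext ω
    rw [lineClaims_restart, add_tsub_cancel_left, Function.comp_apply]
  rw [h1]
  exact (measurable_lineClaims_past j (add_lt_add_right hs h)).sub
    (measurable_lineClaims_past j (lt_add_of_pos_right h (zero_le.trans_lt hs)))

end Restart

/-! ### Concatenation of a constant contract with later strategies -/

namespace RiskModel

variable {m n : ℕ} {M : RiskModel m n}

theorem IsContract.zero {R : Fin n → ℝ≥0 → ℝ≥0} (hR : M.IsContract R) (j : Fin n) : R j 0 = 0 :=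
  le_antisymm (hR.le j 0) zero_le

/-- Surplus at time `h` when the contract `R` is used up to this time, provided that every line is
hit at most once. -/
def waitSurplus (M : RiskModel m n) (R : Fin n → ℝ≥0 → ℝ≥0) (h x : ℝ≥0) (ω : Scenario m n) : ℝ≥0 :=
  x + (M.netPremium R).toNNReal * h - ∑ j, R j (lineClaims j h ω)

namespace Strategy

/-- Use the contract `R` up to time `h`, pay a lump sum `l` at time zero, and restart at time `h`
with a strategy chosen according to the surplus. -/
def concat {R : Fin n → ℝ≥0 → ℝ≥0} (hR : M.IsContract R) (h l x : ℝ≥0) (π : ℕ → M.Strategy)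
    {c : ℝ≥0 → ℕ} (hc : Measurable c) : M.Strategy :=
  -- The surplus is expressed through the aggregate claims of the lines, which are observable,
  -- rather than through the single claims. The index takes countably many values, so selecting a
  -- strategy by it preserves measurability.
  have hidx : ∀ t, h < t → Measurable[strictPast m n t] fun ω => c (M.waitSurplus R h x ω) :=
    fun t ht => hc.comp (Measurable.const_sub (Finset.measurable_sum _ fun j _ =>
      (hR.measurable j).comp (measurable_lineClaims_past j ht)) _)
  { R := fun j t ω a => if t ≤ h then R j a else
      (π (c (M.waitSurplus R h x ω))).R j (t - h) (restart h ω) a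
    R_mem := fun j t ω => by
      by_cases ht : t ≤ h
      · simpa only [ht, if_true] using hR j
      · simpa only [ht, if_false] using (π (c (M.waitSurplus R h x ω))).R_mem j _ _
    R_measurable := fun j => by
      refine Measurable.ite (measurableSet_le measurable_fst measurable_const)
        ((hR.measurable j).comp (by fun_prop)) ?_
      refine measurable_comp_nat (N := fun q : ℝ≥0 × Scenario m n × ℝ≥0 =>
        c (M.waitSurplus R h x q.2.1)) (f := fun i q => (π i).R j (q.1 - h) (restart h q.2.1) q.2.2)
        ?_ fun i => ?_
      · exact (((hidx (h + 1) (lt_add_of_pos_right h one_pos)).mono (strictPast_le _) le_rfl).comp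
          measurable_fst).comp measurable_snd
      · refine ((π i).R_measurable j).comp (f := fun q : ℝ≥0 × Scenario m n × ℝ≥0 =>
          (q.1 - h, restart h q.2.1, q.2.2)) ?_
        exact (by fun_prop : Measurable fun q : ℝ≥0 × Scenario m n × ℝ≥0 => q.1 - h).prodMk
          (((measurable_restart h).comp (measurable_fst.comp measurable_snd)).prodMk
            (measurable_snd.comp measurable_snd))
    R_past := fun j t a => by
      by_cases ht : t ≤ h
      · simp only [ht, if_true]; exact measurable_const
      · simp only [ht, if_false]
        have ht' : h < t := not_le.1 ht
        refine @measurable_comp_nat _ _ (strictPast m n t) _ _ (hidx t ht')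
          (fun i ω => (π i).R j (t - h) (restart h ω) a) fun i => ?_
        have := ((π i).R_past j (t - h) a).comp (measurable_restart_past h (t - h))
        rwa [add_tsub_cancel_of_le ht'.le] at this
    -- A left-continuous process starting at 0 shows the lump sum only after time zero. Up to h the
    -- truncated time t - h is 0, so the later strategy pays nothing yet.
    D := fun t ω => (if t = 0 then 0 else l) +
      (π (c (M.waitSurplus R h x ω))).D (t - h) (restart h ω)
    D_zero := fun ω => by simp [D_zero]
    D_mono := fun ω s t hst => by
      refine add_le_add ?_ ((π _).D_mono _ (tsub_le_tsub_right hst h))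
      by_cases hs : s = 0
      · simp [hs]
      · have : t ≠ 0 := fun ht => hs (le_antisymm (ht ▸ hst) zero_le)
        simp [hs, this]
    D_leftCont := fun ω t => by
      refine ContinuousWithinAt.add ?_ ?_
      · rcases eq_or_ne t 0 with rfl | ht
        · have : Set.Iic (0 : ℝ≥0) = {0} := by ext; simp
          rw [this]; exact continuousWithinAt_singleton
        · refine ContinuousAt.continuousWithinAt (continuousAt_const.congr (f := fun _ => l) ?_)
          filter_upwards [isOpen_ne.mem_nhds ht] with s hs
          rw [if_neg hs]
      · refine ((π (c (M.waitSurplus R h x ω))).D_leftCont (restart h ω) (t - h)).comp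
          (f := fun s : ℝ≥0 => s - h) ?_ fun s hs => ?_
        · exact Continuous.continuousWithinAt (by fun_prop)
        · exact tsub_le_tsub_right hs h
    D_past := fun t => by
      refine Measurable.const_add ?_ _
      by_cases ht : t ≤ h
      · simp only [tsub_eq_zero_of_le ht, D_zero]; exact measurable_const
      · have ht' : h < t := not_le.1 ht
        refine @measurable_comp_nat _ _ (strictPast m n t) _ _ (hidx t ht')
          (fun i ω => (π i).D (t - h) (restart h ω)) fun i => ?_
        have := ((π i).D_past (t - h)).comp (measurable_restart_past h (t - h))
        rwa [add_tsub_cancel_of_le ht'.le] at this }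

section Concat

variable {R : Fin n → ℝ≥0 → ℝ≥0} (hR : M.IsContract R) (h l x : ℝ≥0) (π : ℕ → M.Strategy)
    {c : ℝ≥0 → ℕ} (hc : Measurable c)

theorem contract_concat_of_le {t : ℝ≥0} (ht : t ≤ h) (ω : Scenario m n) :
    (concat hR h l x π hc).contract t ω = R := by
  funext j a
  simp [contract, concat, ht]

theorem contract_concat_of_gt {t : ℝ≥0} (ht : h < t) (ω : Scenario m n) :
    (concat hR h l x π hc).contract t ω =
      (π (c (M.waitSurplus R h x ω))).contract (t - h) (restart h ω) := by
  funext j a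
  simp [contract, concat, not_le.2 ht]

theorem D_concat (t : ℝ≥0) (ω : Scenario m n) : (concat hR h l x π hc).D t ω =
    (if t = 0 then 0 else l) + (π (c (M.waitSurplus R h x ω))).D (t - h) (restart h ω) := rfl

/-- Retained claims up to time `h` under a constant contract. -/
def claimsUpTo (R : Fin n → ℝ≥0 → ℝ≥0) (h : ℝ≥0) (ω : Scenario m n) : ℝ≥0 :=
  ∑ k, ∑ i ∈ Finset.range (eventCount k h ω), retained R (ω (k, i)).2

theorem claimSize_concat {t : ℝ≥0} (ht : t ≤ h) {k : Fin m} {i : ℕ} {ω : Scenario m n}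
    (hi : i < eventCount k t ω) :
    (concat hR h l x π hc).claimSize (k, i) ω = retained R (ω (k, i)).2 := by
  rw [claimSize, contract_concat_of_le hR h l x π hc ((lt_eventCount_iff.1 hi).2.trans ht)]

theorem claimSize_concat_restart {r : ℝ≥0} {k : Fin m} {i : ℕ} {ω : Scenario m n}
    (hi : i < eventCount k r (restart h ω)) :
    (concat hR h l x π hc).claimSize (k, eventCount k h ω + i) ω =
      (π (c (M.waitSurplus R h x ω))).claimSize (k, i) (restart h ω) := by
  have hF := (finite_restart_iff h k ω).1 (lt_eventCount_iff.1 hi).1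
  have hT := eventTime_restart (h := h) hF i
  have hlt : h < eventTime k (eventCount k h ω + i) ω := by
    by_contra hcon
    have := lt_eventCount_iff.2 ⟨hF, not_lt.1 hcon⟩
    omega
  rw [claimSize, contract_concat_of_gt hR h l x π hc hlt, claimSize]
  simp only [← hT, add_tsub_cancel_right]
  rfl

theorem integral_premiumRate_concat_of_le {t : ℝ≥0} (ht : t ≤ h) (ω : Scenario m n) :
    (∫ s in (0 : ℝ)..t, (concat hR h l x π hc).premiumRate ω s) = M.netPremium R * t := by
  rw [intervalIntegral.integral_congr_ae (g := fun _ => M.netPremium R)]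
  · simp [mul_comm]
  · refine ae_of_all _ fun s hs => ?_
    rw [Set.uIoc_of_le (NNReal.coe_nonneg t)] at hs
    rw [premiumRate, contract_concat_of_le hR h l x π hc
      ((Real.toNNReal_le_iff_le_coe.2 hs.2).trans ht)]

theorem integral_premiumRate_concat (hm : 1 ≤ m) (r : ℝ≥0) (ω : Scenario m n) :
    (∫ s in (0 : ℝ)..((h + r : ℝ≥0) : ℝ), (concat hR h l x π hc).premiumRate ω s) =
      M.netPremium R * h + ∫ s in (0 : ℝ)..r,
        (π (c (M.waitSurplus R h x ω))).premiumRate (restart h ω) s := by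
  have hP := (concat hR h l x π hc).pathData hm ω
  rw [← intervalIntegral.integral_add_adjacent_intervals (b := (h : ℝ))
    (hP.intervalIntegrable _ _) (hP.intervalIntegrable _ _),
    integral_premiumRate_concat_of_le hR h l x π hc le_rfl]
  congr 1
  have h1 : (∫ s in (0 : ℝ)..r, (π (c (M.waitSurplus R h x ω))).premiumRate (restart h ω) s) =
      ∫ s in ((0 : ℝ) + h)..(r + h), (π (c (M.waitSurplus R h x ω))).premiumRate (restart h ω)
        (s - h) := by
    rw [intervalIntegral.integral_comp_sub_right fun s =>
      (π (c (M.waitSurplus R h x ω))).premiumRate (restart h ω) s]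
    simp
  rw [h1, zero_add, NNReal.coe_add, add_comm (h : ℝ) r]
  refine intervalIntegral.integral_congr_ae (ae_of_all _ fun s hs => ?_)
  rw [Set.uIoc_of_le (by simp)] at hs
  have hs0 : 0 ≤ s := (NNReal.coe_nonneg h).trans hs.1.le
  have hlt : h < s.toNNReal := (Real.lt_toNNReal_iff_coe_lt).2 hs.1
  rw [premiumRate, contract_concat_of_gt hR h l x π hc hlt, premiumRate]
  congr 3
  rw [NNReal.sub_def, Real.coe_toNNReal s hs0]

/-- Nonnegative premiums may be discarded, and the lump sum is covered by the additional initial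
capital l. So there is no ruin up to h if the claims do not exceed x. -/
theorem surplus_concat_of_le (hp : 0 ≤ M.netPremium R) {t : ℝ≥0} (ht : t ≤ h) (ω : Scenario m n) :
    (x : ℝ) - claimsUpTo R h ω ≤ (concat hR h l x π hc).surplus (x + l) t ω := by
  rw [surplus_eq, integral_premiumRate_concat_of_le hR h l x π hc ht, D_concat,
    tsub_eq_zero_of_le ht, D_zero, add_zero]
  have h1 : ∑ k, ∑ i ∈ Finset.range (eventCount k t ω),
      ((concat hR h l x π hc).claimSize (k, i) ω : ℝ) ≤ claimsUpTo R h ω := by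
    rw [claimsUpTo]
    push_cast
    refine Finset.sum_le_sum fun k _ => ?_
    calc _ = ∑ i ∈ Finset.range (eventCount k t ω), (retained R (ω (k, i)).2 : ℝ) :=
          Finset.sum_congr rfl fun i hi => by
            rw [claimSize_concat hR h l x π hc ht (Finset.mem_range.1 hi)]
      _ ≤ _ := Finset.sum_le_sum_of_subset_of_nonneg
          (Finset.range_mono (eventCount_mono k ω ht)) fun i _ _ => NNReal.coe_nonneg _
  have h2 : ((if t = 0 then 0 else l : ℝ≥0) : ℝ) ≤ l := by
    split_ifs
    exacts [NNReal.coe_nonneg l, le_rfl]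
  have h3 : 0 ≤ M.netPremium R * t := mul_nonneg hp (NNReal.coe_nonneg t)
  rw [NNReal.coe_add]
  linarith

theorem surplus_concat (hm : 1 ≤ m) (hh : 0 < h) {ω : Scenario m n} {z : ℝ≥0}
    (hz : (z : ℝ) = x + M.netPremium R * h - claimsUpTo R h ω) (r : ℝ≥0) :
    (concat hR h l x π hc).surplus (x + l) (h + r) ω =
      (π (c (M.waitSurplus R h x ω))).surplus z r (restart h ω) := by
  rw [surplus_eq, surplus_eq, integral_premiumRate_concat hR h l x π hc hm, D_concat,
    if_neg (by positivity), add_tsub_cancel_left, hz]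
  have h1 : ∑ k, ∑ i ∈ Finset.range (eventCount k (h + r) ω),
      ((concat hR h l x π hc).claimSize (k, i) ω : ℝ) = claimsUpTo R h ω +
      ∑ k, ∑ i ∈ Finset.range (eventCount k r (restart h ω)),
        ((π (c (M.waitSurplus R h x ω))).claimSize (k, i) (restart h ω) : ℝ) := by
    rw [claimsUpTo]
    push_cast
    rw [← Finset.sum_add_distrib]
    refine Finset.sum_congr rfl fun k _ => ?_
    rw [sum_eventCount_restart]
    refine congrArg₂ _ (Finset.sum_congr rfl fun i hi => ?_) (Finset.sum_congr rfl fun i hi => ?_)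
    · rw [claimSize_concat hR h l x π hc le_rfl (Finset.mem_range.1 hi)]
    · rw [claimSize_concat_restart hR h l x π hc (Finset.mem_range.1 hi)]
  rw [h1]
  push_cast
  ring

theorem dividendMeasure_Ico (hm : 1 ≤ m) (π : M.Strategy) (ω : Scenario m n) {a b : ℝ}
    (hab : a ≤ b) : π.dividendMeasure ω (Set.Ico a b) =
      ENNReal.ofReal ((π.D b.toNNReal ω : ℝ) - π.D a.toNNReal ω) :=
  (π.pathData hm ω).measure_Ico a b hab

/-- Both measures are compared on half-open intervals [a, b); the lump sum is counted exactly if 0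
belongs to the interval. -/
theorem dividendMeasure_concat (hm : 1 ≤ m) (ω : Scenario m n) :
    (concat hR h l x π hc).dividendMeasure ω =
      (l : ℝ≥0∞) • Measure.dirac (0 : ℝ) +
        ((π (c (M.waitSurplus R h x ω))).dividendMeasure (restart h ω)).map fun s : ℝ => s + h := by
  have hloc : IsLocallyFiniteMeasure ((concat hR h l x π hc).dividendMeasure ω) := by
    unfold dividendMeasure; infer_instance
  refine Measure.ext_of_Ico _ _ fun a b hab => ?_
  rw [dividendMeasure_Ico hm _ _ hab.le, Measure.add_apply, Measure.smul_apply,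
    Measure.map_apply (by fun_prop) measurableSet_Ico, Set.preimage_add_const_Ico,
    dividendMeasure_Ico hm _ _ (by linarith), D_concat, D_concat, smul_eq_mul,
    Measure.dirac_apply' _ measurableSet_Ico]
  have e : ∀ t : ℝ, t.toNNReal - h = (t - h).toNNReal := fun t => by
    rw [NNReal.sub_def]
    rcases le_total 0 t with h0 | h0
    · rw [Real.coe_toNNReal t h0]
    · rw [Real.toNNReal_of_nonpos h0, Real.toNNReal_of_nonpos, Real.toNNReal_of_nonpos]
      · linarith [NNReal.coe_nonneg h]
      · simp
  rw [e, e]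
  set q := π (c (M.waitSurplus R h x ω))
  have hmono : (q.D (a - h).toNNReal (restart h ω) : ℝ) ≤ q.D (b - h).toNNReal (restart h ω) :=
    NNReal.coe_le_coe.2 (q.D_mono _ (Real.toNNReal_le_toNNReal (by linarith)))
  by_cases h0 : (0 : ℝ) ∈ Set.Ico a b
  · rw [Set.indicator_of_mem h0, if_neg (by simpa using h0.2),
      if_pos (by simpa using h0.1)]
    have hl : (l : ℝ≥0∞) = ENNReal.ofReal (l : ℝ) := ENNReal.ofReal_coe_nnreal.symm
    rw [Pi.one_apply, mul_one, hl, ← ENNReal.ofReal_add (NNReal.coe_nonneg l) (by linarith)]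
    congr 1
    push_cast
    ring
  · rw [Set.indicator_of_notMem h0, mul_zero, zero_add]
    congr 1
    have : (if b.toNNReal = 0 then 0 else l) = (if a.toNNReal = 0 then 0 else l) := by
      simp only [Real.toNNReal_eq_zero]
      rcases le_or_gt b 0 with hb | hb
      · rw [if_pos hb, if_pos (by linarith)]
      · have ha : 0 < a := by
          by_contra hcon
          exact h0 ⟨not_lt.1 hcon, hb⟩
        rw [if_neg (not_le.2 hb), if_neg (not_le.2 ha)]
    rw [this]
    push_cast
    ring

end Concat

/-- Discounted dividends until ruin. -/
def payoff (π : M.Strategy) (x : ℝ≥0) (ω : Scenario m n) : ℝ≥0∞ :=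
  ∫⁻ s in {s : ℝ | 0 ≤ s ∧ ENNReal.ofReal s < π.ruinTime x ω},
    ENNReal.ofReal (Real.exp (-M.δ * s)) ∂(π.dividendMeasure ω)

theorem value_eq (π : M.Strategy) (x : ℝ≥0) : π.value x = ∫⁻ ω, π.payoff x ω ∂M.prob := rfl

theorem surplus_mono (π : M.Strategy) {x y : ℝ≥0} (hxy : x ≤ y) (t : ℝ≥0) (ω : Scenario m n) :
    π.surplus x t ω ≤ π.surplus y t ω := by
  have : (x : ℝ) ≤ y := by exact_mod_cast hxy
  unfold surplus
  linarith

theorem payoff_mono (π : M.Strategy) (ω : Scenario m n) : Monotone fun x => π.payoff x ω := by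
  intro x y hxy
  refine lintegral_mono_set fun s hs => ⟨hs.1, hs.2.trans_le ?_⟩
  refine le_iInf₂ fun t ht => iInf₂_le t ((π.surplus_mono hxy t ω).trans_lt ht)

theorem value_mono (π : M.Strategy) : Monotone π.value := fun _ _ h =>
  lintegral_mono fun ω => π.payoff_mono ω h

theorem measurableSet_lt_time (τ : ℝ≥0∞) : MeasurableSet {s : ℝ | 0 ≤ s ∧ ENNReal.ofReal s < τ} :=
  (measurableSet_le measurable_const measurable_id).inter
    (measurableSet_lt ENNReal.measurable_ofReal measurable_const)

/-- Ruin cannot occur up to h, so the ruin time is at least h plus that of the continuation. The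
dividend measure splits into the atom at zero and a shifted copy, the latter discounted by exp (-δ
h). -/
theorem payoff_concat_ge {R : Fin n → ℝ≥0 → ℝ≥0} (hR : M.IsContract R) (h l x : ℝ≥0)
    (π : ℕ → M.Strategy) {c : ℝ≥0 → ℕ} (hc : Measurable c) (hm : 1 ≤ m) (hh : 0 < h)
    (hp : 0 ≤ M.netPremium R) {ω : Scenario m n} (hx : claimsUpTo R h ω ≤ x)
    (hω : ∑ j, R j (lineClaims j h ω) = claimsUpTo R h ω) :
    (l : ℝ≥0∞) + ENNReal.ofReal (Real.exp (-(M.δ * h))) *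
      (π (c (M.waitSurplus R h x ω))).payoff (M.waitSurplus R h x ω) (restart h ω) ≤
    (concat hR h l x π hc).payoff (x + l) ω := by
  set z := M.waitSurplus R h x ω with hzdef
  have hz : (z : ℝ) = x + M.netPremium R * h - claimsUpTo R h ω := by
    rw [hzdef, waitSurplus, hω, NNReal.coe_sub (hx.trans le_self_add)]
    push_cast
    rw [Real.coe_toNNReal _ hp]
  set q := π (c z) with hq
  set τ := q.ruinTime z (restart h ω) with hτ
  have hruin : (h : ℝ≥0∞) + τ ≤ (concat hR h l x π hc).ruinTime (x + l) ω := by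
    refine le_iInf₂ fun t ht => ?_
    have hlt : h < t := by
      by_contra hcon
      have h1 := surplus_concat_of_le hR h l x π hc hp (not_lt.1 hcon) ω
      have h2 : (claimsUpTo R h ω : ℝ) ≤ x := by exact_mod_cast hx
      linarith
    obtain ⟨r, rfl⟩ := exists_add_of_le hlt.le
    rw [surplus_concat hR h l x π hc hm hh hz] at ht
    push_cast
    exact add_le_add le_rfl (iInf₂_le r ht)
  have hsub : {s : ℝ | 0 ≤ s ∧ ENNReal.ofReal s < (h : ℝ≥0∞) + τ} ⊆
      {s : ℝ | 0 ≤ s ∧ ENNReal.ofReal s < (concat hR h l x π hc).ruinTime (x + l) ω} :=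
    fun s hs => ⟨hs.1, hs.2.trans_le hruin⟩
  refine le_trans ?_ (lintegral_mono_set hsub)
  rw [dividendMeasure_concat hR h l x π hc hm, Measure.restrict_add, lintegral_add_measure]
  have hS := measurableSet_lt_time ((h : ℝ≥0∞) + τ)
  refine add_le_add ?_ ?_
  · classical
    rw [Measure.restrict_smul, lintegral_smul_measure, setLIntegral_dirac' (by fun_prop) hS,
      if_pos]
    · simp
    · refine ⟨le_rfl, ?_⟩
      rw [ENNReal.ofReal_zero]
      exact lt_of_lt_of_le (by exact_mod_cast hh) le_self_add
  · rw [setLIntegral_map hS (by fun_prop) (by fun_prop), payoff,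
      ← lintegral_const_mul _ (by fun_prop)]
    refine le_trans (le_of_eq ?_) (lintegral_mono_set
      (s := {s : ℝ | 0 ≤ s ∧ ENNReal.ofReal s < τ}) fun s hs => ?_)
    · refine lintegral_congr fun s => ?_
      rw [← ENNReal.ofReal_mul (Real.exp_pos _).le, ← Real.exp_add]
      congr 2
      ring
    · refine ⟨add_nonneg hs.1 (NNReal.coe_nonneg h), ?_⟩
      rw [ENNReal.ofReal_add hs.1 (NNReal.coe_nonneg h), ENNReal.ofReal_coe_nnreal, add_comm]
      exact (ENNReal.add_lt_add_iff_left ENNReal.coe_ne_top).2 hs.2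

end Strategy
end RiskModel

/-! ### The law of the restarted scenario after no event or one event -/

section Scenarios

variable {m n : ℕ}

/-- Reduce the first waiting times of the classes in `s`. -/
def delayOn (s : Finset (Fin m)) (b : Fin m → ℝ≥0) (ω : Scenario m n) : Scenario m n := fun e =>
  if e.2 = 0 ∧ e.1 ∈ s then ((ω e).1 - b e.1, (ω e).2) else ω e

theorem measurable_delayOn (s : Finset (Fin m)) (b : Fin m → ℝ≥0) :
    Measurable (delayOn s b : Scenario m n → Scenario m n) := by
  refine measurable_pi_lambda _ fun e => ?_
  unfold delayOn
  split_ifs <;> fun_prop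

/-- Insert an event of class `k` in front of the others of this class. -/
def insertEvent (k : Fin m) (a : Mark n) (ω : Scenario m n) : Scenario m n := fun e =>
  if e.1 = k then (if e.2 = 0 then a else ω (k, e.2 - 1)) else ω e

theorem measurable_insertEvent (k : Fin m) :
    Measurable fun q : Mark n × Scenario m n => insertEvent k q.1 q.2 := by
  refine measurable_pi_lambda _ fun e => ?_
  unfold insertEvent
  split_ifs <;> fun_prop

end Scenarios

namespace RiskModel

variable {m n : ℕ} (M : RiskModel m n)

/-- Memorylessness of the exponential law, by translating its density. -/
theorem lintegral_gapLaw_delay (k : Fin m) (b : ℝ≥0) {g : ℝ≥0 → ℝ≥0∞} (hg : Measurable g) :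
    ∫⁻ w, (if b < w then g (w - b) else 0) ∂(M.gapLaw k) =
      ENNReal.ofReal (Real.exp (-(M.β k * b))) * ∫⁻ w, g w ∂(M.gapLaw k) := by
  have hm1 : Measurable fun w : ℝ≥0 => if b < w then g (w - b) else 0 :=
    Measurable.ite (measurableSet_lt measurable_const measurable_id)
      (hg.comp (by fun_prop)) measurable_const
  rw [M.lintegral_gapLaw k hm1, M.lintegral_gapLaw k hg,
    ← lintegral_const_mul _ (by fun_prop)]
  have h1 : ∀ s : ℝ, 0 ≤ s → ENNReal.ofReal (M.β k * Real.exp (-(M.β k * s))) *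
      (if b < s.toNNReal then g (s.toNNReal - b) else 0) =
      (Set.Ioi (b : ℝ)).indicator (fun s => ENNReal.ofReal (M.β k * Real.exp (-(M.β k * s))) *
        g (s - b).toNNReal) s := by
    intro s hs
    by_cases hb : (b : ℝ) < s
    · rw [if_pos (Real.lt_toNNReal_iff_coe_lt.2 hb),
        Set.indicator_of_mem (show s ∈ Set.Ioi (b : ℝ) from hb), NNReal.sub_def,
        Real.coe_toNNReal s hs]
    · rw [if_neg fun h => hb (Real.lt_toNNReal_iff_coe_lt.1 h),
        Set.indicator_of_notMem (show s ∉ Set.Ioi (b : ℝ) from hb), mul_zero]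
  rw [setLIntegral_congr_fun measurableSet_Ioi fun s hs => h1 s (le_of_lt hs),
    setLIntegral_indicator measurableSet_Ioi, Set.inter_eq_left.2
      (Set.Ioi_subset_Ioi (NNReal.coe_nonneg b)), ← lintegral_Ioi_shift]
  refine setLIntegral_congr_fun measurableSet_Ioi fun s _ => ?_
  rw [add_sub_cancel_left, ← mul_assoc, ← ENNReal.ofReal_mul (Real.exp_pos _).le, mul_left_comm,
    ← Real.exp_add]
  congr 4
  ring

theorem lintegral_markLaw_delay (k : Fin m) (b : ℝ≥0) {g : Mark n → ℝ≥0∞} (hg : Measurable g) :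
    ∫⁻ a, (if b < a.1 then g (a.1 - b, a.2) else 0) ∂(M.markLaw k) =
      ENNReal.ofReal (Real.exp (-(M.β k * b))) * ∫⁻ a, g a ∂(M.markLaw k) := by
  have hm1 : Measurable fun a : Mark n => if b < a.1 then g (a.1 - b, a.2) else 0 :=
    Measurable.ite (measurableSet_lt measurable_const measurable_fst)
      (hg.comp (by fun_prop)) measurable_const
  rw [markLaw_eq, lintegral_prod_symm _ hm1.aemeasurable, lintegral_prod_symm _ hg.aemeasurable,
    ← lintegral_const_mul _ (Measurable.lintegral_prod_left' hg)]
  refine lintegral_congr fun y => ?_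
  exact M.lintegral_gapLaw_delay k b (g := fun w => g (w, y)) (hg.comp (by fun_prop))

/-- Memorylessness for several classes with different elapsed times. Classes are added one at a
time, resampling the first mark of the new class. -/
theorem lintegral_delayOn (s : Finset (Fin m)) (b : Fin m → ℝ≥0) {f : Scenario m n → ℝ≥0∞}
    (hf : Measurable f) :
    ∫⁻ ω, (if ∀ k ∈ s, b k < (ω (k, 0)).1 then f (delayOn s b ω) else 0) ∂M.prob =
      (∏ k ∈ s, ENNReal.ofReal (Real.exp (-(M.β k * b k)))) * ∫⁻ ω, f ω ∂M.prob := by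
  classical
  have hmeas : ∀ s : Finset (Fin m), Measurable fun ω : Scenario m n =>
      if ∀ k ∈ s, b k < (ω (k, 0)).1 then f (delayOn s b ω) else 0 := fun s => by
    refine Measurable.ite ?_ (hf.comp (measurable_delayOn s b)) measurable_const
    have : {ω : Scenario m n | ∀ k ∈ s, b k < (ω (k, 0)).1} =
        ⋂ k ∈ s, {ω | b k < (ω (k, 0)).1} := by ext; simp
    rw [this]
    exact Finset.measurableSet_biInter _ fun k _ => measurableSet_lt measurable_const (by fun_prop)
  induction s using Finset.induction_on with
  | empty =>
    have : ∀ ω : Scenario m n, delayOn ∅ b ω = ω := fun ω => by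
      funext e
      simp [delayOn]
    simp [this]
  | insert k₀ s hk₀ ih =>
    rw [M.lintegral_prob_update (k₀, 0) (hmeas _), Finset.prod_insert hk₀, mul_assoc, ← ih,
      M.lintegral_prob_update (k₀, 0) (hmeas s), ← lintegral_const_mul _ (by
        have := (hmeas s).comp (measurable_update' (a := ((k₀, 0) : Fin m × ℕ)))
        exact Measurable.lintegral_prod_right' this)]
    refine lintegral_congr fun ω => ?_
    refine Eq.trans ?_ (M.lintegral_markLaw_delay k₀ (b k₀)
      ((hmeas s).comp (measurable_update ω (a := (k₀, 0)))))
    refine lintegral_congr fun a => ?_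
    have hne : ∀ k ∈ s, ((k, 0) : Fin m × ℕ) ≠ (k₀, 0) := fun k hk h => hk₀ (by
      rw [← (Prod.mk.inj h).1]; exact hk)
    have h1 : (∀ k ∈ insert k₀ s, b k < (Function.update ω (k₀, 0) a (k, 0)).1) ↔
        b k₀ < a.1 ∧ ∀ k ∈ s, b k < (ω (k, 0)).1 := by
      rw [Finset.forall_mem_insert, Function.update_self]
      refine and_congr_right fun _ => forall₂_congr fun k hk => ?_
      rw [Function.update_of_ne (hne k hk)]
    have h2 : (∀ k ∈ s, b k < (Function.update ω (k₀, 0) (a.1 - b k₀, a.2) (k, 0)).1) ↔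
        ∀ k ∈ s, b k < (ω (k, 0)).1 := forall₂_congr fun k hk => by
      rw [Function.update_of_ne (hne k hk)]
    have h3 : delayOn (insert k₀ s) b (Function.update ω (k₀, 0) a) =
        delayOn s b (Function.update ω (k₀, 0) (a.1 - b k₀, a.2)) := by
      funext e
      unfold delayOn
      by_cases he : e = (k₀, 0)
      · subst he
        simp [hk₀]
      · have : (e.2 = 0 ∧ e.1 ∈ insert k₀ s) ↔ (e.2 = 0 ∧ e.1 ∈ s) := by
          refine and_congr_right fun h0 => ?_
          rw [Finset.mem_insert, or_iff_right]
          exact fun h => he (Prod.ext h h0)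
        simp only [this, Function.update_of_ne he]
    simp only [h1, h2, h3]
    by_cases hb : b k₀ < a.1 <;> simp [hb]

/-- The marks within a class are independent and identically distributed, so putting a fresh mark in
front reproduces the law; this isolates the first event of the class. -/
theorem map_insertEvent_prob (k : Fin m) :
    ((M.markLaw k).prod M.prob).map (fun q => insertEvent k q.1 q.2) = M.prob := by
  classical
  refine Measure.eq_infinitePi _ fun s t ht => ?_
  rw [Measure.map_apply (measurable_insertEvent k)
    (MeasurableSet.pi s.countable_toSet fun i _ => ht i)]
  -- The new position of an old event; it is injective, misses exactly (k, 0), and preserves the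
  -- class and hence the mark law.
  let σ : Fin m × ℕ → Fin m × ℕ := fun e => if e.1 = k then (k, e.2 + 1) else e
  have hσ1 : ∀ e, (σ e).1 = e.1 := fun e => by
    simp only [σ]; split_ifs with h <;> simp [h]
  have hσinj : Function.Injective σ := by
    rintro ⟨a, i⟩ ⟨b, j⟩ h
    have h1 : a = b := (hσ1 (a, i)).symm.trans ((congrArg Prod.fst h).trans (hσ1 (b, j)))
    subst h1
    simp only [σ] at h
    split_ifs at h <;> simpa using h
  have hσsurj : ∀ e, e ≠ (k, 0) → ∃ e', σ e' = e := by
    rintro ⟨a, i⟩ he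
    by_cases ha : a = k
    · subst ha
      have hi : i ≠ 0 := fun h => he (by rw [h])
      exact ⟨(a, i - 1), by simp [σ]; omega⟩
    · exact ⟨(a, i), by simp [σ, ha]⟩
  have hins : ∀ (a : Mark n) (ω : Scenario m n) e, insertEvent k a ω (σ e) = ω e := by
    rintro a ω ⟨b, i⟩
    by_cases hb : b = k
    · subst hb; simp [insertEvent, σ]
    · simp [insertEvent, σ, hb]
  have hins0 : ∀ (a : Mark n) (ω : Scenario m n), insertEvent k a ω (k, 0) = a := fun a ω => by
    simp [insertEvent]
  set s' : Finset (Fin m × ℕ) := (s.erase (k, 0)).preimage σ hσinj.injOn with hs'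
  have hset : (fun q : Mark n × Scenario m n => insertEvent k q.1 q.2) ⁻¹' (Set.pi s t) =
      (if (k, 0) ∈ s then t (k, 0) else Set.univ) ×ˢ Set.pi (s' : Set (Fin m × ℕ))
        (fun e => t (σ e)) := by
    ext ⟨a, ω⟩
    simp only [Set.mem_preimage, Set.mem_pi, Finset.mem_coe, Set.mem_prod, hs',
      Finset.mem_preimage, Finset.mem_erase]
    constructor
    · intro h
      refine ⟨?_, fun e he => ?_⟩
      · split_ifs with hj
        · have := h _ hj
          rwa [hins0] at this
        · trivial
      · have := h _ he.2
        rwa [hins] at this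
    · rintro ⟨h1, h2⟩ e he
      by_cases hij : e = (k, 0)
      · subst hij
        rw [hins0]
        simpa [he] using h1
      · obtain ⟨e', rfl⟩ := hσsurj e hij
        rw [hins]
        exact h2 e' ⟨hij, he⟩
  rw [hset, Measure.prod_prod, prob, Measure.infinitePi_pi _ fun i _ => ht _]
  have hprod : ∏ e ∈ s', M.markLaw e.1 (t (σ e)) = ∏ e ∈ s.erase (k, 0), M.markLaw e.1 (t e) := by
    rw [← Finset.prod_preimage σ (s.erase (k, 0)) hσinj.injOn (fun e => M.markLaw e.1 (t e))]
    · exact Finset.prod_congr rfl fun e _ => by rw [hσ1]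
    · intro e he hne
      obtain ⟨e', he'⟩ := hσsurj e (Finset.mem_erase.1 he).1
      exact absurd ⟨e', he'⟩ hne
  rw [hprod]
  split_ifs with hj
  · rw [Finset.mul_prod_erase s (fun e => M.markLaw e.1 (t e)) hj]
  · rw [Finset.erase_eq_of_notMem hj, measure_univ, one_mul]

theorem lintegral_insertEvent (k : Fin m) {f : Scenario m n → ℝ≥0∞} (hf : Measurable f) :
    ∫⁻ ω, f ω ∂M.prob = ∫⁻ a, ∫⁻ ω, f (insertEvent k a ω) ∂M.prob ∂(M.markLaw k) := by
  conv_lhs => rw [← M.map_insertEvent_prob k]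
  rw [lintegral_map hf (measurable_insertEvent k), lintegral_prod]
  exact (hf.comp (measurable_insertEvent k)).aemeasurable

/-- The weight of the first waiting time if it is at most `h`. -/
theorem lintegral_gapLaw_weight (k : Fin m) (h : ℝ≥0) {c : ℝ} :
    ∫⁻ w : ℝ≥0, (if w ≤ h then ENNReal.ofReal (Real.exp (-c + M.β k * w)) else 0) ∂(M.gapLaw k) =
      ENNReal.ofReal (M.β k * h * Real.exp (-c)) := by
  have hm1 : Measurable fun w : ℝ≥0 =>
      if w ≤ h then ENNReal.ofReal (Real.exp (-c + M.β k * w)) else 0 :=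
    Measurable.ite (measurableSet_le measurable_id measurable_const) (by fun_prop) measurable_const
  rw [M.lintegral_gapLaw k hm1]
  have hβ := M.β_pos k
  have h1 : ∀ s : ℝ, 0 < s → ENNReal.ofReal (M.β k * Real.exp (-(M.β k * s))) *
      (if s.toNNReal ≤ h then ENNReal.ofReal (Real.exp (-c + M.β k * s.toNNReal)) else 0) =
      (Set.Iic (h : ℝ)).indicator (fun _ => ENNReal.ofReal (M.β k * Real.exp (-c))) s := by
    intro s hs
    by_cases hb : s ≤ h
    · rw [if_pos (Real.toNNReal_le_iff_le_coe.2 hb),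
        Set.indicator_of_mem (show s ∈ Set.Iic (h : ℝ) from hb), Real.coe_toNNReal s hs.le,
        ← ENNReal.ofReal_mul (by positivity), mul_assoc, ← Real.exp_add]
      congr 3
      ring
    · rw [if_neg fun h => hb (Real.toNNReal_le_iff_le_coe.1 h),
        Set.indicator_of_notMem (show s ∉ Set.Iic (h : ℝ) from hb), mul_zero]
  rw [setLIntegral_congr_fun measurableSet_Ioi fun s hs => h1 s hs,
    setLIntegral_indicator measurableSet_Iic, Set.Iic_inter_Ioi, setLIntegral_const,
    Real.volume_Ioc, sub_zero, ← ENNReal.ofReal_mul (by positivity)]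
  congr 1
  ring

end RiskModel

section Scenarios

variable {m n : ℕ}

/-- There is no event up to time `h`. -/
def NoEvent (h : ℝ≥0) (ω : Scenario m n) : Prop := ∀ k, h < (ω (k, 0)).1

/-- There is exactly one event up to time `h`, and it is of class `k`. -/
def OneEvent (k : Fin m) (h : ℝ≥0) (ω : Scenario m n) : Prop :=
  (ω (k, 0)).1 ≤ h ∧ h < eventTime k 1 ω ∧ ∀ k' ≠ k, h < (ω (k', 0)).1

theorem eventTime_zero (k : Fin m) (ω : Scenario m n) : eventTime k 0 ω = (ω (k, 0)).1 := by
  simp [eventTime]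

theorem eventCount_eq_zero {k : Fin m} {h : ℝ≥0} {ω : Scenario m n} (hk : h < (ω (k, 0)).1) :
    eventCount k h ω = 0 := by
  by_contra hcon
  have := (lt_eventCount_iff.1 (Nat.pos_of_ne_zero hcon)).2
  rw [eventTime_zero] at this
  exact absurd hk (not_lt.2 this)

theorem OneEvent.eventCount_eq_one {k : Fin m} {h : ℝ≥0} {ω : Scenario m n} (ho : OneEvent k h ω)
    (hω : NonExplosive ω) : eventCount k h ω = 1 := by
  have h0 : 0 < eventCount k h ω := lt_eventCount_iff.2 ⟨hω k, by rw [eventTime_zero]; exact ho.1⟩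
  have h1 : ¬1 < eventCount k h ω := fun hc =>
    absurd ho.2.1 (not_lt.2 (lt_eventCount_iff.1 hc).2)
  omega

theorem measurableSet_oneEvent (k : Fin m) (h : ℝ≥0) :
    MeasurableSet {ω : Scenario m n | OneEvent k h ω} := by
  have : {ω : Scenario m n | OneEvent k h ω} = {ω | (ω (k, 0)).1 ≤ h} ∩ ({ω | h < eventTime k 1 ω} ∩
      ⋂ k' : Fin m, ⋂ _ : k' ≠ k, {ω | h < (ω (k', 0)).1}) := by
    ext; simp [OneEvent]
  rw [this]
  refine (measurableSet_le (by fun_prop) measurable_const).inter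
    ((measurableSet_lt measurable_const (by fun_prop)).inter ?_)
  exact MeasurableSet.iInter fun k' => MeasurableSet.iInter fun _ =>
    measurableSet_lt measurable_const (by fun_prop)

theorem NoEvent.restart_eq {h : ℝ≥0} {ω : Scenario m n} (ho : NoEvent h ω) :
    restart h ω = delayOn Finset.univ (fun _ => h) ω := by
  funext ⟨k, i⟩
  by_cases hi : i = 0
  · subst hi
    simp [restart, delayOn, eventCount_eq_zero (ho k), eventTime_zero]
  · simp [restart, delayOn, eventCount_eq_zero (ho k), hi]

/-- Remaining waiting times after one event. -/
def remaining (k : Fin m) (h w : ℝ≥0) (k' : Fin m) : ℝ≥0 := if k' = k then h - w else h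

theorem eventTime_one_insertEvent (k : Fin m) (a : Mark n) (ω : Scenario m n) :
    eventTime k 1 (insertEvent k a ω) = a.1 + (ω (k, 0)).1 := by
  simp [eventTime, insertEvent, Finset.sum_range_succ]

theorem oneEvent_insertEvent_iff {k : Fin m} {h : ℝ≥0} {a : Mark n} {ω : Scenario m n} :
    OneEvent k h (insertEvent k a ω) ↔
      a.1 ≤ h ∧ ∀ k' ∈ Finset.univ, remaining k h a.1 k' < (ω (k', 0)).1 := by
  have h0 : insertEvent k a ω (k, 0) = a := by simp [insertEvent]
  have h1 : ∀ k' ≠ k, insertEvent k a ω (k', 0) = ω (k', 0) := fun k' hk => by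
    simp [insertEvent, hk]
  rw [OneEvent, h0, eventTime_one_insertEvent]
  refine and_congr_right fun ha => ?_
  constructor
  · rintro ⟨h2, h3⟩ k' -
    by_cases hk : k' = k
    · subst hk
      rw [remaining, if_pos rfl]
      exact (tsub_lt_iff_left ha).2 h2
    · rw [remaining, if_neg hk, ← h1 k' hk]
      exact h3 k' hk
  · intro h2
    refine ⟨?_, fun k' hk => ?_⟩
    · have := h2 k (Finset.mem_univ _)
      rw [remaining, if_pos rfl] at this
      exact (tsub_lt_iff_left ha).1 this
    · have := h2 k' (Finset.mem_univ _)
      rwa [remaining, if_neg hk, ← h1 k' hk] at this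

theorem OneEvent.restart_insertEvent {k : Fin m} {h : ℝ≥0} {a : Mark n} {ω : Scenario m n}
    (ho : OneEvent k h (insertEvent k a ω)) (hω : NonExplosive (insertEvent k a ω)) :
    restart h (insertEvent k a ω) = delayOn Finset.univ (remaining k h a.1) ω := by
  have ha := (oneEvent_insertEvent_iff.1 ho).1
  funext ⟨k', i⟩
  by_cases hk : k' = k
  · subst hk
    simp only [restart, ho.eventCount_eq_one hω, delayOn, remaining, Finset.mem_univ, and_true,
      if_true, eventTime_one_insertEvent]
    by_cases hi : i = 0
    · subst hi
      simp [insertEvent, tsub_tsub_eq_add_tsub_of_le ha, add_comm]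
    · have : 1 + i - 1 = i := by omega
      simp [hi, insertEvent]
  · have hc := eventCount_eq_zero (ho.2.2 k' hk)
    simp only [restart, hc, delayOn, remaining, Finset.mem_univ, and_true, if_neg hk, zero_add,
      eventTime_zero]
    by_cases hi : i = 0
    · subst hi
      simp [insertEvent, hk]
    · simp [hi, insertEvent, hk]

end Scenarios

namespace RiskModel

variable {m n : ℕ} (M : RiskModel m n)

open scoped Classical in
-- Without events, restarting just shortens every first waiting time by h, and the survival
-- probabilities of the classes multiply to exp (-β h).
theorem lintegral_noEvent (h : ℝ≥0) {f : Scenario m n → ℝ≥0∞} (hf : Measurable f) :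
    ∫⁻ ω, (if NoEvent h ω then f (restart h ω) else 0) ∂M.prob =
      ENNReal.ofReal (Real.exp (-(M.totalRate * h))) * ∫⁻ ω, f ω ∂M.prob := by
  have h1 : ENNReal.ofReal (Real.exp (-(M.totalRate * h))) =
      ∏ k : Fin m, ENNReal.ofReal (Real.exp (-(M.β k * h))) := by
    rw [← ENNReal.ofReal_prod_of_nonneg fun k _ => (Real.exp_pos _).le, ← Real.exp_sum,
      totalRate, Finset.sum_mul, Finset.sum_neg_distrib]
  rw [h1, ← M.lintegral_delayOn Finset.univ (fun _ => h) hf]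
  refine lintegral_congr fun ω => ?_
  have h2 : (∀ k ∈ Finset.univ, h < (ω (k, 0)).1) ↔ NoEvent h ω := by simp [NoEvent]
  simp only [h2]
  split_ifs with ho
  · rw [ho.restart_eq]
  · rfl

open scoped Classical in
theorem lintegral_oneEvent (k : Fin m) (h : ℝ≥0)
    {f : ((Fin n → Bool) × (Fin n → ℝ≥0)) × Scenario m n → ℝ≥0∞} (hf : Measurable f) :
    ∫⁻ ω, (if OneEvent k h ω then f ((ω (k, 0)).2, restart h ω) else 0) ∂M.prob =
      ENNReal.ofReal (M.β k * h * Real.exp (-(M.totalRate * h))) *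
        ∫⁻ y, ∫⁻ ω, f (y, ω) ∂M.prob ∂(M.hitLaw k) := by
  have hm1 : Measurable fun ω : Scenario m n =>
      if OneEvent k h ω then f ((ω (k, 0)).2, restart h ω) else 0 :=
    Measurable.ite (measurableSet_oneEvent k h)
      (hf.comp (Measurable.prodMk (by fun_prop) (measurable_restart h))) measurable_const
  have hmp : MeasurePreserving (fun q : Mark n × Scenario m n => insertEvent k q.1 q.2)
      ((M.markLaw k).prod M.prob) M.prob := ⟨measurable_insertEvent k, M.map_insertEvent_prob k⟩
  -- The count up to h equals one only in non-explosive scenarios, so non-explosion is transferred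
  -- to almost every scenario with an inserted event.
  have hae := Measure.ae_ae_of_ae_prod (hmp.quasiMeasurePreserving.ae M.ae_nonExplosive)
  have key : ∀ᵐ a ∂(M.markLaw k), (∫⁻ ω, (if OneEvent k h (insertEvent k a ω) then
      f ((insertEvent k a ω (k, 0)).2, restart h (insertEvent k a ω)) else 0) ∂M.prob) =
      (if a.1 ≤ h then ENNReal.ofReal (Real.exp (-(M.totalRate * h) + M.β k * a.1)) else 0) *
        ∫⁻ ω, f (a.2, ω) ∂M.prob := by
    filter_upwards [hae] with a ha
    have h0 : ∀ ω : Scenario m n, insertEvent k a ω (k, 0) = a := fun ω => by simp [insertEvent]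
    split_ifs with hah
    · have h1 : ENNReal.ofReal (Real.exp (-(M.totalRate * h) + M.β k * a.1)) =
          ∏ k' : Fin m, ENNReal.ofReal (Real.exp (-(M.β k' * remaining k h a.1 k'))) := by
        rw [← ENNReal.ofReal_prod_of_nonneg fun k _ => (Real.exp_pos _).le, ← Real.exp_sum]
        congr 2
        have h2 : ∀ k', -(M.β k' * (remaining k h a.1 k' : ℝ)) =
            -(M.β k' * h) + if k' = k then M.β k * a.1 else 0 := by
          intro k'
          unfold remaining
          split_ifs with hk
          · subst hk
            rw [NNReal.coe_sub hah]; ring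
          · ring
        rw [Finset.sum_congr rfl fun k' _ => h2 k', Finset.sum_add_distrib,
          Finset.sum_neg_distrib, ← Finset.sum_mul, Finset.sum_ite_eq', if_pos (Finset.mem_univ _),
          totalRate]
      rw [h1, ← M.lintegral_delayOn Finset.univ (remaining k h a.1) (f := fun ω => f (a.2, ω))
        (hf.comp (by fun_prop))]
      refine lintegral_congr_ae ?_
      filter_upwards [ha] with ω hω
      by_cases ho : OneEvent k h (insertEvent k a ω)
      · rw [if_pos ho, if_pos (oneEvent_insertEvent_iff.1 ho).2, h0, ho.restart_insertEvent hω]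
      · rw [if_neg ho, if_neg fun h => ho (oneEvent_insertEvent_iff.2 ⟨hah, h⟩)]
    · rw [zero_mul]
      refine (lintegral_congr fun ω => ?_).trans lintegral_zero
      rw [if_neg fun ho => hah (oneEvent_insertEvent_iff.1 ho).1]
  rw [M.lintegral_insertEvent k hm1, lintegral_congr_ae key, markLaw_eq,
    lintegral_prod_mul (f := fun w : ℝ≥0 => if w ≤ h then
      ENNReal.ofReal (Real.exp (-(M.totalRate * h) + M.β k * w)) else 0)
      (g := fun y => ∫⁻ ω, f (y, ω) ∂M.prob), M.lintegral_gapLaw_weight]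
  · exact (Measurable.ite (measurableSet_le measurable_id measurable_const) (by fun_prop)
      measurable_const).aemeasurable
  · exact (Measurable.lintegral_prod_right' hf).aemeasurable

namespace Strategy

variable {M} {R : Fin n → ℝ≥0 → ℝ≥0}

theorem NoEvent.claims (hR : M.IsContract R) {h : ℝ≥0} {ω : Scenario m n} (ho : NoEvent h ω) :
    claimsUpTo R h ω = 0 ∧ ∑ j, R j (lineClaims j h ω) = 0 := by
  have hc : ∀ k, eventCount k h ω = 0 := fun k => eventCount_eq_zero (ho k)
  simp [claimsUpTo, lineClaims, hc, hR.zero]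

theorem OneEvent.claims (hR : M.IsContract R) {k : Fin m} {h : ℝ≥0} {ω : Scenario m n}
    (ho : OneEvent k h ω) (hω : NonExplosive ω) :
    claimsUpTo R h ω = retained R (ω (k, 0)).2 ∧
      ∑ j, R j (lineClaims j h ω) = retained R (ω (k, 0)).2 := by
  have hc : ∀ k' ≠ k, eventCount k' h ω = 0 := fun k' hk => eventCount_eq_zero (ho.2.2 k' hk)
  have h1 := ho.eventCount_eq_one hω
  have hl : ∀ j, lineClaims j h ω = if (ω (k, 0)).2.1 j = true then (ω (k, 0)).2.2 j else 0 := by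
    intro j
    unfold lineClaims
    rw [Finset.sum_eq_single k (fun k' _ hk => by simp [hc k' hk]) (by simp), h1]
    simp
  constructor
  · rw [claimsUpTo, Finset.sum_eq_single k (fun k' _ hk => by simp [hc k' hk]) (by simp), h1]
    simp
  · rw [retained]
    refine Finset.sum_congr rfl fun j _ => ?_
    rw [hl]
    split_ifs
    exacts [rfl, hR.zero j]

open scoped Classical in
/-- Lower bound for the optimal value by waiting for a short time. -/
theorem le_optimalValue_add (hm : 1 ≤ m) (hR : M.IsContract R) (hp : 0 ≤ M.netPremium R)
    {h : ℝ≥0} (hh : 0 < h) (l x : ℝ≥0) (π : ℕ → M.Strategy) {c : ℝ≥0 → ℕ} (hc : Measurable c)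
    {z : ℕ → ℝ≥0} (hz : ∀ y, z (c y) ≤ y) {g : ℕ → Scenario m n → ℝ≥0∞}
    (hg : ∀ i, Measurable (g i)) (hgle : ∀ i ω, g i ω ≤ (π i).payoff (z i) ω) :
    ENNReal.ofReal (Real.exp (-(M.totalRate * h))) * (l + ENNReal.ofReal (Real.exp (-(M.δ * h))) *
      ∫⁻ ω, g (c (x + (M.netPremium R).toNNReal * h)) ω ∂M.prob) +
    ∑ k, ENNReal.ofReal (M.β k * h * Real.exp (-(M.totalRate * h))) * ∫⁻ y,
      (if retained R y ≤ x then ENNReal.ofReal (Real.exp (-(M.δ * h))) * ∫⁻ ω,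
        g (c (x + (M.netPremium R).toNNReal * h - retained R y)) ω ∂M.prob else 0) ∂(M.hitLaw k) ≤
    M.optimalValue (x + l) := by
  set e := ENNReal.ofReal (Real.exp (-(M.δ * h))) with he
  set y₀ := x + (M.netPremium R).toNNReal * h with hy₀
  refine le_trans ?_ (le_iSup (fun π : M.Strategy => π.value (x + l)) (concat hR h l x π hc))
  have hgu : Measurable fun q : ℕ × Scenario m n => g q.1 q.2 :=
    measurable_from_prod_countable_right hg
  set f₀ : Scenario m n → ℝ≥0∞ := fun ω => l + e * g (c y₀) ω with hf₀
  set f₁ : ((Fin n → Bool) × (Fin n → ℝ≥0)) × Scenario m n → ℝ≥0∞ := fun q =>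
    if retained R q.1 ≤ x then e * g (c (y₀ - retained R q.1)) q.2 else 0 with hf₁
  have hmret : Measurable fun q : ((Fin n → Bool) × (Fin n → ℝ≥0)) × Scenario m n =>
      retained R q.1 := (measurable_retained hR.measurable).comp measurable_fst
  have hmf₀ : Measurable f₀ := ((hg _).const_mul e).const_add _
  have hmf₁ : Measurable f₁ := by
    refine Measurable.ite (measurableSet_le hmret measurable_const) (Measurable.const_mul ?_ _)
      measurable_const
    exact hgu.comp ((hc.comp (hmret.const_sub y₀)).prodMk measurable_snd)
  have e0 : ∫⁻ ω, f₀ ω ∂M.prob = l + e * ∫⁻ ω, g (c y₀) ω ∂M.prob := by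
    rw [hf₀, lintegral_add_left measurable_const, lintegral_const_mul _ (hg _)]
    simp
  have e1 : ∀ y, ∫⁻ ω, f₁ (y, ω) ∂M.prob = if retained R y ≤ x then e *
      ∫⁻ ω, g (c (y₀ - retained R y)) ω ∂M.prob else 0 := fun y => by
    simp only [hf₁]
    split_ifs
    · rw [lintegral_const_mul _ (hg _)]
    · simp
  simp_rw [← e0, ← e1, ← M.lintegral_noEvent h hmf₀, ← fun k => M.lintegral_oneEvent k h hmf₁]
  have hm1 : ∀ k, Measurable fun ω : Scenario m n =>
      if OneEvent k h ω then f₁ ((ω (k, 0)).2, restart h ω) else 0 := fun k =>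
    Measurable.ite (measurableSet_oneEvent k h)
      (hmf₁.comp (Measurable.prodMk (by fun_prop) (measurable_restart h))) measurable_const
  rw [← lintegral_finsetSum _ fun k _ => hm1 k,
    ← lintegral_add_right _ (Finset.measurable_sum _ fun k _ => hm1 k), value_eq]
  -- The events on the left are mutually exclusive. Scenarios with two or more events up to h, or
  -- with a claim exceeding x, are simply bounded below by zero.
  refine lintegral_mono_ae ?_
  filter_upwards [M.ae_nonExplosive] with ω hω
  have hpay := fun hx hcl => payoff_concat_ge hR h l x π hc hm hh hp (ω := ω) hx hcl
  have hgp : ∀ y, g (c y) (restart h ω) ≤ (π (c y)).payoff y (restart h ω) := fun y =>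
    (hgle _ _).trans ((π (c y)).payoff_mono _ (hz y))
  by_cases h0 : NoEvent h ω
  · have hk : ∀ k, ¬OneEvent k h ω := fun k ho => absurd (h0 k) (not_lt.2 ho.1)
    obtain ⟨h1, h2⟩ := NoEvent.claims hR h0
    have hw : M.waitSurplus R h x ω = y₀ := by rw [waitSurplus, h2, tsub_zero]
    have := hpay (by rw [h1]; exact zero_le) (by rw [h1, h2])
    rw [hw] at this
    simp only [if_pos h0, hk, if_false, Finset.sum_const_zero, add_zero, hf₀]
    exact (add_le_add le_rfl (mul_le_mul_right (hgp y₀) _)).trans this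
  · rw [if_neg h0, zero_add]
    by_cases hk : ∃ k, OneEvent k h ω
    · obtain ⟨k, hk⟩ := hk
      have huniq : ∀ k' ≠ k, ¬OneEvent k' h ω := fun k' hne ho =>
        absurd (hk.2.2 k' hne) (not_lt.2 ho.1)
      rw [Finset.sum_eq_single k (fun k' _ hne => if_neg (huniq k' hne)) (by simp), if_pos hk]
      simp only [hf₁]
      split_ifs with hx
      · obtain ⟨h1, h2⟩ := OneEvent.claims hR hk hω
        have hw : M.waitSurplus R h x ω = y₀ - retained R (ω (k, 0)).2 := by
          rw [waitSurplus, h2]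
        have := hpay (by rw [h1]; exact hx) (by rw [h1, h2])
        rw [hw] at this
        exact (mul_le_mul_right (hgp _) _).trans (le_add_self.trans this)
      · exact zero_le
    · push Not at hk
      simp [hk]

end Strategy
end RiskModel

/-! ### Dynamic programming: the value function is a supersolution in L -/

namespace RiskModel

variable {m n : ℕ} {M : RiskModel m n}

/-- Never changing the contract and never paying dividends. -/
def constantStrategy {R : Fin n → ℝ≥0 → ℝ≥0} (hR : M.IsContract R) : M.Strategy where
  R j _ _ := R j
  R_mem j _ _ := hR j
  R_measurable j := (hR.measurable j).comp (measurable_snd.comp measurable_snd)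
  R_past _ _ _ := measurable_const
  D _ _ := 0
  D_zero _ := rfl
  D_mono _ := monotone_const
  D_leftCont _ _ := continuousWithinAt_const
  D_past _ := measurable_const

theorem monotone_optimalValue : Monotone M.optimalValue := fun _ _ h =>
  iSup_mono fun π => π.value_mono h

theorem optimalValue_lt_top (hm : 1 ≤ m) (x : ℝ≥0) : M.optimalValue x < ⊤ := by
  obtain ⟨k, -, hk⟩ := exists_optimalValue_le (M := M) hm
  exact (hk x).trans_lt ENNReal.ofReal_lt_top

/-- A measurable minorant with the same lower integral replaces the payoff of an almost optimal
strategy, so measurability of payoffs is never required. -/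
theorem exists_payoff_minorant [Nonempty M.Strategy] (hm : 1 ≤ m) (x : ℝ≥0) {ε : ℝ≥0∞}
    (hε : ε ≠ 0) : ∃ (π : M.Strategy) (g : Scenario m n → ℝ≥0∞), Measurable g ∧
      (∀ ω, g ω ≤ π.payoff x ω) ∧ M.optimalValue x ≤ ∫⁻ ω, g ω ∂M.prob + ε := by
  obtain ⟨π, hπ⟩ : ∃ π : M.Strategy, M.optimalValue x ≤ π.value x + ε := by
    by_cases h0 : M.optimalValue x = 0
    · exact ⟨Classical.arbitrary _, by rw [h0]; exact zero_le⟩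
    · obtain ⟨π, hπ⟩ := lt_iSup_iff.1 (ENNReal.sub_lt_self (optimalValue_lt_top hm x).ne h0 hε)
      exact ⟨π, tsub_le_iff_right.1 hπ.le⟩
  obtain ⟨g, hg, hle, hint⟩ := exists_measurable_le_lintegral_eq M.prob (π.payoff x)
  exact ⟨π, g, hg, hle, by rwa [← hint, ← π.value_eq]⟩

open scoped Classical in
/-- Lower bound for the optimal value by waiting for a short time and then continuing almost
optimally. -/
theorem wait_le_optimalValue (hm : 1 ≤ m) {R : Fin n → ℝ≥0 → ℝ≥0} (hR : M.IsContract R)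
    (hp : 0 ≤ M.netPremium R) {h : ℝ≥0} (hh : 0 < h) (l x : ℝ≥0) {f : ℝ≥0 → ℝ≥0∞}
    (hf : ∀ ε : ℝ≥0, 0 < ε → ∃ (c : ℝ≥0 → ℕ) (z : ℕ → ℝ≥0), Measurable c ∧ (∀ y, z (c y) ≤ y) ∧
      ∀ y ≤ x + (M.netPremium R).toNNReal * h, f y ≤ M.optimalValue (z (c y)) + ε) :
    ENNReal.ofReal (Real.exp (-(M.totalRate * h))) * (l + ENNReal.ofReal (Real.exp (-(M.δ * h))) *
      f (x + (M.netPremium R).toNNReal * h)) +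
    ∑ k, ENNReal.ofReal (M.β k * h * Real.exp (-(M.totalRate * h))) * ∫⁻ y,
      (if retained R y ≤ x then ENNReal.ofReal (Real.exp (-(M.δ * h))) *
        f (x + (M.netPremium R).toNNReal * h - retained R y) else 0) ∂(M.hitLaw k) ≤
    M.optimalValue (x + l) := by
  have : Nonempty M.Strategy := ⟨constantStrategy hR⟩
  have hβ := M.totalRate_pos hm
  have hδ := M.δ_pos
  set y₀ := x + (M.netPremium R).toNNReal * h
  set a := ENNReal.ofReal (Real.exp (-(M.totalRate * h)))
  set e := ENNReal.ofReal (Real.exp (-(M.δ * h)))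
  set b : Fin m → ℝ≥0∞ := fun k => ENNReal.ofReal (M.β k * h * Real.exp (-(M.totalRate * h)))
  have ha : a ≤ 1 := ENNReal.ofReal_le_one.2 (Real.exp_le_one_iff.2 (by
    have : 0 ≤ M.totalRate * h := by positivity
    linarith))
  have he : e ≤ 1 := ENNReal.ofReal_le_one.2 (Real.exp_le_one_iff.2 (by
    have : 0 ≤ M.δ * h := by positivity
    linarith))
  -- One ε is lost by passing to the grid point below the surplus, another by using an almost
  -- optimal strategy there. The total weight of these losses is finite and does not depend on ε.
  have key : ∀ ε : ℝ≥0, 0 < ε → a * (l + e * f y₀) + ∑ k, b k * ∫⁻ y,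
      (if retained R y ≤ x then e * f (y₀ - retained R y) else 0) ∂(M.hitLaw k) ≤
      M.optimalValue (x + l) + (1 + ∑ k, b k) * (ε + ε) := by
    intro ε hε
    obtain ⟨c, z, hc, hz, hfc⟩ := hf ε hε
    choose π g hg hgle hgv using fun i : ℕ =>
      exists_payoff_minorant (M := M) hm (z i) (ENNReal.coe_ne_zero.2 hε.ne')
    refine le_trans ?_ (add_le_add (Strategy.le_optimalValue_add hm hR hp hh l x π hc hz hg hgle)
      le_rfl)
    have hfg : ∀ y ≤ y₀, e * f y ≤ e * ∫⁻ ω, g (c y) ω ∂M.prob + (ε + ε) := by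
      intro y hy
      calc e * f y ≤ e * (∫⁻ ω, g (c y) ω ∂M.prob + (ε + ε)) := by
            rw [← add_assoc]
            exact mul_le_mul_right ((hfc y hy).trans (add_le_add (hgv _) le_rfl)) _
        _ ≤ _ := by
            rw [mul_add]
            exact add_le_add le_rfl (mul_le_of_le_one_left' he)
    have h1 : a * (l + e * f y₀) ≤ a * (l + e * ∫⁻ ω, g (c y₀) ω ∂M.prob) + (ε + ε) := by
      calc a * (l + e * f y₀) ≤ a * (l + e * ∫⁻ ω, g (c y₀) ω ∂M.prob + (ε + ε)) := by
            rw [add_assoc]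
            exact mul_le_mul_right (add_le_add le_rfl (hfg _ le_rfl)) _
        _ ≤ _ := by
            rw [mul_add]
            exact add_le_add le_rfl (mul_le_of_le_one_left' ha)
    have h2 : ∀ k, b k * ∫⁻ y, (if retained R y ≤ x then e * f (y₀ - retained R y) else 0)
        ∂(M.hitLaw k) ≤ b k * ∫⁻ y, (if retained R y ≤ x then
          e * ∫⁻ ω, g (c (y₀ - retained R y)) ω ∂M.prob else 0) ∂(M.hitLaw k) +
        b k * (ε + ε) := by
      intro k
      rw [← mul_add]
      refine mul_le_mul_right ?_ _
      calc _ ≤ ∫⁻ y, ((if retained R y ≤ x then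
          e * ∫⁻ ω, g (c (y₀ - retained R y)) ω ∂M.prob else 0) + (ε + ε)) ∂(M.hitLaw k) := by
            refine lintegral_mono fun y => ?_
            simp only
            split_ifs
            · exact hfg _ tsub_le_self
            · exact zero_le
        _ = _ := by
            rw [lintegral_add_right _ measurable_const]
            simp
    refine (add_le_add h1 (Finset.sum_le_sum fun k _ => h2 k)).trans (le_of_eq ?_)
    rw [Finset.sum_add_distrib, ← Finset.sum_mul, add_mul, one_mul]
    ring
  have hfin : (1 + ∑ k, b k) ≠ ⊤ := by
    simp [b]
  have hlim : Tendsto (fun ε : ℝ≥0 => M.optimalValue (x + l) + (1 + ∑ k, b k) * (ε + ε)) (𝓝[>] 0)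
      (𝓝 (M.optimalValue (x + l))) := by
    have h0 : Tendsto (fun ε : ℝ≥0 => ((ε + ε : ℝ≥0) : ℝ≥0∞)) (𝓝[>] 0) (𝓝 0) := by
      have : Continuous fun ε : ℝ≥0 => ((ε + ε : ℝ≥0) : ℝ≥0∞) :=
        ENNReal.continuous_coe.comp (by fun_prop)
      simpa using (this.tendsto 0).mono_left nhdsWithin_le_nhds
    have h1 := (ENNReal.Tendsto.const_mul h0 (Or.inr hfin)).const_add (M.optimalValue (x + l))
    simpa using h1
  exact ge_of_tendsto hlim (by filter_upwards [self_mem_nhdsWithin] with ε hε using key ε hε)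

/-- The optimal value as a real function. -/
def optimalValueReal (M : RiskModel m n) (x : ℝ≥0) : ℝ := (M.optimalValue x).toReal

theorem ofReal_optimalValueReal (hm : 1 ≤ m) (x : ℝ≥0) :
    ENNReal.ofReal (M.optimalValueReal x) = M.optimalValue x :=
  ENNReal.ofReal_toReal (optimalValue_lt_top hm x).ne

theorem optimalValueReal_nonneg (x : ℝ≥0) : 0 ≤ M.optimalValueReal x := ENNReal.toReal_nonneg

theorem monotone_optimalValueReal (hm : 1 ≤ m) : Monotone M.optimalValueReal := fun _ y h =>
  ENNReal.toReal_mono (optimalValue_lt_top hm y).ne (monotone_optimalValue h)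

/-- Only the scenarios without events are kept. The surplus then takes one known value y₀, so a
two-valued selection suffices and continuity of the value function is not yet needed. -/
theorem exp_mul_le_optimalValueReal (hm : 1 ≤ m) {R : Fin n → ℝ≥0 → ℝ≥0} (hR : M.IsContract R)
    (hp : 0 ≤ M.netPremium R) {h : ℝ≥0} (hh : 0 < h) (l x : ℝ≥0) :
    Real.exp (-(M.totalRate * h)) * (l + Real.exp (-(M.δ * h)) *
      M.optimalValueReal (x + (M.netPremium R).toNNReal * h)) ≤ M.optimalValueReal (x + l) := by
  classical
  set y₀ := x + (M.netPremium R).toNNReal * h with hy₀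
  have key := wait_le_optimalValue hm hR hp hh l x
    (f := fun y => if y₀ ≤ y then M.optimalValue y₀ else 0) (fun ε _ =>
      ⟨fun y => if y₀ ≤ y then 1 else 0, fun i => if i = 1 then y₀ else 0,
        Measurable.ite measurableSet_Ici measurable_const measurable_const,
        fun y => by by_cases hy : y₀ ≤ y <;> simp [hy],
        fun y _ => by by_cases hy : y₀ ≤ y <;> simp [hy]⟩)
  have key' := le_self_add.trans key
  rw [← hy₀, if_pos le_rfl, ← ofReal_optimalValueReal hm, ← ofReal_optimalValueReal hm,
    ← ENNReal.ofReal_mul (Real.exp_pos _).le, ← ENNReal.ofReal_coe_nnreal,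
    ← ENNReal.ofReal_add (NNReal.coe_nonneg l) (mul_nonneg (Real.exp_pos _).le (optimalValueReal_nonneg _)),
    ← ENNReal.ofReal_mul (Real.exp_pos _).le,
    ENNReal.ofReal_le_ofReal_iff (optimalValueReal_nonneg _)] at key'
  exact key'

/-- Pay l at once and continue almost optimally from x after a vanishing waiting time; the contract
used while waiting must have nonnegative premium. -/
theorem add_le_optimalValueReal (hm : 1 ≤ m)
    (hM : ∃ R : Fin n → ℝ≥0 → ℝ≥0, M.IsContract R ∧ 0 ≤ M.netPremium R) (x l : ℝ≥0) :
    M.optimalValueReal x + l ≤ M.optimalValueReal (x + l) := by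
  obtain ⟨R, hR, hp⟩ := hM
  have hc : Continuous fun h : ℝ≥0 => Real.exp (-(M.totalRate * h)) * (l + Real.exp (-(M.δ * h)) *
      M.optimalValueReal x) := by fun_prop
  have hlim := (hc.tendsto 0).mono_left (nhdsWithin_le_nhds (s := Set.Ioi 0))
  simp only [NNReal.coe_zero, mul_zero, neg_zero, Real.exp_zero, one_mul] at hlim
  rw [add_comm]
  refine le_of_tendsto hlim ?_
  filter_upwards [self_mem_nhdsWithin] with h hh
  refine le_trans ?_ (exp_mul_le_optimalValueReal hm hR hp hh l x)
  have := monotone_optimalValueReal (M := M) hm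
    (le_self_add : x ≤ x + (M.netPremium R).toNNReal * h)
  gcongr

theorem optimalValueReal_increment (hm : 1 ≤ m)
    (hM : ∃ R : Fin n → ℝ≥0 → ℝ≥0, M.IsContract R ∧ 0 ≤ M.netPremium R) {x y : ℝ≥0} (h : x ≤ y) :
    (y : ℝ) - x ≤ M.optimalValueReal y - M.optimalValueReal x := by
  have := add_le_optimalValueReal hm hM x (y - x)
  rw [add_tsub_cancel_of_le h, NNReal.coe_sub h] at this
  linarith

theorem setIntegral_shift_le {v : ℝ≥0 → ℝ} (hv : Monotone v) (h0 : 0 ≤ v 0) (G : Measure ℝ≥0)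
    [IsProbabilityMeasure G] (x : ℝ≥0) : ∫ a in Set.Iic x, v (x - a) ∂G ≤ v x := by
  have hx : 0 ≤ v x := h0.trans (hv zero_le)
  have h1 : ∫ a in Set.Iic x, v (x - a) ∂G ≤ ∫ _ in Set.Iic x, v x ∂G :=
    integral_mono_of_nonneg (ae_of_all _ fun a => h0.trans (hv zero_le)) (integrable_const _)
      (ae_of_all _ fun a => hv tsub_le_self)
  rw [setIntegral_const, smul_eq_mul] at h1
  exact h1.trans (mul_le_of_le_one_left hx measureReal_le_one)

theorem exp_sub_one_le {t : ℝ} : Real.exp t - 1 ≤ t * Real.exp t := by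
  have h1 := Real.add_one_le_exp (-t)
  have h2 := mul_le_mul_of_nonneg_right h1 (Real.exp_pos t).le
  rw [← Real.exp_add, neg_add_cancel, Real.exp_zero] at h2
  linarith

/-- If no premium rate is positive, the identity passes the verification argument; the reverse
inequality is immediate payment of the whole surplus. -/
theorem optimalValueReal_eq_self (hm : 1 ≤ m)
    (hM : ∃ R : Fin n → ℝ≥0 → ℝ≥0, M.IsContract R ∧ 0 ≤ M.netPremium R)
    (hp : ∀ R, M.IsContract R → M.netPremium R ≤ 0) (x : ℝ≥0) : M.optimalValueReal x = x := by
  refine le_antisymm ?_ ?_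
  · rw [← ENNReal.ofReal_le_ofReal_iff (NNReal.coe_nonneg x), ofReal_optimalValueReal hm]
    refine iSup_le fun π => π.value_le hm (v := fun z => z) (dv := fun _ => 1) (C := 1)
      ⟨fun z => hasDerivAt_id z, continuous_const, fun _ _ => le_rfl, fun z hz => hz⟩
      (fun z _ => ⟨by linarith, le_rfl⟩) (fun R hR z => ?_) x
    have := M.isProbabilityMeasure_claimLaw hm hR.measurable
    have h1 := setIntegral_shift_le (v := fun y : ℝ≥0 => (y : ℝ)) (fun _ _ h => by exact_mod_cast h)
      le_rfl (M.claimLaw R) z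
    have h2 := mul_le_mul_of_nonneg_left h1 (M.totalRate_pos hm).le
    have h3 := mul_nonneg M.δ_pos.le (NNReal.coe_nonneg z)
    have h4 := hp R hR
    rw [generator]
    change _ + M.totalRate * ∫ a in Set.Iic z, ((z - a : ℝ≥0) : ℝ) ∂(M.claimLaw R) ≤ 0
    linarith
  · have := optimalValueReal_increment hm hM (zero_le (a := x))
    have h0 := optimalValueReal_nonneg (M := M) 0
    rw [NNReal.coe_zero] at this
    linarith

/-- Starting from x, a surplus of x + s is reached after the time s / p_R if no event occurs. The
cost of waiting is an exponential in s, which yields the local Lipschitz bound. -/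
theorem optimalValueReal_add_le (hm : 1 ≤ m) {R : Fin n → ℝ≥0 → ℝ≥0} (hR : M.IsContract R)
    (hp : 0 < M.netPremium R) (x s : ℝ≥0) : M.optimalValueReal (x + s) ≤
      Real.exp ((M.δ + M.totalRate) / M.netPremium R * s) * M.optimalValueReal x := by
  rcases eq_or_ne s 0 with rfl | hs
  · simp
  have hp' : 0 < (M.netPremium R).toNNReal := Real.toNNReal_pos.2 hp
  have h1 := exp_mul_le_optimalValueReal hm hR hp.le
    (h := s / (M.netPremium R).toNNReal) (by positivity) 0 x
  rw [mul_div_cancel₀ _ hp'.ne', add_zero, NNReal.coe_zero, zero_add, ← mul_assoc, ← Real.exp_add,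
    NNReal.coe_div, Real.coe_toNNReal _ hp.le] at h1
  have h2 := mul_le_mul_of_nonneg_left h1
    (Real.exp_pos ((M.δ + M.totalRate) / M.netPremium R * s)).le
  rw [← mul_assoc, ← Real.exp_add] at h2
  rwa [show (M.δ + M.totalRate) / M.netPremium R * s + (-(M.totalRate * (s / M.netPremium R)) +
    -(M.δ * (s / M.netPremium R))) = 0 by ring, Real.exp_zero, one_mul] at h2

theorem locallyLipschitz_optimalValueReal (hm : 1 ≤ m)
    (hM : ∃ R : Fin n → ℝ≥0 → ℝ≥0, M.IsContract R ∧ 0 ≤ M.netPremium R) :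
    LocallyLipschitz M.optimalValueReal := by
  by_cases hpos : ∀ R, M.IsContract R → M.netPremium R ≤ 0
  · rw [show M.optimalValueReal = fun x : ℝ≥0 => (x : ℝ) from
      funext (optimalValueReal_eq_self hm hM hpos)]
    exact LipschitzWith.locallyLipschitz (K := 1) (LipschitzWith.of_dist_le_mul fun x y => by
      rw [NNReal.coe_one, one_mul]; rfl)
  push Not at hpos
  obtain ⟨R, hR, hp⟩ := hpos
  have hδ := M.δ_pos
  have hβ := M.totalRate_pos hm
  intro x
  set κ := (M.δ + M.totalRate) / M.netPremium R with hκ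
  have hκ0 : 0 < κ := by positivity
  set B := M.optimalValueReal (x + 1) with hB
  have hB0 : 0 ≤ B := optimalValueReal_nonneg _
  have key : ∀ y z : ℝ≥0, y ≤ z → z ≤ x + 1 → M.optimalValueReal z - M.optimalValueReal y ≤
      κ * Real.exp (κ * (x + 1)) * B * ((z : ℝ) - y) := by
    intro y z hyz hz
    have h1 := optimalValueReal_add_le hm hR hp y (z - y)
    rw [add_tsub_cancel_of_le hyz, NNReal.coe_sub hyz] at h1
    have hyz' : (y : ℝ) ≤ z := by exact_mod_cast hyz
    have hz' : (z : ℝ) ≤ x + 1 := by exact_mod_cast hz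
    have hy0 := NNReal.coe_nonneg y
    have h2 : M.optimalValueReal y ≤ B := monotone_optimalValueReal hm (hyz.trans hz)
    have h3 : Real.exp (κ * (z - y)) - 1 ≤ κ * (z - y) * Real.exp (κ * (x + 1)) := by
      refine exp_sub_one_le.trans (mul_le_mul_of_nonneg_left (Real.exp_le_exp.2
        (mul_le_mul_of_nonneg_left ?_ hκ0.le)) (mul_nonneg hκ0.le (sub_nonneg.2 hyz')))
      linarith
    have h4 : 0 ≤ κ * (z - y) * Real.exp (κ * (x + 1)) :=
      mul_nonneg (mul_nonneg hκ0.le (sub_nonneg.2 hyz')) (Real.exp_pos _).le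
    calc _ ≤ (Real.exp (κ * (z - y)) - 1) * M.optimalValueReal y := by linarith
      _ ≤ (κ * (z - y) * Real.exp (κ * (x + 1))) * M.optimalValueReal y :=
        mul_le_mul_of_nonneg_right h3 (optimalValueReal_nonneg _)
      _ ≤ (κ * (z - y) * Real.exp (κ * (x + 1))) * B := mul_le_mul_of_nonneg_left h2 h4
      _ = _ := by ring
  have hC0 : 0 ≤ κ * Real.exp (κ * (x + 1)) * B := by positivity
  refine ⟨(κ * Real.exp (κ * (x + 1)) * B).toNNReal, Set.Iic (x + 1),
    Iic_mem_nhds (lt_add_one x), LipschitzOnWith.of_dist_le_mul fun y hy z hz => ?_⟩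
  rw [Real.coe_toNNReal _ hC0]
  have hmono := monotone_optimalValueReal (M := M) hm
  rcases le_total y z with h | h
  · rw [dist_comm, dist_comm y z, Real.dist_eq, abs_of_nonneg (sub_nonneg.2 (hmono h)),
      NNReal.dist_eq, abs_of_nonneg (sub_nonneg.2 (by exact_mod_cast h))]
    exact key y z h hz
  · rw [Real.dist_eq, abs_of_nonneg (sub_nonneg.2 (hmono h)),
      NNReal.dist_eq, abs_of_nonneg (sub_nonneg.2 (by exact_mod_cast h))]
    exact key z y h hy

theorem classL_optimalValueReal (hm : 1 ≤ m)
    (hM : ∃ R : Fin n → ℝ≥0 → ℝ≥0, M.IsContract R ∧ 0 ≤ M.netPremium R) :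
    ClassL M.optimalValueReal := by
  refine ⟨locallyLipschitz_optimalValueReal hm hM,
    fun x y h => optimalValueReal_increment hm hM h.le, ?_⟩
  obtain ⟨k, hk0, hk⟩ := exists_optimalValue_le (M := M) hm
  refine ⟨k, hk0, fun x => ?_⟩
  have := hk x
  rwa [← ofReal_optimalValueReal hm, ENNReal.ofReal_le_ofReal_iff (by positivity)] at this

/-- The continuity of the value function allows to use finitely many strategies on bounded sets. -/
theorem exists_grid (hm : 1 ≤ m) (hc : Continuous M.optimalValueReal) (B : ℝ≥0) {ε : ℝ≥0}
    (hε : 0 < ε) : ∃ (c : ℝ≥0 → ℕ) (z : ℕ → ℝ≥0), Measurable c ∧ (∀ y, z (c y) ≤ y) ∧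
      ∀ y ≤ B, M.optimalValue y ≤ M.optimalValue (z (c y)) + ε := by
  have huc := (isCompact_Icc (a := (0 : ℝ≥0)) (b := B)).uniformContinuousOn_of_continuous
    hc.continuousOn
  obtain ⟨r, hr, hur⟩ := Metric.uniformContinuousOn_iff.1 huc ε (by exact_mod_cast hε)
  set s : ℝ≥0 := (r / 2).toNNReal with hs
  have hs0 : 0 < s := Real.toNNReal_pos.2 (by linarith)
  have hle : ∀ y : ℝ≥0, (⌊y / s⌋₊ : ℝ≥0) * s ≤ y := fun y =>
    (le_div_iff₀ hs0).1 (Nat.floor_le zero_le)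
  refine ⟨fun y => ⌊y / s⌋₊, fun i => i * s, Nat.measurable_floor.comp (measurable_id.div_const s),
    hle, fun y hy => ?_⟩
  have h1 : y ≤ (⌊y / s⌋₊ : ℝ≥0) * s + s := by
    have := (div_le_iff₀ hs0).1 (Nat.lt_floor_add_one (y / s)).le
    rwa [add_mul, one_mul] at this
  have h2 := hur y ⟨zero_le, hy⟩ ((⌊y / s⌋₊ : ℝ≥0) * s) ⟨zero_le, (hle y).trans hy⟩ (by
    have h1' : (y : ℝ) ≤ (((⌊y / s⌋₊ : ℝ≥0) * s : ℝ≥0) : ℝ) + s := by exact_mod_cast h1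
    have h2' : (((⌊y / s⌋₊ : ℝ≥0) * s : ℝ≥0) : ℝ) ≤ y := by exact_mod_cast hle y
    have hs' : (s : ℝ) = r / 2 := Real.coe_toNNReal _ (by linarith)
    rw [NNReal.dist_eq, abs_of_nonneg (by linarith)]
    linarith)
  rw [Real.dist_eq] at h2
  have h3 := (le_abs_self _).trans h2.le
  rw [← ofReal_optimalValueReal hm, ← ofReal_optimalValueReal hm, ← ENNReal.ofReal_coe_nnreal,
    ← ENNReal.ofReal_add (optimalValueReal_nonneg _) (NNReal.coe_nonneg ε)]
  exact ENNReal.ofReal_le_ofReal (by linarith)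

/-- The scenarios with one event are now included, which is possible since continuity provides the
grid. After a claim, the premium income is dropped by monotonicity, leaving the claim integral at x.
-/
theorem wait_le_optimalValueReal (hm : 1 ≤ m) (hL : ClassL M.optimalValueReal)
    {R : Fin n → ℝ≥0 → ℝ≥0} (hR : M.IsContract R) (hp : 0 ≤ M.netPremium R) {h : ℝ≥0} (hh : 0 < h)
    (x : ℝ≥0) :
    Real.exp (-((M.δ + M.totalRate) * h)) *
      (M.optimalValueReal (x + (M.netPremium R).toNNReal * h) + h * (M.totalRate *
        ∫ a in Set.Iic x, M.optimalValueReal (x - a) ∂(M.claimLaw R))) ≤ M.optimalValueReal x := by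
  classical
  have hβ := M.totalRate_pos hm
  have := M.isProbabilityMeasure_claimLaw hm hR.measurable
  set y₀ := x + (M.netPremium R).toNNReal * h with hy₀
  set I := ∫ a in Set.Iic x, M.optimalValueReal (x - a) ∂(M.claimLaw R) with hI
  have hI0 : 0 ≤ I := integral_nonneg fun _ => optimalValueReal_nonneg _
  have key := wait_le_optimalValue hm hR hp hh 0 x (f := M.optimalValue)
    (fun ε hε => exists_grid hm hL.continuous _ hε)
  rw [ENNReal.coe_zero, zero_add, add_zero, ← hy₀] at key
  have hmeas : Measurable fun a => (Set.Iic x).indicator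
      (fun a => ENNReal.ofReal (M.optimalValueReal (x - a))) a :=
    Measurable.indicator (ENNReal.measurable_ofReal.comp
      (hL.continuous.comp (by fun_prop)).measurable) measurableSet_Iic
  have hsum : ENNReal.ofReal (M.totalRate * I) = ∑ k, ENNReal.ofReal (M.β k) *
      ∫⁻ y, (Set.Iic x).indicator (fun a => ENNReal.ofReal (M.optimalValueReal (x - a)))
        (retained R y) ∂(M.hitLaw k) := by
    rw [← M.rate_mul_lintegral_claimLaw hm hR.measurable hmeas, ENNReal.ofReal_mul hβ.le,
      lintegral_indicator measurableSet_Iic, hI, ofReal_integral_eq_lintegral_ofReal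
        (hL.integrableOn_shift _ x) (ae_of_all _ fun a => optimalValueReal_nonneg _)]
  have hE : Real.exp (-((M.δ + M.totalRate) * h)) =
      Real.exp (-(M.totalRate * h)) * Real.exp (-(M.δ * h)) := by
    rw [← Real.exp_add]; congr 1; ring
  have hlow : ENNReal.ofReal (Real.exp (-((M.δ + M.totalRate) * h)) * (h * (M.totalRate * I))) ≤
      ∑ k, ENNReal.ofReal (M.β k * h * Real.exp (-(M.totalRate * h))) * ∫⁻ y,
      (if retained R y ≤ x then ENNReal.ofReal (Real.exp (-(M.δ * h))) *
        M.optimalValue (y₀ - retained R y) else 0) ∂(M.hitLaw k) := by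
    rw [← mul_assoc, ENNReal.ofReal_mul (by positivity), hsum, Finset.mul_sum]
    refine Finset.sum_le_sum fun k _ => ?_
    have hk := (M.β_pos k).le
    have h1 : ∫⁻ y, ENNReal.ofReal (Real.exp (-(M.δ * h))) *
        (Set.Iic x).indicator (fun a => ENNReal.ofReal (M.optimalValueReal (x - a)))
        (retained R y) ∂(M.hitLaw k) ≤ ∫⁻ y,
      (if retained R y ≤ x then ENNReal.ofReal (Real.exp (-(M.δ * h))) *
        M.optimalValue (y₀ - retained R y) else 0) ∂(M.hitLaw k) := by
      refine lintegral_mono fun y => ?_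
      simp only [Set.indicator_apply, Set.mem_Iic]
      split_ifs
      · rw [ofReal_optimalValueReal hm]
        exact mul_le_mul_right (monotone_optimalValue (tsub_le_tsub_right le_self_add _)) _
      · simp
    refine le_trans (le_of_eq ?_) (mul_le_mul_right h1 _)
    rw [lintegral_const_mul (f := fun y => (Set.Iic x).indicator (fun a =>
      ENNReal.ofReal (M.optimalValueReal (x - a))) (retained R y)) _
      (hmeas.comp (measurable_retained hR.measurable)), ← mul_assoc,
      ← mul_assoc, ← ENNReal.ofReal_mul (by positivity), ← ENNReal.ofReal_mul (by positivity), hE]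
    congr 2
    ring
  have key' := (add_le_add le_rfl hlow).trans key
  rw [← ofReal_optimalValueReal hm, ← ofReal_optimalValueReal hm, ← mul_assoc,
    ← ENNReal.ofReal_mul (Real.exp_pos _).le, ← hE, ← ENNReal.ofReal_mul (Real.exp_pos _).le,
    ← ENNReal.ofReal_add (mul_nonneg (Real.exp_pos _).le (optimalValueReal_nonneg _))
      (by positivity), ENNReal.ofReal_le_ofReal_iff (optimalValueReal_nonneg _)] at key'
  rwa [mul_add]

theorem eventually_ge_of_mem_subDiff {u : ℝ≥0 → ℝ} {x : ℝ≥0} {d κ : ℝ} (hd : d ∈ subDiff u x)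
    (hκ : 0 < κ) : ∀ᶠ y : ℝ≥0 in 𝓝[>] x, (d - κ) * ((y : ℝ) - x) ≤ u y - u x := by
  have h1 : ((d - κ : ℝ) : EReal) < liminf (diffQuot u x) (𝓝[>] x) :=
    lt_of_lt_of_le (EReal.coe_lt_coe_iff.2 (by linarith)) hd.1
  filter_upwards [eventually_lt_of_lt_liminf h1, self_mem_nhdsWithin] with y hy hxy
  have hpos : (0 : ℝ) < y - x := sub_pos.2 (by exact_mod_cast hxy)
  rw [diffQuot, EReal.coe_lt_coe_iff, lt_div_iff₀ hpos] at hy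
  exact hy.le

/-- Unit increments give d ≥ 1. For a contract with nonpositive premium the generator inequality is
trivial, since a claim cannot raise the value. For a positive premium p, expand the waiting
inequality to first order in h, with a subgradient bounding V(x + p h) from below. -/
theorem isViscositySuper_optimalValueReal (hm : 1 ≤ m)
    (hM : ∃ R : Fin n → ℝ≥0 → ℝ≥0, M.IsContract R ∧ 0 ≤ M.netPremium R) :
    M.IsViscositySuper M.optimalValueReal := by
  have hL := classL_optimalValueReal hm hM
  have hβ := M.totalRate_pos hm
  have hδ := M.δ_pos
  refine ⟨hL.locallyLipschitz, fun x hx d hd => ?_⟩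
  have hd1 : 1 ≤ d := by
    refine ge_of_mem_subDiff hx hd ?_
    filter_upwards [self_mem_nhdsWithin] with y hy
    rw [one_mul]
    exact hL.increment y x hy
  refine hjb_nonpos_iff.2 ⟨hd1, fun R hR => ?_⟩
  have := M.isProbabilityMeasure_claimLaw hm hR.measurable
  rw [generator]
  set I := ∫ a in Set.Iic x, M.optimalValueReal (x - a) ∂(M.claimLaw R) with hI
  have hV := optimalValueReal_nonneg (M := M) x
  rcases le_or_gt (M.netPremium R) 0 with hp | hp
  · have h1 := setIntegral_shift_le hL.monotone (optimalValueReal_nonneg 0) (M.claimLaw R) x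
    have h2 := mul_le_mul_of_nonneg_left h1 hβ.le
    have h3 := mul_nonneg hδ.le hV
    have h4 := mul_nonpos_of_nonpos_of_nonneg hp (zero_le_one.trans hd1)
    linarith
  have hp' : 0 < (M.netPremium R).toNNReal := Real.toNNReal_pos.2 hp
  have hpc : ((M.netPremium R).toNNReal : ℝ) = M.netPremium R := Real.coe_toNNReal _ hp.le
  set p := M.netPremium R with hpdef
  have key : ∀ κ : ℝ, 0 < κ →
      (d - κ) * p + M.totalRate * I ≤ (M.δ + M.totalRate) * M.optimalValueReal x := by
    intro κ hκ
    have hc : Continuous fun h : ℝ≥0 => (M.δ + M.totalRate) *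
        Real.exp ((M.δ + M.totalRate) * h) * M.optimalValueReal x := by fun_prop
    have hlim := (hc.tendsto 0).mono_left (nhdsWithin_le_nhds (s := Set.Ioi 0))
    simp only [NNReal.coe_zero, mul_zero, Real.exp_zero, mul_one] at hlim
    refine ge_of_tendsto hlim ?_
    -- Positivity of p makes the surplus approach x strictly from the right, the side on which the
    -- subdifferential bounds increments from below.
    have htend : Tendsto (fun h : ℝ≥0 => x + p.toNNReal * h) (𝓝[>] 0) (𝓝[>] x) := by
      refine tendsto_nhdsWithin_iff.2 ⟨?_, ?_⟩
      · have : Continuous fun h : ℝ≥0 => x + p.toNNReal * h := by fun_prop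
        simpa using (this.tendsto 0).mono_left (nhdsWithin_le_nhds (s := Set.Ioi 0))
      · filter_upwards [self_mem_nhdsWithin] with h hh
        exact lt_add_of_pos_right _ (mul_pos hp' hh)
    filter_upwards [self_mem_nhdsWithin, htend.eventually (eventually_ge_of_mem_subDiff hd hκ)]
      with h hh hdiff
    have hh' : (0 : ℝ) < h := by exact_mod_cast hh
    have h1 := wait_le_optimalValueReal hm hL hR hp.le hh x
    rw [← hpdef, ← hI] at h1
    set t := (M.δ + M.totalRate) * (h : ℝ) with ht
    have h2 := mul_le_mul_of_nonneg_left h1 (Real.exp_pos t).le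
    rw [← mul_assoc, ← Real.exp_add, add_neg_cancel, Real.exp_zero, one_mul] at h2
    have h3 := mul_le_mul_of_nonneg_right (exp_sub_one_le (t := t)) hV
    rw [NNReal.coe_add, NNReal.coe_mul, hpc, add_sub_cancel_left] at hdiff
    refine le_of_mul_le_mul_left ?_ hh'
    calc (h : ℝ) * ((d - κ) * p + M.totalRate * I)
        = (d - κ) * (p * h) + h * (M.totalRate * I) := by ring
      _ ≤ t * Real.exp t * M.optimalValueReal x := by linarith
      _ = _ := by rw [ht]; ring
  have hc : Continuous fun κ : ℝ => (d - κ) * p + M.totalRate * I := by fun_prop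
  have hlim := (hc.tendsto 0).mono_left (nhdsWithin_le_nhds (s := Set.Ioi 0))
  rw [sub_zero] at hlim
  have := le_of_tendsto hlim (by filter_upwards [self_mem_nhdsWithin] with κ hκ using key κ hκ)
  linarith

theorem optimalValueReal_le_of_super (hm : 1 ≤ m)
    (hM : ∃ R : Fin n → ℝ≥0 → ℝ≥0, M.IsContract R ∧ 0 ≤ M.netPremium R) {u : ℝ≥0 → ℝ}
    (hu : ClassL u) (hs : M.IsViscositySuper u) (x : ℝ≥0) : M.optimalValueReal x ≤ u x := by
  have h0 : 0 ≤ u x := (hs.zero_nonneg hm hM hu).trans (hu.monotone zero_le)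
  rw [← ENNReal.ofReal_le_ofReal_iff h0, ofReal_optimalValueReal hm]
  exact optimalValue_le_of_super hm hM hs hu x

end RiskModel
end

theorem proposition4p4 {m n : ℕ} (hm : 1 ≤ m) (hn : 2 ≤ n) (M : RiskModel m n)
    (hM : ∃ R : Fin n → ℝ≥0 → ℝ≥0, M.IsContract R ∧ 0 ≤ M.netPremium R) :
    (∀ x, M.optimalValue x < ⊤) ∧
    IsLeast {u : ℝ≥0 → ℝ | ClassL u ∧ M.IsViscositySuper u} (fun x => (M.optimalValue x).toReal) ∧
    ((∀ j, IsSeqCompact (M.fam j)) →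
      ∀ u : ℝ≥0 → ℝ, (u ∈ M.LStar ∧ IsGLB ((fun w : ℝ≥0 → ℝ => w 0) '' M.LStar) (u 0)) ↔
        u = fun x => (M.optimalValue x).toReal) := by
  have hL := M.classL_optimalValueReal hm hM
  have hS := M.isViscositySuper_optimalValueReal hm hM
  have hle : ∀ w, ClassL w → M.IsViscositySuper w → ∀ x, M.optimalValueReal x ≤ w x :=
    fun w hw hs => RiskModel.optimalValueReal_le_of_super hm hM hw hs
  change _ ∧ IsLeast _ M.optimalValueReal ∧ (_ → ∀ u, _ ↔ u = M.optimalValueReal)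
  refine ⟨RiskModel.optimalValue_lt_top hm, ⟨⟨hL, hS⟩, fun w hw => hle w hw.1 hw.2⟩,
    fun hc u => ?_⟩
  -- Compactness enters only here. Since V itself is in L*, the infimum of the values at 0 is
  -- attained by V.
  have hV : M.optimalValueReal ∈ M.LStar := ⟨hL, RiskModel.isViscositySub_of_least hL hS
    (RiskModel.optimalValueReal_nonneg 0) hm hc hle, hS⟩
  constructor
  · rintro ⟨hu, hglb⟩
    have h0 : u 0 ≤ M.optimalValueReal 0 := hglb.1 ⟨_, hV, rfl⟩
    -- Comparison gives u ≤ V from u(0) ≤ V(0); the other inequality is the minimality of V among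
    -- supersolutions.
    exact funext fun x => le_antisymm
      (hu.2.1.le_of_super hm hu.1 hS hL (RiskModel.optimalValueReal_nonneg 0) h0 x)
      (hle u hu.1 hu.2.2 x)
  · rintro rfl
    refine ⟨hV, ?_, fun b hb => hb ⟨_, hV, rfl⟩⟩
    rintro _ ⟨w, hw, rfl⟩
    exact hle w hw.1 hw.2.2 0
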